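/- **Notation.** For $n\ge 0$ let $\mathcal{PT}_n$ be the monoid of all partial transformations of $X_n=\{1,\dots,n\}$ (maps written on the right and composed from left to right), $\mathcal T_n$ the submonoid of full transformations, and $\mathcal I_n$ the submonoid of partial injective transformations. Let $Q\in\{\mathcal T,\mathcal{PT},\mathcal I\}$. Put $0*=1$ if $Q=\mathcal T$ and $0*=0$ otherwise. The rank $|f|$ is the size of the image of $f$. In a finite monoid $S$, $a\,\mathcal H\,b$ means $aS=bS$ and $Sa=Sb$, and $a\,\mathcal D\,b$ means $SaS=SbS$. For $P\subseteq\{0*,\dots,m\}\times\{0*,\dots,n\}$ let $D_P=\{(f,g)\in Q_m\times Q_n : (|f|,|g|)\in P\}$, and $D_{i,j}=D_{\{(i,j)\}}$. $S_i$ is the symmetric group on $\{1,\dots,i\}$, $\varepsilon_i$ its trivial subgroup, and $\pi_1,\pi_2$ are the coordinate projections. For each $\mathcal H$-class of $Q_m$ (and, independently, of $Q_n$) fix an arbitrary linear order $a_1<\dots<a_i$ on the common image of its elements; for $f$ in the class and $\omega\in S_i$ let $f\cdot\omega$ be the map with the same domain as $f$ that sends $x$ to $a_{k\omega}$ whenever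 $xf=a_k$. **Theorem.** Assume that $Q_m$ and $Q_n$ are non-trivial. Let $\mathcal P$ be a partition of $Q_m\times Q_n$ into unions of $\mathcal D$-classes; associate with each part $B$ a type from $\{F,\mathcal H,\varepsilon\}^2$ and, if this type is not $FF$, a group $N_B$, such that the following conditions hold. 1. There is at most one part of type $FF$; such a part is $B=D_P$ for a downward-closed $P\subseteq\{0*,\dots,m\}\times\{0*,\dots,n\}$ (componentwise order) with $P\ne\{0\}\times\{0,\dots,j\}$ for all $j\in\{0,\dots,n\}$ and $P\ne\{0,\dots,i\}\times\{0\}$ for all $i\in\{0,\dots,m\}$. 2. If $B$ has type $\mathcal HF$ or $\varepsilon F$, then $B=D_P$ with $P=\{i\}\times\{0*,\dots,j\}$ for some $0*\le i\le m$, $1\le j\le n$, and $N_B\trianglelefteq S_i$. For type $\mathcal HF$, moreover $i\ge2$ and $N_B\ne\varepsilon_i$; for type $\varepsilon F$, $N_B=\varepsilon_i$. 3. If $B$ has type $F\mathcal H$ or $F\varepsilon$, then $B=D_P$ with $P=\{0*,\dots,i\}\times\{j\}$ for some $1\le i\le m$, $0*\le j\le n$, and $N_B\trianglelefteq S_j$.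 For type $F\mathcal H$, moreover $j\ge2$ and $N_B\ne\varepsilon_j$; for type $F\varepsilon$, $N_B=\varepsilon_j$. 4. There is at most one part of type $\mathcal HF$; if $D_{\{i\}\times\{0*,\dots,j\}}$ is such a part, then there is a part of type $FF$ containing $D_{\{0*,\dots,i-1\}\times\{0*,\dots,j\}}$. 5. There is at most one part of type $F\mathcal H$; if $D_{\{0*,\dots,i\}\times\{j\}}$ is such a part, then there is a part of type $FF$ containing $D_{\{0*,\dots,i\}\times\{0*,\dots,j-1\}}$. 6. Let $J$ be the set of pairs $(i,j_i)$ such that $D_{\{i\}\times\{0*,\dots,j_i\}}$ is a part of type $\varepsilon F$. Then $\pi_1(J)$ is a (possibly empty) set of consecutive integers, and $j_i$ is non-increasing in $i$. If $J\neq\emptyset$ and $i'=\min\pi_1(J)>0*$, then some part of type $\mathcal HF$ or $FF$ contains $D_{\{i'-1\}\times\{0*,\dots,j_{i'}\}}$. 7. Let $J'$ be the set of pairs $(i_j,j)$ such that $D_{\{0*,\dots,i_j\}\times\{j\}}$ is a part of type $F\varepsilon$. Then $\pi_2(J')$ is a (possibly empty) set of consecutive integers, and $i_j$ is non-increasing in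 $j$. If $J'\neq\emptyset$ and $j'=\min\pi_2(J')>0*$, then some part of type $F\mathcal H$ or $FF$ contains $D_{\{0*,\dots,i_{j'}\}\times\{j'-1\}}$. 8. If $B$ has type $\mathcal{HH}$, $\varepsilon\mathcal H$, $\mathcal H\varepsilon$ or $\varepsilon\varepsilon$, then $B=D_{i,j}$ for some $0*\le i\le m$, $0*\le j\le n$, and $N_B\trianglelefteq S_i\times S_j$. Moreover: (a) for type $\mathcal{HH}$, $i,j\ge2$, $\pi_1(N_B)\ne\varepsilon_i$ and $\pi_2(N_B)\ne\varepsilon_j$; (b) for type $\varepsilon\mathcal H$, $j\ge2$ and $N_B=\varepsilon_i\times N'$ for some $N'\ne\varepsilon_j$; (c) for type $\mathcal H\varepsilon$, $i\ge2$ and $N_B=N'\times\varepsilon_j$ for some $N'\ne\varepsilon_i$; (d) for type $\varepsilon\varepsilon$, $N_B=\varepsilon_i\times\varepsilon_j$. 9. If $B=D_{i,j}$ has type $\mathcal{HH}$, then the part $B'$ containing $D_{i,j-1}$ either has type $FF$, or has type $\mathcal HF$ and $\pi_1(N_B)\subseteq N_{B'}$; and the part $B''$ containing $D_{i-1,j}$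 either has type $FF$, or has type $F\mathcal H$ and $\pi_2(N_B)\subseteq N_{B''}$. 10. If $B=D_{i,j}$ has type $\varepsilon\mathcal H$ with $N_B=\varepsilon_i\times N'$, then the part containing $D_{i,j-1}$ has type $FF$, $\mathcal HF$ or $\varepsilon F$. If moreover $i>0*$, then the part $B''$ containing $D_{i-1,j}$ has type $FF$, $\mathcal HF$ or $\varepsilon F$; or has type $F\mathcal H$ with $N'\subseteq N_{B''}$; or has type $\mathcal{HH}$ or $\varepsilon\mathcal H$ with $\varepsilon_{i-1}\times N'\subseteq N_{B''}$. 11. If $B=D_{i,j}$ has type $\mathcal H\varepsilon$ with $N_B=N'\times\varepsilon_j$, then the part containing $D_{i-1,j}$ has type $FF$, $F\mathcal H$ or $F\varepsilon$. If moreover $j>0*$, then the part $B''$ containing $D_{i,j-1}$ has type $FF$, $F\mathcal H$ or $F\varepsilon$; or has type $\mathcal HF$ with $N'\subseteq N_{B''}$; or has type $\mathcal{HH}$ or $\mathcal H\varepsilon$ with $N'\times\varepsilon_{j-1}\subseteq N_{B''}$. On each part $B$ define a relation $\theta_B$: if $B$ has type $FF$, $\theta_B=B\times B$; if $B$ has type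 $\mathcal HF$ or $\varepsilon F$, then $(f,g)\,\theta_B\,(f',g')$ iff $f\,\mathcal H\,f'$ and $f'=f\cdot\sigma$ for some $\sigma\in N_B$; if $B$ has type $F\mathcal H$ or $F\varepsilon$, then $(f,g)\,\theta_B\,(f',g')$ iff $g\,\mathcal H\,g'$ and $g'=g\cdot\sigma$ for some $\sigma\in N_B$; if $B$ has type $\mathcal{HH}$, $\varepsilon\mathcal H$, $\mathcal H\varepsilon$ or $\varepsilon\varepsilon$, then $(f,g)\,\theta_B\,(f',g')$ iff $f\,\mathcal H\,f'$, $g\,\mathcal H\,g'$ and $(f',g')=(f\cdot\sigma,g\cdot\tau)$ for some $(\sigma,\tau)\in N_B$. Then $\theta=\bigcup_{B\in\mathcal P}\theta_B$ is a congruence on $Q_m\times Q_n$. Conversely, every congruence on $Q_m\times Q_n$ is obtained in this way from some such data. -/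

import Mathlib

/-! ### The monoids of (partial, full, partial injective) transformations

Maps are written on the right: in `f * g` one applies `f` first and then `g`. A partial
transformation of an `n`-element set is a function `Fin n → Option (Fin n)`, the value `none`
meaning "undefined". -/

/-- Partial transformations of an `n`-element set. -/
def PTrans (n : ℕ) : Type := Fin n → Option (Fin n)

instance (n : ℕ) : Monoid (PTrans n) where
  mul f g := fun x => (f x).bind g
  one := fun x => some x
  mul_assoc f g h := funext fun x => Option.bind_assoc (f x) g h
  one_mul _ := rfl
  mul_one f := funext fun x => Option.bind_fun_some (f x)

theorem PTrans.mul_apply {n : ℕ} (f g : PTrans n) (x : Fin n) : (f * g) x = (f x).bind g := rfl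

theorem PTrans.one_apply {n : ℕ} (x : Fin n) : (1 : PTrans n) x = some x := rfl

/-- The three families of transformation monoids: full transformations, partial
transformations, and partial injective transformations (the symmetric inverse monoid). -/
inductive Kind : Type
  | T
  | PT
  | I

/-- The condition on a partial transformation to belong to the given family. -/
def Kind.Mem (K : Kind) {n : ℕ} (f : PTrans n) : Prop :=
  match K with
  | Kind.T => ∀ x, ∃ y, f x = some y
  | Kind.PT => True
  | Kind.I => ∀ x₁ x₂ y, f x₁ = some y → f x₂ = some y → x₁ = x₂

/-- `𝒯ₙ`, `𝒫𝒯ₙ`, `ℐₙ` as submonoids of the monoid of all partial transformations. -/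
def Kind.submonoid (K : Kind) (n : ℕ) : Submonoid (PTrans n) where
  carrier := {f | K.Mem f}
  one_mem' := by
    cases K
    · exact fun x => ⟨x, rfl⟩
    · exact trivial
    · intro x₁ x₂ y h₁ h₂
      exact Option.some.inj (h₁.trans h₂.symm)
  mul_mem' := by
    intro f g hf hg
    cases K
    · intro x
      obtain ⟨y, hy⟩ := hf x
      obtain ⟨z, hz⟩ := hg y
      exact ⟨z, by rw [PTrans.mul_apply, hy]; exact hz⟩
    · exact trivial
    · intro x₁ x₂ y h₁ h₂
      obtain ⟨a, ha, ha'⟩ := Option.bind_eq_some_iff.1 h₁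
      obtain ⟨b, hb, hb'⟩ := Option.bind_eq_some_iff.1 h₂
      have hab : a = b := hg a b y ha' hb'
      subst hab
      exact hf x₁ x₂ a ha hb

/-- The monoid `Qₙ` for `Q ∈ {𝒯, 𝒫𝒯, ℐ}`. -/
abbrev Q (K : Kind) (n : ℕ) : Type := K.submonoid n

/-- The smallest rank `0*` occurring in `Q`: it is `1` for `𝒯` and `0` for `𝒫𝒯` and `ℐ`. -/
def Kind.zeroStar : Kind → ℕ
  | Kind.T => 1
  | Kind.PT => 0
  | Kind.I => 0

/-- The image of a transformation. -/
def Q.im {K : Kind} {n : ℕ} (f : Q K n) : Finset (Fin n) :=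
  Finset.univ.biUnion fun x => (f.1 x).toFinset

/-- The rank of a transformation: the size of its image. -/
def Q.rank {K : Kind} {n : ℕ} (f : Q K n) : ℕ := f.im.card

theorem Q.mem_im_iff {K : Kind} {n : ℕ} {f : Q K n} {y : Fin n} :
    y ∈ f.im ↔ ∃ x, f.1 x = some y := by
  simp [Q.im, Option.mem_toFinset]

theorem Q.mem_im {K : Kind} {n : ℕ} {f : Q K n} {x y : Fin n} (h : f.1 x = some y) :
    y ∈ f.im :=
  Q.mem_im_iff.2 ⟨x, h⟩

/-! ### Green's relations -/

/-- Green's relation `ℋ` of a monoid `S`: `aS = bS` and `Sa = Sb`. -/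
def GreenH {S : Type*} [Monoid S] (a b : S) : Prop :=
  {x | ∃ s, x = a * s} = {x | ∃ s, x = b * s} ∧ {x | ∃ s, x = s * a} = {x | ∃ s, x = s * b}

/-- Green's relation `𝒟` of a finite monoid `S` (where it coincides with `𝒥`): `SaS = SbS`. -/
def GreenD {S : Type*} [Monoid S] (a b : S) : Prop :=
  {x | ∃ s t, x = s * a * t} = {x | ∃ s t, x = s * b * t}

/-! ### The action of the symmetric groups on the `ℋ`-classes -/

/-- A choice, for each `ℋ`-class of `Qₙ`, of a linear order `a₁ < ⋯ < aᵢ` of the common image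
of the elements of the class. The order is recorded as the enumeration `k ↦ aₖ` of the image
(indices start at `0`); `compat` says that it depends only on the `ℋ`-class. -/
structure ImageOrder (K : Kind) (n : ℕ) where
  enum : ∀ (f : Q K n) {i : ℕ}, f.rank = i → (Fin i ≃ {y : Fin n // y ∈ f.im})
  compat : ∀ (f g : Q K n), GreenH f g → ∀ (i : ℕ) (hf : f.rank = i) (hg : g.rank = i)
    (k : Fin i), (enum f hf k : Fin n) = (enum g hg k : Fin n)

theorem GreenH.im_eq {K : Kind} {n : ℕ} {f g : Q K n} (h : GreenH f g) : f.im = g.im := by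
  have key : ∀ a b : Q K n, a ∈ {x | ∃ s, x = s * b} → a.im ⊆ b.im := by
    rintro a b ⟨s, rfl⟩ y hy
    obtain ⟨x, hx⟩ := Q.mem_im_iff.1 hy
    obtain ⟨z, -, hz⟩ := Option.bind_eq_some_iff.1 hx
    exact Q.mem_im hz
  refine Finset.Subset.antisymm (key f g ?_) (key g f ?_)
  · rw [← h.2]
    exact ⟨1, (one_mul f).symm⟩
  · rw [h.2]
    exact ⟨1, (one_mul g).symm⟩

/-- Such choices exist, e.g. the usual order of `Fin n` on every image. -/
instance (K : Kind) (n : ℕ) : Nonempty (ImageOrder K n) :=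
  ⟨{ enum := fun f _ h => (f.im.orderIsoOfFin h).toEquiv
     compat := by
      intro f g h i hf hg k
      have key : ∀ (s t : Finset (Fin n)) (hs : s.card = i) (ht : t.card = i), s = t →
          ((s.orderIsoOfFin hs k : s) : Fin n) = ((t.orderIsoOfFin ht k : t) : Fin n) := by
        intro s t hs ht hst
        subst hst
        rfl
      exact key f.im g.im hf hg h.im_eq }⟩

/-- The element `f · ω` for `f` of rank `i` and `ω ∈ Sᵢ`: it is defined where `f` is, and if `f`
sends `x` to `aₖ`, then `f · ω` sends `x` to `a_{ω k}`. -/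
def ImageOrder.act {K : Kind} {n : ℕ} (o : ImageOrder K n) (f : Q K n) {i : ℕ}
    (hf : f.rank = i) (ω : Equiv.Perm (Fin i)) : Q K n :=
  ⟨fun x => Option.pmap
      (fun (y : Fin n) (hy : y ∈ f.im) =>
        (o.enum f hf (ω ((o.enum f hf).symm ⟨y, hy⟩)) : Fin n))
      (f.1 x) (fun _ hy => Q.mem_im hy), by
    have hmem : K.Mem f.1 := f.2
    change K.Mem _
    cases K
    · intro x
      obtain ⟨y, hy⟩ := hmem x
      exact ⟨_, Option.pmap_eq_some_iff.2 ⟨y, Q.mem_im hy, hy, rfl⟩⟩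
    · exact trivial
    · intro x₁ x₂ y h₁ h₂
      obtain ⟨a, ha, ha', h₁⟩ := Option.pmap_eq_some_iff.1 h₁
      obtain ⟨b, hb, hb', h₂⟩ := Option.pmap_eq_some_iff.1 h₂
      have h := Subtype.ext (h₁.symm.trans h₂)
      have hab : a = b := by simpa using h
      subst hab
      exact hmem x₁ x₂ a ha' hb'⟩

/-! ### Labelled partitions of `Q_m × Q_n` -/

/-- The three possible component types `F`, `ℋ`, `ε` of a part. -/
inductive CompType : Type
  | F
  | H
  | E

/-- A group attached to a part: a subgroup of `Sᵢ` used in the first coordinate, a subgroup of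
`Sⱼ` used in the second coordinate, or a subgroup of `Sᵢ × Sⱼ`. (Each `S_k` enters only
through its normal subgroups, so it does not matter in which order permutations compose.) -/
inductive PartGroup : Type
  | left (i : ℕ) (N : Subgroup (Equiv.Perm (Fin i)))
  | right (j : ℕ) (N : Subgroup (Equiv.Perm (Fin j)))
  | both (i j : ℕ) (N : Subgroup (Equiv.Perm (Fin i) × Equiv.Perm (Fin j)))

/-- `D_P`: the set of pairs `(f, g) ∈ Q_m × Q_n` whose pair of ranks belongs to `P`. -/
def DSet (K : Kind) (m n : ℕ) (P : Set (ℕ × ℕ)) : Set (Q K m × Q K n) :=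
  {p | (p.1.rank, p.2.rank) ∈ P}

/-- A partition of `Q_m × Q_n` into unions of `𝒟`-classes, together with a type in
`{F, ℋ, ε}²` and a group for each part. Only the values of `ty` at parts, and the values of
`grp` at parts of type different from `FF`, are ever used. -/
structure LabelledPartition (K : Kind) (m n : ℕ) where
  parts : Set (Set (Q K m × Q K n))
  isPartition : Setoid.IsPartition parts
  preservesD : ∀ B ∈ parts, ∀ x y, GreenD x y → x ∈ B → y ∈ B
  ty : Set (Q K m × Q K n) → CompType × CompType
  grp : Set (Q K m × Q K n) → PartGroup

namespace LabelledPartition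

variable {K : Kind} {m n : ℕ}

/-- The relation `θ_B` on a part `B`. -/
def partRel (L : LabelledPartition K m n) (o₁ : ImageOrder K m) (o₂ : ImageOrder K n)
    (B : Set (Q K m × Q K n)) (p q : Q K m × Q K n) : Prop :=
  p ∈ B ∧ q ∈ B ∧
  match L.ty B with
  | (CompType.F, CompType.F) => True
  | (_, CompType.F) =>
      ∃ (i : ℕ) (N : Subgroup (Equiv.Perm (Fin i))), L.grp B = PartGroup.left i N ∧
        GreenH p.1 q.1 ∧ ∃ (hp : p.1.rank = i), ∃ σ ∈ N, q.1 = o₁.act p.1 hp σ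
  | (CompType.F, _) =>
      ∃ (j : ℕ) (N : Subgroup (Equiv.Perm (Fin j))), L.grp B = PartGroup.right j N ∧
        GreenH p.2 q.2 ∧ ∃ (hp : p.2.rank = j), ∃ σ ∈ N, q.2 = o₂.act p.2 hp σ
  | (_, _) =>
      ∃ (i j : ℕ) (N : Subgroup (Equiv.Perm (Fin i) × Equiv.Perm (Fin j))),
        L.grp B = PartGroup.both i j N ∧ GreenH p.1 q.1 ∧ GreenH p.2 q.2 ∧
        ∃ (hp₁ : p.1.rank = i) (hp₂ : p.2.rank = j), ∃ στ ∈ N,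
          q.1 = o₁.act p.1 hp₁ στ.1 ∧ q.2 = o₂.act p.2 hp₂ στ.2

/-- The relation `θ = ⋃_B θ_B` on `Q_m × Q_n`. -/
def rel (L : LabelledPartition K m n) (o₁ : ImageOrder K m) (o₂ : ImageOrder K n)
    (p q : Q K m × Q K n) : Prop :=
  ∃ B ∈ L.parts, L.partRel o₁ o₂ B p q

/-- The pairs `(i, j)` such that `{i} × {0*, …, j}` is the index set of a part of type `εF`. -/
def colSet (L : LabelledPartition K m n) : Set (ℕ × ℕ) :=
  {x | x.1 ∈ Set.Icc K.zeroStar m ∧ x.2 ∈ Set.Icc K.zeroStar n ∧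
    ∃ B ∈ L.parts, L.ty B = (CompType.E, CompType.F) ∧
      B = DSet K m n ({x.1} ×ˢ Set.Icc K.zeroStar x.2)}

/-- The pairs `(i, j)` such that `{0*, …, i} × {j}` is the index set of a part of type `Fε`. -/
def rowSet (L : LabelledPartition K m n) : Set (ℕ × ℕ) :=
  {x | x.1 ∈ Set.Icc K.zeroStar m ∧ x.2 ∈ Set.Icc K.zeroStar n ∧
    ∃ B ∈ L.parts, L.ty B = (CompType.F, CompType.E) ∧
      B = DSet K m n (Set.Icc K.zeroStar x.1 ×ˢ {x.2})}

/-- The shape and placement conditions on the parts, their types and their groups. -/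
structure Admissible (L : LabelledPartition K m n) : Prop where
  /-- There is at most one part of type `FF`. -/
  ff_unique : ∀ B ∈ L.parts, ∀ B' ∈ L.parts, L.ty B = (CompType.F, CompType.F) →
    L.ty B' = (CompType.F, CompType.F) → B = B'
  /-- Shape of a part of type `FF`. -/
  ff_shape : ∀ B ∈ L.parts, L.ty B = (CompType.F, CompType.F) →
    ∃ P : Set (ℕ × ℕ), P ⊆ Set.Icc K.zeroStar m ×ˢ Set.Icc K.zeroStar n ∧
      (∀ x ∈ P, ∀ y ∈ Set.Icc K.zeroStar m ×ˢ Set.Icc K.zeroStar n, y ≤ x → y ∈ P) ∧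
      B = DSet K m n P ∧
      (∀ j ≤ n, P ≠ {0} ×ˢ Set.Icc 0 j) ∧
      (∀ i ≤ m, P ≠ Set.Icc 0 i ×ˢ {0})
  /-- Shape and group of a part of type `ℋF` or `εF`. -/
  col_shape : ∀ B ∈ L.parts,
    (L.ty B = (CompType.H, CompType.F) ∨ L.ty B = (CompType.E, CompType.F)) →
    ∃ (i j : ℕ) (N : Subgroup (Equiv.Perm (Fin i))),
      i ∈ Set.Icc K.zeroStar m ∧ j ∈ Set.Icc 1 n ∧
      B = DSet K m n ({i} ×ˢ Set.Icc K.zeroStar j) ∧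
      L.grp B = PartGroup.left i N ∧ N.Normal ∧
      (L.ty B = (CompType.H, CompType.F) → 2 ≤ i ∧ N ≠ ⊥) ∧
      (L.ty B = (CompType.E, CompType.F) → N = ⊥)
  /-- Shape and group of a part of type `Fℋ` or `Fε`. -/
  row_shape : ∀ B ∈ L.parts,
    (L.ty B = (CompType.F, CompType.H) ∨ L.ty B = (CompType.F, CompType.E)) →
    ∃ (i j : ℕ) (N : Subgroup (Equiv.Perm (Fin j))),
      i ∈ Set.Icc 1 m ∧ j ∈ Set.Icc K.zeroStar n ∧
      B = DSet K m n (Set.Icc K.zeroStar i ×ˢ {j}) ∧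
      L.grp B = PartGroup.right j N ∧ N.Normal ∧
      (L.ty B = (CompType.F, CompType.H) → 2 ≤ j ∧ N ≠ ⊥) ∧
      (L.ty B = (CompType.F, CompType.E) → N = ⊥)
  /-- There is at most one part of type `ℋF`. -/
  hf_unique : ∀ B ∈ L.parts, ∀ B' ∈ L.parts, L.ty B = (CompType.H, CompType.F) →
    L.ty B' = (CompType.H, CompType.F) → B = B'
  /-- Placement of a part of type `ℋF`. -/
  hf_place : ∀ B ∈ L.parts, L.ty B = (CompType.H, CompType.F) →
    ∀ i ∈ Set.Icc K.zeroStar m, ∀ j ∈ Set.Icc 1 n,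
      B = DSet K m n ({i} ×ˢ Set.Icc K.zeroStar j) →
      ∃ B' ∈ L.parts, L.ty B' = (CompType.F, CompType.F) ∧
        DSet K m n (Set.Icc K.zeroStar (i - 1) ×ˢ Set.Icc K.zeroStar j) ⊆ B'
  /-- There is at most one part of type `Fℋ`. -/
  fh_unique : ∀ B ∈ L.parts, ∀ B' ∈ L.parts, L.ty B = (CompType.F, CompType.H) →
    L.ty B' = (CompType.F, CompType.H) → B = B'
  /-- Placement of a part of type `Fℋ`. -/
  fh_place : ∀ B ∈ L.parts, L.ty B = (CompType.F, CompType.H) →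
    ∀ i ∈ Set.Icc 1 m, ∀ j ∈ Set.Icc K.zeroStar n,
      B = DSet K m n (Set.Icc K.zeroStar i ×ˢ {j}) →
      ∃ B' ∈ L.parts, L.ty B' = (CompType.F, CompType.F) ∧
        DSet K m n (Set.Icc K.zeroStar i ×ˢ Set.Icc K.zeroStar (j - 1)) ⊆ B'
  /-- The first indices of the parts of type `εF` are consecutive integers. -/
  ef_consecutive : (Prod.fst '' L.colSet).OrdConnected
  /-- The heights of the parts of type `εF` are non-increasing. -/
  ef_antitone : ∀ x ∈ L.colSet, ∀ y ∈ L.colSet, x.1 ≤ y.1 → y.2 ≤ x.2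
  /-- Placement of the first part of type `εF`. -/
  ef_place : ∀ x ∈ L.colSet, IsLeast (Prod.fst '' L.colSet) x.1 → K.zeroStar < x.1 →
    ∃ B' ∈ L.parts,
      (L.ty B' = (CompType.H, CompType.F) ∨ L.ty B' = (CompType.F, CompType.F)) ∧
      DSet K m n ({x.1 - 1} ×ˢ Set.Icc K.zeroStar x.2) ⊆ B'
  /-- The second indices of the parts of type `Fε` are consecutive integers. -/
  fe_consecutive : (Prod.snd '' L.rowSet).OrdConnected
  /-- The widths of the parts of type `Fε` are non-increasing. -/
  fe_antitone : ∀ x ∈ L.rowSet, ∀ y ∈ L.rowSet, x.2 ≤ y.2 → y.1 ≤ x.1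
  /-- Placement of the first part of type `Fε`. -/
  fe_place : ∀ x ∈ L.rowSet, IsLeast (Prod.snd '' L.rowSet) x.2 → K.zeroStar < x.2 →
    ∃ B' ∈ L.parts,
      (L.ty B' = (CompType.F, CompType.H) ∨ L.ty B' = (CompType.F, CompType.F)) ∧
      DSet K m n (Set.Icc K.zeroStar x.1 ×ˢ {x.2 - 1}) ⊆ B'
  /-- Shape and group of a part of type `ℋℋ`, `εℋ`, `ℋε` or `εε`. -/
  cell_shape : ∀ B ∈ L.parts, (L.ty B).1 ≠ CompType.F → (L.ty B).2 ≠ CompType.F →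
    ∃ (i j : ℕ) (N : Subgroup (Equiv.Perm (Fin i) × Equiv.Perm (Fin j))),
      i ∈ Set.Icc K.zeroStar m ∧ j ∈ Set.Icc K.zeroStar n ∧
      B = DSet K m n {(i, j)} ∧ L.grp B = PartGroup.both i j N ∧ N.Normal ∧
      (L.ty B = (CompType.H, CompType.H) → 2 ≤ i ∧ 2 ≤ j ∧
        N.map (MonoidHom.fst _ _) ≠ ⊥ ∧ N.map (MonoidHom.snd _ _) ≠ ⊥) ∧
      (L.ty B = (CompType.E, CompType.H) → 2 ≤ j ∧
        ∃ N' : Subgroup (Equiv.Perm (Fin j)), N' ≠ ⊥ ∧ N = Subgroup.prod ⊥ N') ∧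
      (L.ty B = (CompType.H, CompType.E) → 2 ≤ i ∧
        ∃ N' : Subgroup (Equiv.Perm (Fin i)), N' ≠ ⊥ ∧ N = Subgroup.prod N' ⊥) ∧
      (L.ty B = (CompType.E, CompType.E) → N = Subgroup.prod ⊥ ⊥)
  /-- Placement of a part of type `ℋℋ`: the part containing `D_{i,j-1}`. -/
  hh_place_snd : ∀ B ∈ L.parts, L.ty B = (CompType.H, CompType.H) →
    ∀ (i j : ℕ) (N : Subgroup (Equiv.Perm (Fin i) × Equiv.Perm (Fin j))),
      B = DSet K m n {(i, j)} → L.grp B = PartGroup.both i j N →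
      ∃ B' ∈ L.parts, DSet K m n {(i, j - 1)} ⊆ B' ∧
        (L.ty B' = (CompType.F, CompType.F) ∨
          L.ty B' = (CompType.H, CompType.F) ∧
            ∃ N' : Subgroup (Equiv.Perm (Fin i)), L.grp B' = PartGroup.left i N' ∧
              N.map (MonoidHom.fst _ _) ≤ N')
  /-- Placement of a part of type `ℋℋ`: the part containing `D_{i-1,j}`. -/
  hh_place_fst : ∀ B ∈ L.parts, L.ty B = (CompType.H, CompType.H) →
    ∀ (i j : ℕ) (N : Subgroup (Equiv.Perm (Fin i) × Equiv.Perm (Fin j))),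
      B = DSet K m n {(i, j)} → L.grp B = PartGroup.both i j N →
      ∃ B' ∈ L.parts, DSet K m n {(i - 1, j)} ⊆ B' ∧
        (L.ty B' = (CompType.F, CompType.F) ∨
          L.ty B' = (CompType.F, CompType.H) ∧
            ∃ N' : Subgroup (Equiv.Perm (Fin j)), L.grp B' = PartGroup.right j N' ∧
              N.map (MonoidHom.snd _ _) ≤ N')
  /-- Placement of a part of type `εℋ`: the part containing `D_{i,j-1}`. -/
  eh_place_snd : ∀ B ∈ L.parts, L.ty B = (CompType.E, CompType.H) →
    ∀ (i j : ℕ), B = DSet K m n {(i, j)} →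
      ∃ B' ∈ L.parts, DSet K m n {(i, j - 1)} ⊆ B' ∧
        (L.ty B' = (CompType.F, CompType.F) ∨ L.ty B' = (CompType.H, CompType.F) ∨
          L.ty B' = (CompType.E, CompType.F))
  /-- Placement of a part of type `εℋ`: the part containing `D_{i-1,j}`. -/
  eh_place_fst : ∀ B ∈ L.parts, L.ty B = (CompType.E, CompType.H) →
    ∀ (i j : ℕ) (N' : Subgroup (Equiv.Perm (Fin j))), B = DSet K m n {(i, j)} →
      L.grp B = PartGroup.both i j (Subgroup.prod ⊥ N') → K.zeroStar < i →
      ∃ B' ∈ L.parts, DSet K m n {(i - 1, j)} ⊆ B' ∧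
        (L.ty B' = (CompType.F, CompType.F) ∨
          L.ty B' = (CompType.H, CompType.F) ∨
          L.ty B' = (CompType.E, CompType.F) ∨
          (L.ty B' = (CompType.F, CompType.H) ∧
            ∃ M : Subgroup (Equiv.Perm (Fin j)), L.grp B' = PartGroup.right j M ∧ N' ≤ M) ∨
          ((L.ty B' = (CompType.H, CompType.H) ∨ L.ty B' = (CompType.E, CompType.H)) ∧
            ∃ M : Subgroup (Equiv.Perm (Fin (i - 1)) × Equiv.Perm (Fin j)),
              L.grp B' = PartGroup.both (i - 1) j M ∧ Subgroup.prod ⊥ N' ≤ M))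
  /-- Placement of a part of type `ℋε`: the part containing `D_{i-1,j}`. -/
  he_place_fst : ∀ B ∈ L.parts, L.ty B = (CompType.H, CompType.E) →
    ∀ (i j : ℕ), B = DSet K m n {(i, j)} →
      ∃ B' ∈ L.parts, DSet K m n {(i - 1, j)} ⊆ B' ∧
        (L.ty B' = (CompType.F, CompType.F) ∨ L.ty B' = (CompType.F, CompType.H) ∨
          L.ty B' = (CompType.F, CompType.E))
  /-- Placement of a part of type `ℋε`: the part containing `D_{i,j-1}`. -/
  he_place_snd : ∀ B ∈ L.parts, L.ty B = (CompType.H, CompType.E) →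
    ∀ (i j : ℕ) (N' : Subgroup (Equiv.Perm (Fin i))), B = DSet K m n {(i, j)} →
      L.grp B = PartGroup.both i j (Subgroup.prod N' ⊥) → K.zeroStar < j →
      ∃ B' ∈ L.parts, DSet K m n {(i, j - 1)} ⊆ B' ∧
        (L.ty B' = (CompType.F, CompType.F) ∨
          L.ty B' = (CompType.F, CompType.H) ∨
          L.ty B' = (CompType.F, CompType.E) ∨
          (L.ty B' = (CompType.H, CompType.F) ∧
            ∃ M : Subgroup (Equiv.Perm (Fin i)), L.grp B' = PartGroup.left i M ∧ N' ≤ M) ∨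
          ((L.ty B' = (CompType.H, CompType.H) ∨ L.ty B' = (CompType.H, CompType.E)) ∧
            ∃ M : Subgroup (Equiv.Perm (Fin i) × Equiv.Perm (Fin (j - 1))),
              L.grp B' = PartGroup.both i (j - 1) M ∧ Subgroup.prod N' ⊥ ≤ M))

end LabelledPartition

namespace Q

variable {K : Kind} {n : ℕ}

/-- The element of `Qₙ` given by a partial function with the appropriate properties. -/
def ofFun (K : Kind) {n : ℕ} (p : Fin n → Option (Fin n))
    (hT : K = Kind.T → ∀ x, ∃ y, p x = some y)
    (hI : K = Kind.I → ∀ x₁ x₂ y, p x₁ = some y → p x₂ = some y → x₁ = x₂) : Q K n :=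
  ⟨p, by
    change K.Mem p
    cases K
    · exact hT rfl
    · exact trivial
    · exact hI rfl⟩

theorem total (hK : K = Kind.T) (f : Q K n) (x : Fin n) : ∃ y, f.1 x = some y := by
  subst hK
  exact f.2 x

theorem injective (hK : K = Kind.I) (f : Q K n) {x₁ x₂ y : Fin n} (h₁ : f.1 x₁ = some y)
    (h₂ : f.1 x₂ = some y) : x₁ = x₂ := by
  subst hK
  exact f.2 x₁ x₂ y h₁ h₂

theorem coe_mul (f g : Q K n) (x : Fin n) : (f * g).1 x = (f.1 x).bind g.1 := rfl

theorem mul_apply_some {f g : Q K n} {x y : Fin n} (h : f.1 x = some y) :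
    (f * g).1 x = g.1 y := by
  rw [coe_mul, h]; rfl

theorem mul_apply_none {f g : Q K n} {x : Fin n} (h : f.1 x = none) : (f * g).1 x = none := by
  rw [coe_mul, h]; rfl

theorem mul_eq_some_iff {f g : Q K n} {x z : Fin n} :
    (f * g).1 x = some z ↔ ∃ y, f.1 x = some y ∧ g.1 y = some z :=
  Option.bind_eq_some_iff

theorem ext' {f g : Q K n} (h : ∀ x, f.1 x = g.1 x) : f = g := Subtype.ext (funext h)

theorem ext_some {f g : Q K n} (h : ∀ x y, f.1 x = some y → g.1 x = some y)
    (h' : ∀ x, f.1 x = none → g.1 x = none) : f = g := by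
  refine ext' fun x => ?_
  rcases hx : f.1 x with _ | y
  · exact (h' x hx).symm
  · exact (h x y hx).symm

theorem im_mul_subset (f g : Q K n) : (f * g).im ⊆ g.im := by
  intro y hy
  obtain ⟨x, hx⟩ := mem_im_iff.1 hy
  obtain ⟨z, -, hz⟩ := mul_eq_some_iff.1 hx
  exact mem_im hz

theorem rank_mul_le_right (f g : Q K n) : (f * g).rank ≤ g.rank :=
  Finset.card_le_card (im_mul_subset f g)

theorem im_mul (f g : Q K n) : (f * g).im = f.im.biUnion fun y => (g.1 y).toFinset := by
  ext z
  simp only [mem_im_iff, mul_eq_some_iff, Finset.mem_biUnion, Option.mem_toFinset,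
    Option.mem_def]
  grind

theorem card_biUnion_toFinset_le {α β : Type*} [DecidableEq β] (s : Finset α)
    (p : α → Option β) : (s.biUnion fun y => (p y).toFinset).card ≤ s.card := by
  refine (Finset.card_biUnion_le).trans ?_
  calc ∑ y ∈ s, (p y).toFinset.card ≤ ∑ _y ∈ s, 1 := by
        refine Finset.sum_le_sum fun y _ => ?_
        rcases p y with _ | z <;> simp
    _ = s.card := by simp

theorem rank_mul_le_left (f g : Q K n) : (f * g).rank ≤ f.rank := by
  unfold rank
  rw [im_mul]
  exact card_biUnion_toFinset_le _ _

theorem rank_mul_mul_le (s f t : Q K n) : (s * f * t).rank ≤ f.rank :=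
  (rank_mul_le_left _ _).trans (rank_mul_le_right _ _)

theorem rank_le (f : Q K n) : f.rank ≤ n := by
  simpa [rank] using Finset.card_le_univ f.im

theorem zeroStar_le_one : K.zeroStar ≤ 1 := by cases K <;> simp [Kind.zeroStar]

theorem im_nonempty (hn : 1 ≤ n) (hK : K = Kind.T) (f : Q K n) : f.im.Nonempty := by
  obtain ⟨y, hy⟩ := total hK f ⟨0, hn⟩
  exact ⟨y, mem_im hy⟩

theorem zeroStar_le_rank (hn : 1 ≤ n) (f : Q K n) : K.zeroStar ≤ f.rank := by
  by_cases hK : K = Kind.T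
  · have h := Finset.card_pos.2 (im_nonempty hn hK f)
    exact zeroStar_le_one.trans h
  · cases K <;> simp_all [Kind.zeroStar]

theorem rank_mem_Icc (hn : 1 ≤ n) (f : Q K n) : f.rank ∈ Set.Icc K.zeroStar n :=
  ⟨zeroStar_le_rank hn f, rank_le f⟩

theorem eq_of_rank_eq_zero {f g : Q K n} (hf : f.rank = 0) (hg : g.rank = 0) : f = g := by
  have key : ∀ k : Q K n, k.rank = 0 → ∀ x, k.1 x = none := by
    intro k hk x
    rcases hx : k.1 x with _ | y
    · rfl
    · have := mem_im hx
      rw [Finset.card_eq_zero.1 hk] at this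
      simp at this
  exact ext' fun x => by rw [key f hf, key g hg]

/-- An injection defined on a subset extends to an element of `Qₙ`. -/
theorem exists_extend (K : Kind) {n : ℕ} (A : Finset (Fin n)) (φ : Fin n → Fin n)
    (hφ : Set.InjOn φ A) : ∃ v : Q K n, ∀ y ∈ A, v.1 y = some (φ y) := by
  classical
  by_cases hK : K = Kind.T
  · exact ⟨ofFun K (fun y => some (φ y)) (fun _ x => ⟨_, rfl⟩) (by subst hK; simp),
      fun y _ => rfl⟩
  · refine ⟨ofFun K (fun y => if y ∈ A then some (φ y) else none) (fun h => absurd h hK) ?_, ?_⟩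
    · intro _ x₁ x₂ y h₁ h₂
      simp only [Option.ite_none_right_eq_some, Option.some.injEq] at h₁ h₂
      exact hφ h₁.1 h₂.1 (h₁.2.trans h₂.2.symm)
    · intro y hy
      exact if_pos hy

/-- Divisibility on the left is governed by images. -/
theorem exists_mul_left {f g : Q K n} (h : f.im ⊆ g.im) : ∃ s : Q K n, f = s * g := by
  have hc : ∀ y, ∃ x, y ∈ g.im → g.1 x = some y := by
    intro y
    by_cases hy : y ∈ g.im
    · obtain ⟨x, hx⟩ := mem_im_iff.1 hy
      exact ⟨x, fun _ => hx⟩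
    · exact ⟨y, fun h => absurd h hy⟩
  choose c hc using hc
  have hT : K = Kind.T → ∀ x, ∃ y, (f.1 x).map c = some y := by
    intro hK x
    obtain ⟨y, hy⟩ := total hK f x
    exact ⟨c y, by rw [hy]; rfl⟩
  have hI : K = Kind.I → ∀ x₁ x₂ y, (f.1 x₁).map c = some y → (f.1 x₂).map c = some y →
      x₁ = x₂ := by
    intro hK x₁ x₂ y h₁ h₂
    obtain ⟨z₁, hz₁, rfl⟩ := Option.map_eq_some_iff.1 h₁
    obtain ⟨z₂, hz₂, h₂⟩ := Option.map_eq_some_iff.1 h₂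
    have e := (hc z₁ (h (mem_im hz₁))).symm.trans (h₂ ▸ hc z₂ (h (mem_im hz₂)))
    obtain rfl := Option.some.inj e
    exact injective hK f hz₁ hz₂
  have hs : ∀ x, (ofFun K _ hT hI).1 x = (f.1 x).map c := fun x => rfl
  refine ⟨ofFun K _ hT hI, ext_some (fun x y hx => ?_) (fun x hx => ?_)⟩
  · have : (ofFun K _ hT hI).1 x = some (c y) := by rw [hs, hx]; rfl
    rw [mul_apply_some this]
    exact hc y (h (mem_im hx))
  · exact mul_apply_none (by rw [hs, hx]; rfl)

/-- Divisibility on the right is governed by domains and kernels. -/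
theorem exists_mul_right {f g : Q K n} (h₀ : ∀ x, g.1 x = none → f.1 x = none)
    (h : ∀ x y, g.1 x = g.1 y → f.1 x = f.1 y) : ∃ s : Q K n, f = g * s := by
  classical
  have hc : ∀ y, ∃ x, y ∈ g.im → g.1 x = some y := by
    intro y
    by_cases hy : y ∈ g.im
    · obtain ⟨x, hx⟩ := mem_im_iff.1 hy
      exact ⟨x, fun _ => hx⟩
    · exact ⟨y, fun h => absurd h hy⟩
  choose c hc using hc
  have hT : K = Kind.T → ∀ x, ∃ y,
      (if x ∈ g.im ∨ K = Kind.T then f.1 (c x) else none) = some y := by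
    intro hK x
    rw [if_pos (Or.inr hK)]
    exact total hK f _
  have hI : K = Kind.I → ∀ x₁ x₂ y,
      (if x₁ ∈ g.im ∨ K = Kind.T then f.1 (c x₁) else none) = some y →
      (if x₂ ∈ g.im ∨ K = Kind.T then f.1 (c x₂) else none) = some y → x₁ = x₂ := by
    intro hK x₁ x₂ y h₁ h₂
    have hK' : ¬ K = Kind.T := by rw [hK]; simp
    simp only [hK', or_false, Option.ite_none_right_eq_some] at h₁ h₂
    have e := injective hK f h₁.2 h₂.2
    exact Option.some.inj ((hc x₁ h₁.1).symm.trans (e ▸ hc x₂ h₂.1))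
  refine ⟨ofFun K _ hT hI, ext' fun x => ?_⟩
  rcases hx : g.1 x with _ | y
  · rw [mul_apply_none hx, h₀ x hx]
  · rw [mul_apply_some hx]
    change _ = if y ∈ g.im ∨ K = Kind.T then f.1 (c y) else none
    rw [if_pos (Or.inl (mem_im hx))]
    exact h _ _ (hx.trans (hc y (mem_im hx)).symm)

/-- Elements of smaller rank are two-sided multiples. -/
theorem exists_mul_mul {f g : Q K n} (h : f.rank ≤ g.rank) : ∃ u v : Q K n, u * g * v = f := by
  classical
  obtain ⟨φ, hφ, hinj⟩ : ∃ φ : Fin n → Fin n, (∀ y ∈ f.im, φ y ∈ g.im) ∧ Set.InjOn φ f.im := by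
    obtain ⟨φ, hφ⟩ := Finset.exists_subset_card_eq h
    obtain ⟨e⟩ : Nonempty (f.im ≃ φ) := by
      refine ⟨Finset.equivOfCardEq hφ.2.symm⟩
    refine ⟨fun y => if hy : y ∈ f.im then e ⟨y, hy⟩ else y, fun y hy => ?_, ?_⟩
    · simp only [hy, dif_pos]
      exact hφ.1 (e ⟨y, hy⟩).2
    · intro y hy z hz hyz
      simp only [Finset.mem_coe] at hy hz
      simpa [hy, hz, Subtype.ext_iff] using hyz
  obtain ⟨v₁, hv₁⟩ := exists_extend K f.im φ hinj
  obtain ⟨u, hu⟩ : ∃ u : Q K n, f * v₁ = u * g := by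
    refine exists_mul_left fun z hz => ?_
    obtain ⟨x, hx⟩ := mem_im_iff.1 hz
    obtain ⟨y, hy, hyz⟩ := mul_eq_some_iff.1 hx
    rw [hv₁ y (mem_im hy)] at hyz
    obtain rfl := Option.some.inj hyz
    exact hφ y (mem_im hy)
  obtain ⟨v₂, hv₂⟩ : ∃ v₂ : Q K n, f = f * v₁ * v₂ := by
    refine exists_mul_right (fun x hx => ?_) (fun x y hxy => ?_)
    · rcases hx' : f.1 x with _ | y
      · rfl
      · rw [mul_apply_some hx', hv₁ y (mem_im hx')] at hx
        simp at hx
    · rcases hx' : f.1 x with _ | a <;> rcases hy' : f.1 y with _ | b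
      · rfl
      · rw [mul_apply_none hx', mul_apply_some hy', hv₁ b (mem_im hy')] at hxy
        simp at hxy
      · rw [mul_apply_none hy', mul_apply_some hx', hv₁ a (mem_im hx')] at hxy
        simp at hxy
      · rw [mul_apply_some hx', mul_apply_some hy', hv₁ a (mem_im hx'), hv₁ b (mem_im hy')] at hxy
        rw [hinj (mem_im hx') (mem_im hy') (Option.some.inj hxy)]
  exact ⟨u, v₂, by rw [← hu, ← hv₂]⟩

/-- Every rank between `0*` and `n` occurs. -/
theorem exists_rank_eq (K : Kind) {n k : ℕ} (hk : k ∈ Set.Icc K.zeroStar n) :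
    ∃ f : Q K n, f.rank = k := by
  classical
  obtain ⟨A, -, hA⟩ := Finset.exists_subset_card_eq
    (show k ≤ (Finset.univ : Finset (Fin n)).card by simpa using hk.2)
  by_cases hK : K = Kind.T
  · have hA0 : A.Nonempty := by
      rw [← Finset.card_pos, hA]
      have := hk.1
      subst hK
      exact this
    obtain ⟨a, ha⟩ := hA0
    refine ⟨ofFun K (fun x => if x ∈ A then some x else some a) (fun _ x => ?_)
      (by subst hK; simp), ?_⟩
    · by_cases hx : x ∈ A <;> simp [hx]
    · refine Eq.trans ?_ hA
      unfold rank
      congr 1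
      ext y
      rw [mem_im_iff]
      constructor
      · rintro ⟨x, hx⟩
        change (if x ∈ A then some x else some a) = some y at hx
        split_ifs at hx <;> simp_all
      · intro hy
        exact ⟨y, if_pos hy⟩
  · refine ⟨ofFun K (fun x => if x ∈ A then some x else none) (fun h => absurd h hK) ?_, ?_⟩
    · intro _ x₁ x₂ y h₁ h₂
      simp only [Option.ite_none_right_eq_some, Option.some.injEq] at h₁ h₂
      exact h₁.2.trans h₂.2.symm
    · refine Eq.trans ?_ hA
      unfold rank
      congr 1
      ext y
      rw [mem_im_iff]
      constructor
      · rintro ⟨x, hx⟩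
        change (if x ∈ A then some x else none) = some y at hx
        split_ifs at hx
        simp_all
      · intro hy
        exact ⟨y, if_pos hy⟩

/-- The map moving only `y`: to `b` for full transformations, and out of the domain
otherwise. -/
theorem exists_collapse (K : Kind) {n : ℕ} (y b : Fin n) :
    ∃ t : Q K n, (∀ z, z ≠ y → t.1 z = some z) ∧ (K ≠ Kind.T → t.1 y = none) ∧
      (K = Kind.T → t.1 y = some b) := by
  classical
  by_cases hK : K = Kind.T
  · refine ⟨ofFun K (fun x => if x = y then some b else some x) (fun _ x => ?_)
      (by subst hK; simp), fun z hz => if_neg hz, fun h => absurd hK h, fun _ => if_pos rfl⟩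
    by_cases hx : x = y <;> simp [hx]
  · refine ⟨ofFun K (fun x => if x = y then none else some x) (fun h => absurd h hK) ?_,
      fun z hz => if_neg hz, fun _ => if_pos rfl, fun h => absurd h hK⟩
    intro _ x₁ x₂ y h₁ h₂
    simp only [Option.ite_none_left_eq_some, Option.some.injEq] at h₁ h₂
    exact h₁.2.trans h₂.2.symm

/-- A left factor removing exactly one point from the image. -/
theorem exists_drop {g : Q K n} {a b : Fin n} (ha : a ∈ g.im) (hb : b ∈ g.im) (hab : a ≠ b) :
    ∃ s : Q K n, (s * g).im = g.im.erase a ∧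
      ∀ x x', s.1 x = some x' → g.1 x' ≠ some a := by
  classical
  obtain ⟨x₀, hx₀⟩ := mem_im_iff.1 hb
  obtain ⟨s, hs, hs'⟩ : ∃ s : Q K n, (∀ x, g.1 x ≠ some a → s.1 x = some x) ∧
      ∀ x, g.1 x = some a → s.1 x = none ∨ s.1 x = some x₀ := by
    by_cases hK : K = Kind.T
    · refine ⟨ofFun K (fun x => if g.1 x = some a then some x₀ else some x) (fun _ x => ?_)
        (by subst hK; simp), fun z hz => if_neg hz, fun x hx => Or.inr (if_pos hx)⟩
      by_cases hx : g.1 x = some a <;> simp [hx]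
    · refine ⟨ofFun K (fun x => if g.1 x = some a then none else some x) (fun h => absurd h hK) ?_,
        fun z hz => if_neg hz, fun x hx => Or.inl (if_pos hx)⟩
      intro _ x₁ x₂ y h₁ h₂
      simp only [Option.ite_none_left_eq_some, Option.some.injEq] at h₁ h₂
      exact h₁.2.trans h₂.2.symm
  have key : ∀ x x', s.1 x = some x' → g.1 x' ≠ some a := by
    intro x x' hx
    by_cases hxa : g.1 x = some a
    · rcases hs' x hxa with h | h
      · simp [h] at hx
      · rw [h] at hx
        obtain rfl := Option.some.inj hx
        rw [hx₀]
        exact fun h => hab (Option.some.inj h).symm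
    · rw [hs x hxa] at hx
      obtain rfl := Option.some.inj hx
      exact hxa
  refine ⟨s, ?_, key⟩
  ext y
  rw [mem_im_iff, Finset.mem_erase]
  constructor
  · rintro ⟨x, hx⟩
    obtain ⟨x', hx', hy⟩ := mul_eq_some_iff.1 hx
    refine ⟨?_, mem_im hy⟩
    rintro rfl
    exact key _ _ hx' hy
  · rintro ⟨hya, hy⟩
    obtain ⟨x, hx⟩ := mem_im_iff.1 hy
    refine ⟨x, ?_⟩
    rw [mul_apply_some (hs x ?_), hx]
    rw [hx]
    exact fun h => hya (Option.some.inj h)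

/-- A left factor keeping the rank of `g` and lowering that of `h`, when the kernel of `h` is not
contained in that of `g`. -/
theorem exists_rank_mul_lt {g h : Q K n} {x y₀ : Fin n} (hx : g.1 x = some y₀)
    (hh : h.1 x = none ∨ ∃ y y₁, g.1 y = some y₁ ∧ y₁ ≠ y₀ ∧ h.1 y = h.1 x) :
    ∃ s : Q K n, (s * g).rank = g.rank ∧ (s * h).rank < g.rank := by
  classical
  obtain ⟨c, hc, hcx⟩ : ∃ c : Fin n → Fin n, (∀ y ∈ g.im, g.1 (c y) = some y) ∧
      (h.1 (c y₀) = none ∨ ∃ y₁ ∈ g.im, y₁ ≠ y₀ ∧ h.1 (c y₁) = h.1 (c y₀)) := by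
    have hc : ∀ y, ∃ x, y ∈ g.im → g.1 x = some y := by
      intro y
      by_cases hy : y ∈ g.im
      · obtain ⟨x, hx⟩ := mem_im_iff.1 hy
        exact ⟨x, fun _ => hx⟩
      · exact ⟨y, fun h => absurd h hy⟩
    choose c hc using hc
    rcases hh with hh | ⟨y, y₁, hy, hne, hyx⟩
    · refine ⟨Function.update c y₀ x, fun y hy => ?_, Or.inl (by simpa using hh)⟩
      by_cases hyy : y = y₀
      · subst hyy; simpa using hx
      · simpa [hyy] using hc y hy
    · refine ⟨Function.update (Function.update c y₁ y) y₀ x, fun z hz => ?_,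
        Or.inr ⟨y₁, mem_im hy, hne, by simpa [hne] using hyx⟩⟩
      by_cases hyy : z = y₀
      · subst hyy; simpa using hx
      · by_cases hyy' : z = y₁
        · subst hyy'; simpa [hyy] using hy
        · simpa [hyy, hyy'] using hc z hz
  have hT : K = Kind.T → ∀ x, ∃ y, (g.1 x).map c = some y := by
    intro hK x
    obtain ⟨y, hy⟩ := total hK g x
    exact ⟨c y, by rw [hy]; rfl⟩
  have hI : K = Kind.I → ∀ x₁ x₂ y, (g.1 x₁).map c = some y → (g.1 x₂).map c = some y →
      x₁ = x₂ := by
    intro hK x₁ x₂ y h₁ h₂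
    obtain ⟨z₁, hz₁, rfl⟩ := Option.map_eq_some_iff.1 h₁
    obtain ⟨z₂, hz₂, h₂⟩ := Option.map_eq_some_iff.1 h₂
    have e := (hc z₁ (mem_im hz₁)).symm.trans (h₂ ▸ hc z₂ (mem_im hz₂))
    obtain rfl := Option.some.inj e
    exact injective hK g hz₁ hz₂
  have hs : ∀ x z, (ofFun K _ hT hI).1 x = some z ↔ ∃ y, g.1 x = some y ∧ c y = z :=
    fun x z => Option.map_eq_some_iff
  refine ⟨ofFun K _ hT hI, ?_, ?_⟩
  · unfold rank
    congr 1
    ext y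
    simp only [mem_im_iff, mul_eq_some_iff, hs]
    constructor
    · rintro ⟨x, _, ⟨y', hy', rfl⟩, hz⟩
      exact ⟨_, hz⟩
    · rintro ⟨x, hx⟩
      exact ⟨x, _, ⟨y, hx, rfl⟩, hc y (mem_im hx)⟩
  · have hsub : (ofFun K _ hT hI * h).im ⊆
        (g.im.erase y₀).biUnion fun y => (h.1 (c y)).toFinset := by
      intro z hz
      obtain ⟨x, hx⟩ := mem_im_iff.1 hz
      obtain ⟨w, hw, hwz⟩ := mul_eq_some_iff.1 hx
      obtain ⟨y, hy, rfl⟩ := (hs _ _).1 hw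
      simp only [Finset.mem_biUnion, Option.mem_toFinset, Option.mem_def, Finset.mem_erase]
      by_cases hyy : y = y₀
      · subst hyy
        rcases hcx with hcx | ⟨y₁, hy₁, hne, he⟩
        · simp [hcx] at hwz
        · exact ⟨y₁, ⟨hne, hy₁⟩, he.trans hwz⟩
      · exact ⟨y, ⟨hyy, mem_im hy⟩, hwz⟩
    exact ((Finset.card_le_card hsub).trans (card_biUnion_toFinset_le _ _)).trans_lt
      (Finset.card_erase_lt_of_mem (mem_im hx))

theorem greenH_of {f g : Q K n} (him : f.im = g.im) (h₀ : ∀ x, f.1 x = none ↔ g.1 x = none)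
    (h : ∀ x y, f.1 x = f.1 y ↔ g.1 x = g.1 y) : GreenH f g := by
  have key : ∀ a b : Q K n, (∃ s, a = b * s) → {x | ∃ s, x = a * s} ⊆ {x | ∃ s, x = b * s} := by
    rintro a b ⟨s, rfl⟩ _ ⟨t, rfl⟩
    exact ⟨s * t, mul_assoc _ _ _⟩
  have key' : ∀ a b : Q K n, (∃ s, a = s * b) → {x | ∃ s, x = s * a} ⊆ {x | ∃ s, x = s * b} := by
    rintro a b ⟨s, rfl⟩ _ ⟨t, rfl⟩
    exact ⟨t * s, (mul_assoc _ _ _).symm⟩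
  exact ⟨Set.Subset.antisymm
      (key _ _ (exists_mul_right (fun x => (h₀ x).2) fun x y => (h x y).2))
      (key _ _ (exists_mul_right (fun x => (h₀ x).1) fun x y => (h x y).1)),
    Set.Subset.antisymm (key' _ _ (exists_mul_left him.subset))
      (key' _ _ (exists_mul_left him.symm.subset))⟩

/-- Elements with the same image which are not `ℋ`-related have ranks that can be told apart after
a left multiplication. -/
theorem exists_rank_lt_of_not_greenH {g h : Q K n} (him : g.im = h.im) (hH : ¬ GreenH g h) :
    ∃ s : Q K n, ((s * g).rank = g.rank ∧ (s * h).rank < g.rank) ∨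
      ((s * h).rank = g.rank ∧ (s * g).rank < g.rank) := by
  by_contra! hcon
  have hr : h.rank = g.rank := by rw [rank, rank, him]
  have h₁ : ¬ ∃ s : Q K n, (s * g).rank = g.rank ∧ (s * h).rank < g.rank := by
    rintro ⟨s, h, h'⟩
    exact absurd h' (not_lt.2 ((hcon s).1 h))
  have h₂ : ¬ ∃ s : Q K n, (s * h).rank = h.rank ∧ (s * g).rank < h.rank := by
    rw [hr]
    rintro ⟨s, h, h'⟩
    exact absurd h' (not_lt.2 ((hcon s).2 h))
  have dom : ∀ a b : Q K n, (¬ ∃ s : Q K n, (s * a).rank = a.rank ∧ (s * b).rank < a.rank) →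
      ∀ x, b.1 x = none → a.1 x = none := by
    intro a b hab x hx
    by_contra hne
    obtain ⟨y, hy⟩ := Option.ne_none_iff_exists'.1 hne
    exact hab (exists_rank_mul_lt hy (Or.inl hx))
  have ker : ∀ a b : Q K n, (¬ ∃ s : Q K n, (s * a).rank = a.rank ∧ (s * b).rank < a.rank) →
      (∀ x, a.1 x = none ↔ b.1 x = none) → ∀ x y, b.1 x = b.1 y → a.1 x = a.1 y := by
    intro a b hab hd x y hxy
    rcases hx : a.1 x with _ | p <;> rcases hy : a.1 y with _ | q
    · rfl
    · rw [(hd y).2 (hxy ▸ (hd x).1 hx)] at hy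
      simp at hy
    · rw [(hd x).2 (hxy ▸ (hd y).1 hy)] at hx
      simp at hx
    · by_contra hpq
      exact hab (exists_rank_mul_lt hx (Or.inr ⟨y, q, hy, fun h => hpq (by rw [h]), hxy.symm⟩))
  have hd : ∀ x, g.1 x = none ↔ h.1 x = none := fun x => ⟨dom h g h₂ x, dom g h h₁ x⟩
  exact hH (greenH_of him hd fun x y =>
    ⟨ker h g h₂ (fun x => (hd x).symm) x y, ker g h h₁ hd x y⟩)

theorem domain_iff_of_greenH {f g : Q K n} (h : GreenH f g) (x : Fin n) :
    f.1 x = none ↔ g.1 x = none := by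
  have key : ∀ a b : Q K n, a ∈ {x | ∃ s, x = b * s} → b.1 x = none → a.1 x = none := by
    rintro a b ⟨s, rfl⟩ hb
    exact mul_apply_none hb
  exact ⟨key g f (h.1 ▸ ⟨1, (mul_one g).symm⟩), key f g (h.1 ▸ ⟨1, (mul_one f).symm⟩)⟩

theorem kernel_iff_of_greenH {f g : Q K n} (h : GreenH f g) (x y : Fin n) :
    f.1 x = f.1 y ↔ g.1 x = g.1 y := by
  have key : ∀ a b : Q K n, a ∈ {x | ∃ s, x = b * s} → b.1 x = b.1 y → a.1 x = a.1 y := by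
    rintro a b ⟨s, rfl⟩ hb
    rw [coe_mul, coe_mul, hb]
  exact ⟨key g f (h.1 ▸ ⟨1, (mul_one g).symm⟩), key f g (h.1 ▸ ⟨1, (mul_one f).symm⟩)⟩

theorem rank_eq_of_greenH {f g : Q K n} (h : GreenH f g) : f.rank = g.rank := by
  rw [rank, rank, h.im_eq]

/-- A congruence on `Qₙ` relating two elements with different images collapses an ideal. -/
theorem con_of_mem_im_of_notMem_im (hn : 1 ≤ n) (ρ : Con (Q K n)) {g h : Q K n} {y : Fin n}
    (hgh : ρ g h) (hyg : y ∈ g.im) (hyh : y ∉ h.im) {k k' : Q K n} (hk : k.rank ≤ g.rank)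
    (hk' : k'.rank ≤ g.rank) : ρ k k' := by
  classical
  induction hj : g.rank using Nat.strong_induction_on generalizing g h k k' with
  | _ j ih =>
  subst hj
  have hpos : 0 < g.rank := Finset.card_pos.2 ⟨y, hyg⟩
  obtain ⟨x, hx⟩ := mem_im_iff.1 hyg
  by_cases hT1 : K = Kind.T ∧ g.rank = 1
  · obtain ⟨hK, h1⟩ := hT1
    have hconst : ∀ l : Q K n, l.rank ≤ 1 → ∃ d, ∀ z, l.1 z = some d := by
      intro l hl
      obtain ⟨d, hd⟩ := im_nonempty hn hK l
      refine ⟨d, fun z => ?_⟩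
      obtain ⟨e, he⟩ := total hK l z
      rw [he, Finset.card_le_one.1 hl e (mem_im he) d hd]
    obtain ⟨d, hd⟩ := hconst k (h1 ▸ hk)
    obtain ⟨d', hd'⟩ := hconst k' (h1 ▸ hk')
    by_cases hdd : d = d'
    · rw [show k = k' from ext' fun z => by rw [hd, hd', hdd]]
      exact ρ.refl _
    obtain ⟨b, hb⟩ := total hK h x
    have hyb : y ≠ b := by
      rintro rfl
      exact hyh (mem_im hb)
    obtain ⟨v, hv⟩ := exists_extend K {y, b} (fun z => if z = y then d else d') (by
      intro p hp q hq hpq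
      simp only [Finset.coe_insert, Finset.coe_singleton, Set.mem_insert_iff,
        Set.mem_singleton_iff] at hp hq
      rcases hp with rfl | rfl <;> rcases hq with rfl | rfl
      · rfl
      · simp only [if_true, if_neg hyb.symm] at hpq
        exact absurd hpq hdd
      · simp only [if_true, if_neg hyb.symm] at hpq
        exact absurd hpq.symm hdd
      · rfl)
    let c : Q K n := ofFun K (fun _ => some x) (fun _ _ => ⟨x, rfl⟩) (by rw [hK]; simp)
    have e : ρ (c * g * v) (c * h * v) := ρ.mul (ρ.mul (ρ.refl c) hgh) (ρ.refl v)
    have e₁ : c * g * v = k := by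
      refine ext' fun z => ?_
      rw [mul_apply_some (y := y) ((mul_apply_some rfl).trans hx), hv y (by simp), hd]
      simp
    have e₂ : c * h * v = k' := by
      refine ext' fun z => ?_
      rw [mul_apply_some (y := b) ((mul_apply_some rfl).trans hb), hv b (by simp), hd']
      simp [hyb.symm]
    rwa [e₁, e₂] at e
  · have hsmall : ∀ l l' : Q K n, l.rank ≤ g.rank - 1 → l'.rank ≤ g.rank - 1 → ρ l l' := by
      intro l l' hl hl'
      by_cases h1 : g.rank = 1
      · rw [eq_of_rank_eq_zero (f := l) (g := l') (by omega) (by omega)]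
        exact ρ.refl _
      · obtain ⟨a, ha, hay⟩ : ∃ a ∈ g.im, a ≠ y :=
          Finset.exists_mem_ne (by change 1 < g.rank; omega) y
        obtain ⟨s, hs, -⟩ := exists_drop ha hyg hay
        have hr : (s * g).rank = g.rank - 1 := by
          rw [rank, hs, Finset.card_erase_of_mem ha]; rfl
        exact ih _ (by rw [hr]; omega) (ρ.mul (ρ.refl s) hgh)
          (by rw [hs]; exact Finset.mem_erase.2 ⟨hay.symm, hyg⟩)
          (fun hy => hyh (im_mul_subset _ _ hy)) (by rw [hr]; exact hl) (by rw [hr]; exact hl') rfl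
    obtain ⟨b, hb⟩ : ∃ b, K = Kind.T → b ∈ g.im ∧ b ≠ y := by
      by_cases hK : K = Kind.T
      · obtain ⟨a, ha, hay⟩ : ∃ a ∈ g.im, a ≠ y := by
          refine Finset.exists_mem_ne ?_ y
          change 1 < g.rank
          have : g.rank ≠ 1 := fun h => hT1 ⟨hK, h⟩
          omega
        exact ⟨a, fun _ => ⟨ha, hay⟩⟩
      · exact ⟨y, fun h => absurd h hK⟩
    obtain ⟨t, ht, htI, htT⟩ := exists_collapse K y b
    have hht : h * t = h := by
      refine ext_some (fun x z hx => ?_) (fun x hx => ?_)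
      · obtain ⟨w, hw, hz⟩ := mul_eq_some_iff.1 hx
        rw [ht w (by rintro rfl; exact hyh (mem_im hw))] at hz
        rwa [← Option.some.inj hz]
      · rcases hw : h.1 x with _ | w
        · rfl
        · rw [mul_apply_some hw, ht w (by rintro rfl; exact hyh (mem_im hw))] at hx
          simp at hx
    have hgt : ρ g (g * t) := by
      have := ρ.mul hgh (ρ.refl t)
      rw [hht] at this
      exact ρ.trans hgh (ρ.symm this)
    have hlt : (g * t).rank < g.rank := by
      have hsub : (g * t).im ⊆ g.im.erase y := by
        intro z hz
        obtain ⟨x, hx⟩ := mem_im_iff.1 hz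
        obtain ⟨w, hw, hz⟩ := mul_eq_some_iff.1 hx
        by_cases hwy : w = y
        · subst hwy
          by_cases hK : K = Kind.T
          · rw [htT hK] at hz
            obtain rfl := Option.some.inj hz
            exact Finset.mem_erase.2 ⟨(hb hK).2, (hb hK).1⟩
          · simp [htI hK] at hz
        · rw [ht w hwy] at hz
          obtain rfl := Option.some.inj hz
          exact Finset.mem_erase.2 ⟨hwy, mem_im hw⟩
      exact (Finset.card_le_card hsub).trans_lt (Finset.card_erase_lt_of_mem hyg)
    have hred : ∀ l : Q K n, l.rank ≤ g.rank → ∃ l' : Q K n, l'.rank ≤ g.rank - 1 ∧ ρ l l' := by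
      intro l hl
      obtain ⟨u, v, rfl⟩ := exists_mul_mul hl
      refine ⟨u * (g * t) * v, ?_, ρ.mul (ρ.mul (ρ.refl u) hgt) (ρ.refl v)⟩
      have := rank_mul_mul_le u (g * t) v
      omega
    obtain ⟨l, hl, hkl⟩ := hred k hk
    obtain ⟨l', hl', hkl'⟩ := hred k' hk'
    exact ρ.trans hkl (ρ.trans (hsmall _ _ hl hl') (ρ.symm hkl'))

end Q

namespace ImageOrder

open Q

variable {K : Kind} {n : ℕ} (o : ImageOrder K n)

theorem exists_enum (f : Q K n) {i : ℕ} (hf : f.rank = i) {y : Fin n} (hy : y ∈ f.im) :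
    ∃ k : Fin i, (o.enum f hf k : Fin n) = y :=
  ⟨(o.enum f hf).symm ⟨y, hy⟩, by simp⟩

theorem exists_enum_of_apply (f : Q K n) {i : ℕ} (hf : f.rank = i) {x y : Fin n}
    (hx : f.1 x = some y) : ∃ k : Fin i, f.1 x = some (o.enum f hf k : Fin n) := by
  obtain ⟨k, hk⟩ := o.exists_enum f hf (mem_im hx)
  exact ⟨k, by rw [hk, hx]⟩

theorem enum_inj (f : Q K n) {i : ℕ} (hf : f.rank = i) {k l : Fin i}
    (h : (o.enum f hf k : Fin n) = o.enum f hf l) : k = l :=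
  (o.enum f hf).injective (Subtype.ext h)

theorem act_apply_none (f : Q K n) {i : ℕ} (hf : f.rank = i) (σ : Equiv.Perm (Fin i))
    {x : Fin n} (hx : f.1 x = none) : (o.act f hf σ).1 x = none := by
  simp only [ImageOrder.act]
  exact Option.pmap_eq_none_iff.2 hx

theorem act_apply_some (f : Q K n) {i : ℕ} (hf : f.rank = i) (σ : Equiv.Perm (Fin i))
    {x : Fin n} {k : Fin i} (hx : f.1 x = some (o.enum f hf k : Fin n)) :
    (o.act f hf σ).1 x = some (o.enum f hf (σ k) : Fin n) := by
  simp only [ImageOrder.act]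
  exact Option.pmap_eq_some_iff.2 ⟨_, (o.enum f hf k).2, hx, by simp⟩

theorem act_eq_of (f g : Q K n) {i : ℕ} (hf : f.rank = i) (σ : Equiv.Perm (Fin i))
    (h₀ : ∀ x, f.1 x = none → g.1 x = none)
    (h : ∀ x k, f.1 x = some (o.enum f hf k : Fin n) →
      g.1 x = some (o.enum f hf (σ k) : Fin n)) : g = o.act f hf σ := by
  refine ext' fun x => ?_
  rcases hx : f.1 x with _ | y
  · rw [h₀ x hx, o.act_apply_none f hf σ hx]
  · obtain ⟨k, hk⟩ := o.exists_enum_of_apply f hf hx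
    rw [h x k hk, o.act_apply_some f hf σ hk]

theorem greenH_act (f : Q K n) {i : ℕ} (hf : f.rank = i) (σ : Equiv.Perm (Fin i)) :
    GreenH f (o.act f hf σ) := by
  have h₀ : ∀ x, f.1 x = none ↔ (o.act f hf σ).1 x = none := by
    intro x
    simp only [ImageOrder.act]
    exact Option.pmap_eq_none_iff.symm
  refine greenH_of ?_ h₀ fun x y => ?_
  · ext y
    constructor
    · intro hy
      obtain ⟨k, rfl⟩ := o.exists_enum f hf hy
      obtain ⟨x, hx⟩ := mem_im_iff.1 (o.enum f hf (σ⁻¹ k)).2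
      have := o.act_apply_some f hf σ hx
      rw [← Equiv.Perm.mul_apply, mul_inv_cancel, Equiv.Perm.one_apply] at this
      exact mem_im this
    · intro hy
      obtain ⟨x, hx⟩ := mem_im_iff.1 hy
      obtain ⟨z, hz⟩ := Option.ne_none_iff_exists'.1
        (fun h => by simp [(h₀ x).1 h] at hx : f.1 x ≠ none)
      obtain ⟨k, hk⟩ := o.exists_enum_of_apply f hf hz
      rw [o.act_apply_some f hf σ hk] at hx
      rw [← Option.some.inj hx]
      exact (o.enum f hf (σ k)).2
  · rcases hx : f.1 x with _ | a <;> rcases hy : f.1 y with _ | b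
    · rw [(h₀ x).1 hx, (h₀ y).1 hy]
    · rw [(h₀ x).1 hx]
      simp only [reduceCtorEq, false_iff]
      intro h
      simp [(h₀ y).2 h.symm] at hy
    · rw [(h₀ y).1 hy]
      simp only [reduceCtorEq, false_iff]
      intro h
      simp [(h₀ x).2 h] at hx
    · obtain ⟨k, hk⟩ := o.exists_enum_of_apply f hf hx
      obtain ⟨l, hl⟩ := o.exists_enum_of_apply f hf hy
      rw [o.act_apply_some f hf σ hk, o.act_apply_some f hf σ hl, ← hx, ← hy, hk, hl]
      simp only [Option.some.injEq]
      constructor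
      · intro h
        rw [o.enum_inj f hf h]
      · intro h
        rw [σ.injective (o.enum_inj f hf h)]

theorem rank_act (f : Q K n) {i : ℕ} (hf : f.rank = i) (σ : Equiv.Perm (Fin i)) :
    (o.act f hf σ).rank = i :=
  (rank_eq_of_greenH (o.greenH_act f hf σ)).symm.trans hf

theorem enum_act (f : Q K n) {i : ℕ} (hf : f.rank = i) (σ : Equiv.Perm (Fin i))
    (h : (o.act f hf σ).rank = i) (k : Fin i) :
    (o.enum (o.act f hf σ) h k : Fin n) = o.enum f hf k :=
  (o.compat _ _ (o.greenH_act f hf σ) i hf h k).symm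

theorem act_one (f : Q K n) {i : ℕ} (hf : f.rank = i) : o.act f hf 1 = f :=
  (o.act_eq_of f f hf 1 (fun _ h => h) fun _ _ h => h).symm

theorem act_act (f : Q K n) {i : ℕ} (hf : f.rank = i) (σ τ : Equiv.Perm (Fin i))
    (h : (o.act f hf σ).rank = i) : o.act (o.act f hf σ) h τ = o.act f hf (τ * σ) := by
  refine o.act_eq_of f _ hf _ (fun x hx => ?_) (fun x k hx => ?_)
  · exact o.act_apply_none _ _ _ (o.act_apply_none f hf σ hx)
  · have h1 := o.act_apply_some f hf σ hx
    rw [← o.enum_act f hf σ h] at h1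
    rw [o.act_apply_some _ h τ h1, o.enum_act]
    rfl

theorem exists_act_of_greenH {f g : Q K n} (h : GreenH f g) {i : ℕ} (hf : f.rank = i) :
    ∃ σ : Equiv.Perm (Fin i), g = o.act f hf σ := by
  have hex : ∀ k : Fin i, ∃ l : Fin i, ∀ x, f.1 x = some (o.enum f hf k : Fin n) →
      g.1 x = some (o.enum f hf l : Fin n) := by
    intro k
    obtain ⟨x, hx⟩ := mem_im_iff.1 (o.enum f hf k).2
    obtain ⟨z, hz⟩ := Option.ne_none_iff_exists'.1
      (fun hg => by simp [(domain_iff_of_greenH h x).2 hg] at hx : g.1 x ≠ none)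
    obtain ⟨l, rfl⟩ := o.exists_enum f hf (y := z) (by rw [h.im_eq]; exact mem_im hz)
    exact ⟨l, fun x' hx' => by
      rw [← hz]; exact (kernel_iff_of_greenH h _ _).1 (hx'.trans hx.symm)⟩
  choose s hs using hex
  have hinj : Function.Injective s := by
    intro k l hkl
    obtain ⟨x, hx⟩ := mem_im_iff.1 (o.enum f hf k).2
    obtain ⟨y, hy⟩ := mem_im_iff.1 (o.enum f hf l).2
    have e : g.1 x = g.1 y := by rw [hs k x hx, hs l y hy, hkl]
    have e' := (kernel_iff_of_greenH h x y).2 e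
    rw [hx, hy] at e'
    exact o.enum_inj f hf (Option.some.inj e')
  refine ⟨Equiv.ofBijective s (Finite.injective_iff_bijective.1 hinj), ?_⟩
  exact o.act_eq_of f g hf _ (fun x hx => (domain_iff_of_greenH h x).1 hx) fun x k hx => hs k x hx

/-- Any two elements of the same rank are linked by two-sided multiplications compatible with the
action of the symmetric group, up to any prescribed permutation. -/
theorem exists_transport {f f' : Q K n} {i : ℕ} (hf : f.rank = i) (hf' : f'.rank = i)
    (ρ : Equiv.Perm (Fin i)) :
    ∃ u v : Q K n, ∀ σ, u * o.act f hf σ * v = o.act f' hf' (ρ * σ) := by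
  classical
  have h₁ : ∀ y, ∃ z, ∀ k, y = (o.enum f' hf' k : Fin n) → z = (o.enum f hf k : Fin n) := by
    intro y
    by_cases hy : y ∈ f'.im
    · obtain ⟨k, hk⟩ := o.exists_enum f' hf' hy
      refine ⟨o.enum f hf k, fun l hl => ?_⟩
      rw [o.enum_inj f' hf' (hk.trans hl)]
    · exact ⟨y, fun k hk => absurd (hk ▸ (o.enum f' hf' k).2) hy⟩
  have h₂ : ∀ y, ∃ z, ∀ k, y = (o.enum f hf k : Fin n) → z = (o.enum f' hf' (ρ k) : Fin n) := by
    intro y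
    by_cases hy : y ∈ f.im
    · obtain ⟨k, hk⟩ := o.exists_enum f hf hy
      refine ⟨o.enum f' hf' (ρ k), fun l hl => ?_⟩
      rw [o.enum_inj f hf (hk.trans hl)]
    · exact ⟨y, fun k hk => absurd (hk ▸ (o.enum f hf k).2) hy⟩
  choose φ hφ using h₁
  choose ψ hψ using h₂
  obtain ⟨w, hw⟩ := exists_extend K f'.im φ (by
    intro y hy z hz hyz
    obtain ⟨k, rfl⟩ := o.exists_enum f' hf' hy
    obtain ⟨l, rfl⟩ := o.exists_enum f' hf' hz
    rw [hφ _ k rfl, hφ _ l rfl] at hyz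
    rw [o.enum_inj f hf hyz])
  obtain ⟨v, hv⟩ := exists_extend K f.im ψ (by
    intro y hy z hz hyz
    obtain ⟨k, rfl⟩ := o.exists_enum f hf hy
    obtain ⟨l, rfl⟩ := o.exists_enum f hf hz
    rw [hψ _ k rfl, hψ _ l rfl] at hyz
    rw [ρ.injective (o.enum_inj f' hf' hyz)])
  have hw' : ∀ k, w.1 (o.enum f' hf' k : Fin n) = some (o.enum f hf k : Fin n) := fun k => by
    rw [hw _ (o.enum f' hf' k).2, hφ _ k rfl]
  have hv' : ∀ k, v.1 (o.enum f hf k : Fin n) = some (o.enum f' hf' (ρ k) : Fin n) := fun k => by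
    rw [hv _ (o.enum f hf k).2, hψ _ k rfl]
  obtain ⟨u, hu⟩ : ∃ u : Q K n, f' * w = u * f := by
    refine exists_mul_left fun z hz => ?_
    obtain ⟨x, hx⟩ := mem_im_iff.1 hz
    obtain ⟨y, hy, hyz⟩ := mul_eq_some_iff.1 hx
    obtain ⟨k, rfl⟩ := o.exists_enum f' hf' (mem_im hy)
    rw [hw'] at hyz
    rw [← Option.some.inj hyz]
    exact (o.enum f hf k).2
  refine ⟨u, v, fun σ => o.act_eq_of f' _ hf' _ (fun x hx => ?_) (fun x k hx => ?_)⟩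
  · have h : (u * f).1 x = none := by rw [← hu, mul_apply_none hx]
    refine mul_apply_none ?_
    rcases hux : u.1 x with _ | y
    · exact mul_apply_none hux
    · rw [mul_apply_some hux] at h ⊢
      exact o.act_apply_none f hf σ h
  · have h : (u * f).1 x = some (o.enum f hf k : Fin n) := by
      rw [← hu, mul_apply_some hx, hw']
    obtain ⟨y, hy, hfy⟩ := mul_eq_some_iff.1 h
    have h' : (u * o.act f hf σ).1 x = some (o.enum f hf (σ k) : Fin n) := by
      rw [mul_apply_some hy, o.act_apply_some f hf σ hfy]
    rw [mul_apply_some h', hv']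
    rfl

/-- The action of the symmetric group and two-sided multiplication. -/
theorem exists_conj_of_rank_mul_mul {f : Q K n} {i : ℕ} (hf : f.rank = i) {s t : Q K n}
    (h : (s * f * t).rank = i) :
    ∃ ρ : Equiv.Perm (Fin i), ∀ σ, s * o.act f hf σ * t = o.act (s * f * t) h (ρ * σ * ρ⁻¹) := by
  have hex : ∀ l : Fin i, ∃ k : Fin i,
      t.1 (o.enum f hf k : Fin n) = some (o.enum _ h l : Fin n) := by
    intro l
    obtain ⟨x, hx⟩ := mem_im_iff.1 (o.enum _ h l).2
    obtain ⟨y, hy, hyz⟩ := mul_eq_some_iff.1 hx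
    obtain ⟨k, rfl⟩ := o.exists_enum f hf (im_mul_subset _ _ (mem_im hy))
    exact ⟨k, hyz⟩
  choose κ hκ using hex
  have hinj : Function.Injective κ := by
    intro k l hkl
    have := (hκ k).symm.trans (hkl ▸ hκ l)
    exact o.enum_inj _ h (Option.some.inj this)
  have hbij := Finite.injective_iff_bijective.1 hinj
  obtain ⟨κ', hκ'⟩ : ∃ κ' : Equiv.Perm (Fin i), ∀ l, κ' l = κ l :=
    ⟨Equiv.ofBijective κ hbij, fun _ => rfl⟩
  have ht : ∀ k, t.1 (o.enum f hf k : Fin n) = some (o.enum _ h (κ'⁻¹ k) : Fin n) := by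
    intro k
    have := hκ (κ'⁻¹ k)
    rwa [← hκ', ← Equiv.Perm.mul_apply, mul_inv_cancel, Equiv.Perm.one_apply] at this
  refine ⟨κ'⁻¹, fun σ => o.act_eq_of _ _ h _ (fun x hx => ?_) (fun x k hx => ?_)⟩
  · rcases hsx : s.1 x with _ | y
    · exact mul_apply_none (mul_apply_none hsx)
    · rcases hfy : f.1 y with _ | z
      · refine mul_apply_none ?_
        rw [mul_apply_some hsx, o.act_apply_none f hf σ hfy]
      · obtain ⟨k, hk⟩ := o.exists_enum_of_apply f hf hfy
        have : (s * f).1 x = some (o.enum f hf k : Fin n) := by rw [mul_apply_some hsx, hk]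
        rw [mul_apply_some this, ht] at hx
        simp at hx
  · obtain ⟨y, hy, hyz⟩ := mul_eq_some_iff.1 hx
    obtain ⟨z, hz, hzy⟩ := mul_eq_some_iff.1 hy
    obtain ⟨l, hl⟩ := o.exists_enum_of_apply f hf hzy
    have hly : y = (o.enum f hf l : Fin n) := Option.some.inj (hzy.symm.trans hl)
    subst hly
    rw [ht] at hyz
    have hk : κ'⁻¹ l = k := o.enum_inj _ h (Option.some.inj hyz)
    have h' : (s * o.act f hf σ).1 x = some (o.enum f hf (σ l) : Fin n) := by
      rw [mul_apply_some hz, o.act_apply_some f hf σ hl]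
    rw [mul_apply_some h', ht, ← hk]
    simp

theorem rank_mul_act_mul_lt {f : Q K n} {i : ℕ} (hf : f.rank = i) {s t : Q K n}
    (h : (s * f * t).rank < i) (σ : Equiv.Perm (Fin i)) : (s * o.act f hf σ * t).rank < i := by
  have hle : (s * o.act f hf σ * t).rank ≤ i :=
    (rank_mul_mul_le _ _ _).trans (o.rank_act f hf σ).le
  refine lt_of_le_of_ne hle fun he => ?_
  obtain ⟨ρ, hρ⟩ := o.exists_conj_of_rank_mul_mul (o.rank_act f hf σ) he
  have h1 := hρ σ⁻¹
  rw [o.act_act, inv_mul_cancel, o.act_one] at h1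
  rw [h1, o.rank_act] at h
  exact lt_irrefl _ h

end ImageOrder

namespace ProductCon

open Q

variable {K : Kind} {m n : ℕ}

/-- The congruence on the product with the factors exchanged. -/
def swap (θ : Con (Q K m × Q K n)) : Con (Q K n × Q K m) where
  r p q := θ p.swap q.swap
  iseqv := ⟨fun _ => θ.refl _, fun h => θ.symm h, fun h h' => θ.trans h h'⟩
  mul' h h' := θ.mul h h'

/-- The congruence induced on the fibre over an element of the first factor. -/
def fibre (θ : Con (Q K m × Q K n)) (f : Q K m) : Con (Q K n) where
  r g g' := θ (f, g) (f, g')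
  iseqv := ⟨fun _ => θ.refl _, fun h => θ.symm h, fun h h' => θ.trans h h'⟩
  mul' {g g' h h'} hg hh := by
    have h₁ := θ.mul hg (θ.refl (1, h))
    have h₂ := θ.mul (θ.refl (1, g')) hh
    simp only [Prod.mk_mul_mk, mul_one, one_mul] at h₁ h₂
    exact θ.trans h₁ h₂

/-- Over an element of rank `i`, all elements of rank at most `j` are identified. -/
def ColFull (θ : Con (Q K m × Q K n)) (i j : ℕ) : Prop :=
  ∀ (f : Q K m) (g g' : Q K n), f.rank = i → g.rank ≤ j → g'.rank ≤ j → θ (f, g) (f, g')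

/-- Beside an element of rank `j`, all elements of rank at most `i` are identified. -/
abbrev RowFull (θ : Con (Q K m × Q K n)) (i j : ℕ) : Prop := ColFull (swap θ) j i

theorem RowFull.rel {θ : Con (Q K m × Q K n)} {i j : ℕ} (h : RowFull θ i j) {f f' : Q K m}
    {g : Q K n} (hg : g.rank = j) (hf : f.rank ≤ i) (hf' : f'.rank ≤ i) : θ (f, g) (f', g) :=
  h g f f' hg hf hf'

variable {θ : Con (Q K m × Q K n)}

theorem mul_left_right {p q : Q K m × Q K n} (h : θ p q) (s t : Q K m × Q K n) :
    θ (s * p * t) (s * q * t) :=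
  θ.mul (θ.mul (θ.refl s) h) (θ.refl t)

theorem mul_fst {f f' : Q K m} {g g' : Q K n} (h : θ (f, g) (f', g')) (u v : Q K m) :
    θ (u * f * v, g) (u * f' * v, g') := by
  simpa using mul_left_right h (u, 1) (v, 1)

theorem mul_snd {f f' : Q K m} {g g' : Q K n} (h : θ (f, g) (f', g')) (u v : Q K n) :
    θ (f, u * g * v) (f', u * g' * v) := by
  simpa using mul_left_right h (1, u) (1, v)

theorem swap_rel {p q : Q K m × Q K n} : swap θ p.swap q.swap ↔ θ p q := Iff.rfl

theorem ColFull.mono (hm : 1 ≤ m) {i i' j j' : ℕ} (h : ColFull θ i j) (him : i ≤ m)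
    (hi : i' ≤ i) (hj : j' ≤ j) : ColFull θ i' j' := by
  intro f g g' hf hg hg'
  obtain ⟨e, he⟩ := exists_rank_eq K
    (show i ∈ Set.Icc K.zeroStar m from ⟨(zeroStar_le_rank hm f).trans (hf ▸ hi), him⟩)
  obtain ⟨u, v, rfl⟩ := exists_mul_mul (f := f) (g := e) (by rw [hf, he]; exact hi)
  exact mul_fst (h e g g' he (hg.trans hj) (hg'.trans hj)) u v

theorem colFull_of_fibre {f : Q K m} {j : ℕ}
    (h : ∀ g g' : Q K n, g.rank ≤ j → g'.rank ≤ j → θ (f, g) (f, g')) : ColFull θ f.rank j := by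
  intro f' g g' hf hg hg'
  obtain ⟨u, v, rfl⟩ := exists_mul_mul (f := f') (g := f) hf.le
  exact mul_fst (h g g' hg hg') u v

theorem colFull_of_mem_im (hn : 1 ≤ n) {f f' : Q K m} {g g' : Q K n}
    (h : θ (f, g) (f', g')) {y : Fin n} (hy : y ∈ g.im) (hy' : y ∉ g'.im) :
    ColFull θ f.rank g.rank := by
  obtain ⟨b, hb⟩ : ∃ b, K = Kind.T → b ∈ g'.im := by
    by_cases hK : K = Kind.T
    · obtain ⟨b, hb⟩ := im_nonempty hn hK g'
      exact ⟨b, fun _ => hb⟩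
    · exact ⟨y, fun h => absurd h hK⟩
  obtain ⟨t, ht, htI, htT⟩ := exists_collapse K y b
  have hgt : g' * t = g' := by
    refine ext_some (fun x z hx => ?_) (fun x hx => ?_)
    · obtain ⟨w, hw, hz⟩ := mul_eq_some_iff.1 hx
      rw [ht w (by rintro rfl; exact hy' (mem_im hw))] at hz
      rwa [← Option.some.inj hz]
    · rcases hw : g'.1 x with _ | w
      · rfl
      · rw [mul_apply_some hw, ht w (by rintro rfl; exact hy' (mem_im hw))] at hx
        simp at hx
  have hyt : y ∉ (g * t).im := by
    intro hyt
    obtain ⟨x, hx⟩ := mem_im_iff.1 hyt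
    obtain ⟨w, hw, hz⟩ := mul_eq_some_iff.1 hx
    by_cases hwy : w = y
    · subst hwy
      by_cases hK : K = Kind.T
      · rw [htT hK] at hz
        exact hy' (Option.some.inj hz ▸ hb hK)
      · simp [htI hK] at hz
    · rw [ht w hwy] at hz
      exact hwy (Option.some.inj hz)
  have h₁ := mul_snd h 1 t
  rw [one_mul, one_mul, hgt] at h₁
  have h₂ : fibre θ f g (g * t) := θ.trans h (θ.symm h₁)
  exact colFull_of_fibre fun k k' hk hk' =>
    con_of_mem_im_of_notMem_im hn (fibre θ f) h₂ hy hyt hk hk'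

theorem colFull_of_rank_lt (hn : 1 ≤ n) {f f' : Q K m} {g g' : Q K n}
    (h : θ (f, g) (f', g')) (hr : g'.rank < g.rank) : ColFull θ f.rank g.rank := by
  obtain ⟨y, hy, hy'⟩ := Finset.exists_mem_notMem_of_card_lt_card hr
  exact colFull_of_mem_im hn h hy hy'

theorem rowFull_of_rank_lt (hm : 1 ≤ m) {f f' : Q K m} {g g' : Q K n}
    (h : θ (f, g) (f', g')) (hr : f'.rank < f.rank) : RowFull θ f.rank g.rank :=
  colFull_of_rank_lt hm (swap_rel.2 h) hr

theorem ColFull.extend_row {i j j' : ℕ} (h : ColFull θ i j') (hr : RowFull θ i j)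
    (hm : 1 ≤ m) (him : i ≤ m) (hjn : j ≤ n) (hj : K.zeroStar ≤ j) (hjj : j ≤ j') :
    RowFull θ i j' := by
  intro g f f' hg hf hf'
  obtain ⟨g₀, hg₀⟩ := exists_rank_eq K (show j ∈ Set.Icc K.zeroStar n from ⟨hj, hjn⟩)
  have h₁ : ∀ e : Q K m, e.rank ≤ i → θ (e, g) (e, g₀) := fun e he =>
    (h.mono hm him he le_rfl) e g g₀ rfl hg.le (hg₀.le.trans hjj)
  exact θ.trans (h₁ f hf) (θ.trans (hr.rel hg₀ hf hf') (θ.symm (h₁ f' hf')))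

theorem colFull_of_not_greenH (hm : 1 ≤ m) (hn : 1 ≤ n) {f f' : Q K m} {g g' : Q K n}
    (h : θ (f, g) (f', g')) (hr : g'.rank ≤ g.rank) (hH : ¬ GreenH g g') :
    ColFull θ f.rank g.rank := by
  by_cases him : g.im ⊆ g'.im
  · have him' : g.im = g'.im := Finset.eq_of_subset_of_card_le him hr
    obtain ⟨s, ⟨hs, hs'⟩ | ⟨hs, hs'⟩⟩ := exists_rank_lt_of_not_greenH him' hH
    · have := mul_snd h s 1
      rw [mul_one, mul_one] at this
      exact hs ▸ colFull_of_rank_lt hn this (hs.symm ▸ hs')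
    · have := θ.symm (mul_snd h s 1)
      rw [mul_one, mul_one] at this
      have hc : ColFull θ f'.rank g.rank := hs ▸ colFull_of_rank_lt hn this (hs.symm ▸ hs')
      rcases le_or_gt f.rank f'.rank with hle | hlt
      · exact hc.mono hm (rank_le _) hle le_rfl
      · have hrow := rowFull_of_rank_lt hm h hlt
        exact ColFull.extend_row (θ := swap θ) hrow hc hn (rank_le _) (rank_le _)
          (zeroStar_le_rank hm _) hlt.le
  · obtain ⟨y, hy, hy'⟩ := Finset.not_subset.1 him
    exact colFull_of_mem_im hn h hy hy'

/-- Distinct `ℋ`-related second coordinates force the smaller ranks to be identified. -/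
theorem colFull_of_greenH (hn : 1 ≤ n) {f f' : Q K m} {g g' : Q K n}
    (h : θ (f, g) (f', g')) (hH : GreenH g g') (hne : g ≠ g') :
    2 ≤ g.rank ∧ ColFull θ f.rank (g.rank - 1) := by
  obtain ⟨x, hx⟩ : ∃ x, g.1 x ≠ g'.1 x := by
    by_contra! hcon
    exact hne (ext' hcon)
  obtain ⟨a, ha⟩ : ∃ a, g.1 x = some a := by
    rw [← Option.ne_none_iff_exists']
    intro h0
    exact hx (h0.trans ((domain_iff_of_greenH hH x).1 h0).symm)
  obtain ⟨b, hb⟩ : ∃ b, g'.1 x = some b := by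
    rw [← Option.ne_none_iff_exists']
    intro h0
    simp [(domain_iff_of_greenH hH x).2 h0] at ha
  have hab : a ≠ b := by
    rintro rfl
    exact hx (ha.trans hb.symm)
  have hag := mem_im ha
  have hbg : b ∈ g.im := by
    rw [hH.im_eq]
    exact mem_im hb
  obtain ⟨s, hs, hs'⟩ := exists_drop hag hbg hab
  have hrank : (s * g).rank = g.rank - 1 := by
    rw [rank, hs, Finset.card_erase_of_mem hag]; rfl
  have hb' : b ∉ (s * g').im := by
    intro hbs
    obtain ⟨z, hz⟩ := mem_im_iff.1 hbs
    obtain ⟨w, hw, hwb⟩ := mul_eq_some_iff.1 hz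
    refine hs' z w hw ?_
    rw [← ha]
    exact (kernel_iff_of_greenH hH _ _).2 (hwb.trans hb.symm)
  refine ⟨Finset.one_lt_card.2 ⟨a, hag, b, hbg, hab⟩, ?_⟩
  have := mul_snd h s 1
  rw [mul_one, mul_one] at this
  exact hrank ▸ colFull_of_mem_im hn this (by rw [hs]; exact Finset.mem_erase.2 ⟨hab.symm, hbg⟩) hb'

/-- All pairs with ranks at most `(i, j)` are identified. -/
def Full (θ : Con (Q K m × Q K n)) (i j : ℕ) : Prop := ColFull θ i j ∧ RowFull θ i j

theorem Full.swap {i j : ℕ} (h : Full θ i j) : Full (swap θ) j i := ⟨h.2, h.1⟩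

theorem Full.mono (hm : 1 ≤ m) (hn : 1 ≤ n) {i i' j j' : ℕ} (h : Full θ i j) (him : i ≤ m)
    (hjn : j ≤ n) (hi : i' ≤ i) (hj : j' ≤ j) : Full θ i' j' :=
  ⟨h.1.mono hm him hi hj, ColFull.mono hn h.2 hjn hj hi⟩

theorem Full.rel (hm : 1 ≤ m) (hn : 1 ≤ n) {i j : ℕ} (h : Full θ i j) (him : i ≤ m)
    (hjn : j ≤ n) {f f' : Q K m} {g g' : Q K n} (hf : f.rank ≤ i) (hf' : f'.rank ≤ i)
    (hg : g.rank ≤ j) (hg' : g'.rank ≤ j) : θ (f, g) (f', g') :=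
  θ.trans ((h.1.mono hm him hf le_rfl) f g g' rfl hg hg')
    ((ColFull.mono hn h.2 hjn hg' le_rfl) g' f f' rfl hf hf')

/-- The index set of the part of type `FF`. -/
def FF (θ : Con (Q K m × Q K n)) (i j : ℕ) : Prop :=
  Full θ i j ∧ Full θ K.zeroStar 1 ∧ Full θ 1 K.zeroStar

theorem FF.swap {i j : ℕ} (h : FF θ i j) : FF (swap θ) j i := ⟨h.1.swap, h.2.2.swap, h.2.1.swap⟩

theorem FF.mono (hm : 1 ≤ m) (hn : 1 ≤ n) {i i' j j' : ℕ} (h : FF θ i j) (him : i ≤ m)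
    (hjn : j ≤ n) (hi : i' ≤ i) (hj : j' ≤ j) : FF θ i' j' :=
  ⟨h.1.mono hm hn him hjn hi hj, h.2⟩

theorem ff_of_full (hm : 1 ≤ m) (hn : 1 ≤ n) {i j : ℕ} (h : Full θ i j) (hi : 1 ≤ i) (hj : 1 ≤ j)
    (him : i ≤ m) (hjn : j ≤ n) : FF θ i j :=
  ⟨h, h.mono hm hn him hjn (zeroStar_le_one.trans hi) hj,
    h.mono hm hn him hjn hi (zeroStar_le_one.trans hj)⟩

theorem FF.rel (hm : 1 ≤ m) (hn : 1 ≤ n) {f f' : Q K m} {g g' : Q K n}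
    (h : FF θ f.rank g.rank) (h' : FF θ f'.rank g'.rank) : θ (f, g) (f', g') := by
  obtain ⟨f₀, hf₀⟩ := exists_rank_eq K
    (show K.zeroStar ∈ Set.Icc K.zeroStar m from ⟨le_rfl, zeroStar_le_one.trans hm⟩)
  obtain ⟨g₀, hg₀⟩ := exists_rank_eq K
    (show K.zeroStar ∈ Set.Icc K.zeroStar n from ⟨le_rfl, zeroStar_le_one.trans hn⟩)
  have key : ∀ (a : Q K m) (b : Q K n), FF θ a.rank b.rank → θ (a, b) (f₀, g₀) := fun a b hab =>
    hab.1.rel hm hn (rank_le _) (rank_le _) le_rfl (hf₀ ▸ zeroStar_le_rank hm a) le_rfl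
      (hg₀ ▸ zeroStar_le_rank hn b)
  exact θ.trans (key _ _ h) (θ.symm (key _ _ h'))

theorem colFull_zeroStar (hK : K ≠ Kind.T) (i : ℕ) : ColFull θ i K.zeroStar := by
  intro f g g' _ hg hg'
  have h0 : K.zeroStar = 0 := by cases K <;> simp_all [Kind.zeroStar]
  rw [eq_of_rank_eq_zero (f := g) (g := g') (by omega) (by omega)]
  exact θ.refl _

/-- A collapsed column meeting a collapsed row gives a collapsed rectangle. -/
theorem ff_of_colFull_of_rowFull (hm : 1 ≤ m) (hn : 1 ≤ n) {i i' j : ℕ} (hi : K.zeroStar ≤ i)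
    (hjn : j ≤ n) (h : ColFull θ i (max j 1)) (hr : RowFull θ i' K.zeroStar) (hii : i ≤ i')
    (hi' : 1 ≤ i') (him : i' ≤ m) : FF θ i j := by
  have hz : K.zeroStar ≤ n := zeroStar_le_one.trans hn
  have hr' : RowFull θ i K.zeroStar := ColFull.mono hn hr hz le_rfl hii
  have hr'' : RowFull θ i (max j 1) := h.extend_row hr' hm (hii.trans him) hz le_rfl
    (zeroStar_le_one.trans (le_max_right _ _))
  have hF : Full θ i (max j 1) := ⟨h, hr''⟩
  have hjn' : max j 1 ≤ n := max_le hjn hn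
  refine ⟨hF.mono hm hn (hii.trans him) hjn' le_rfl (le_max_left _ _),
    hF.mono hm hn (hii.trans him) hjn' hi (le_max_right _ _), ?_,
    ColFull.mono hn hr hz le_rfl hi'⟩
  by_cases hK : K = Kind.T
  · subst hK
    exact h.mono hm (hii.trans him) hi (le_max_right _ _)
  · exact colFull_zeroStar hK 1

/-- A class meeting the part of type `FF` is contained in it. -/
theorem FF.of_rel (hm : 1 ≤ m) (hn : 1 ≤ n) {f f' : Q K m} {g g' : Q K n}
    (h : FF θ f.rank g.rank) (hr : θ (f, g) (f', g')) : FF θ f'.rank g'.rank := by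
  refine ⟨?_, h.2⟩
  obtain ⟨f₀, hf₀⟩ := exists_rank_eq K
    (show K.zeroStar ∈ Set.Icc K.zeroStar m from ⟨le_rfl, zeroStar_le_one.trans hm⟩)
  obtain ⟨g₀, hg₀⟩ := exists_rank_eq K
    (show K.zeroStar ∈ Set.Icc K.zeroStar n from ⟨le_rfl, zeroStar_le_one.trans hn⟩)
  have hz : K.zeroStar ≤ n := zeroStar_le_one.trans hn
  have hz' : K.zeroStar ≤ m := zeroStar_le_one.trans hm
  have h00 : Full θ K.zeroStar K.zeroStar :=
    h.2.1.mono hm hn hz' hn le_rfl zeroStar_le_one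
  have hFF0 : FF θ f₀.rank g₀.rank := ⟨by rw [hf₀, hg₀]; exact h00, h.2⟩
  have h' : θ (f', g') (f₀, g₀) := θ.trans (θ.symm hr) (h.rel hm hn hFF0)
  rcases (zeroStar_le_rank hm f').eq_or_lt with hf | hf <;>
    rcases (zeroStar_le_rank hn g').eq_or_lt with hg | hg
  · rwa [← hf, ← hg]
  · have hc := colFull_of_rank_lt hn h' (hg₀ ▸ hg)
    exact ⟨hc, hc.extend_row (hf ▸ h00.2) hm (rank_le _) hz le_rfl hg.le⟩
  · have hc := rowFull_of_rank_lt hm h' (hf₀ ▸ hf)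
    exact ⟨ColFull.extend_row (θ := ProductCon.swap θ) hc (hg ▸ h00.1) hn (rank_le _) hz' le_rfl hf.le, hc⟩
  · exact ⟨colFull_of_rank_lt hn h' (hg₀ ▸ hg), rowFull_of_rank_lt hm h' (hf₀ ▸ hf)⟩

/-- The column over `i` is a part of type `ℋF` or `εF`. -/
def IsCol (θ : Con (Q K m × Q K n)) (i : ℕ) : Prop := ColFull θ i 1 ∧ ¬ FF θ i K.zeroStar

theorem not_ff_of_isCol (hm : 1 ≤ m) (hn : 1 ≤ n) {i j : ℕ} (h : IsCol θ i)
    (hj : K.zeroStar ≤ j) (him : i ≤ m) (hjn : j ≤ n) : ¬ FF θ i j :=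
  fun hF => h.2 (hF.mono hm hn him hjn le_rfl hj)

theorem isCol_of (hm : 1 ≤ m) (hn : 1 ≤ n) {i j : ℕ} (h : ColFull θ i (max j 1))
    (hF : ¬ FF θ i j) (him : i ≤ m) (hjn : j ≤ n) : IsCol θ i := by
  refine ⟨h.mono hm him le_rfl (le_max_right _ _), fun h' => hF ⟨?_, h'.2⟩⟩
  have hr := h.extend_row h'.1.2 hm him (zeroStar_le_one.trans hn) le_rfl
    (zeroStar_le_one.trans (le_max_right _ _))
  exact Full.mono hm hn ⟨h, hr⟩ him (max_le hjn hn) le_rfl (le_max_left _ _)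

/-- A class meeting a column part is contained in it and lies over a single `ℋ`-class. -/
theorem IsCol.of_rel (hm : 1 ≤ m) (hn : 1 ≤ n) {f f' : Q K m} {g g' : Q K n}
    (hc : IsCol θ f.rank) (h : ColFull θ f.rank (max g.rank 1)) (hr : θ (f, g) (f', g')) :
    GreenH f f' ∧ ColFull θ f.rank (max g'.rank 1) := by
  have hFF : ¬ FF θ f.rank g.rank :=
    not_ff_of_isCol hm hn hc (zeroStar_le_rank hn g) (rank_le _) (rank_le _)
  obtain ⟨g₀, hg₀⟩ := exists_rank_eq K
    (show K.zeroStar ∈ Set.Icc K.zeroStar n from ⟨le_rfl, zeroStar_le_one.trans hn⟩)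
  have hr₀ : θ (f, g₀) (f', g') := by
    refine θ.trans (h f g₀ g rfl ?_ (le_max_left _ _)) hr
    rw [hg₀]
    exact zeroStar_le_one.trans (le_max_right _ _)
  have hH : GreenH f f' := by
    by_contra hH
    rcases le_or_gt f'.rank f.rank with hle | hlt
    · have hrow : RowFull θ f.rank g₀.rank :=
        colFull_of_not_greenH hn hm (swap_rel.2 hr₀) hle hH
      rw [hg₀] at hrow
      have hpos : 1 ≤ f.rank := by
        by_contra hpos
        refine hH ?_
        rw [eq_of_rank_eq_zero (f := f) (g := f') (by omega) (by omega)]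
        exact ⟨rfl, rfl⟩
      exact hFF (ff_of_colFull_of_rowFull hm hn (zeroStar_le_rank hm f) (rank_le _) h hrow le_rfl
        hpos (rank_le _))
    · have hrow : RowFull θ f'.rank g'.rank := rowFull_of_rank_lt hm (θ.symm hr₀) hlt
      have hrow' : RowFull θ f'.rank K.zeroStar :=
        ColFull.mono hn hrow (rank_le _) (zeroStar_le_rank hn g') le_rfl
      exact hFF (ff_of_colFull_of_rowFull hm hn (zeroStar_le_rank hm f) (rank_le _) h hrow'
        hlt.le (by omega) (rank_le _))
  refine ⟨hH, ?_⟩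
  rcases (zeroStar_le_rank hn g').eq_or_lt with hg | hg
  · refine h.mono hm (rank_le _) le_rfl ?_
    rw [← hg, max_eq_right zeroStar_le_one]
    exact le_max_right _ _
  · have := colFull_of_rank_lt hn (θ.symm hr₀) (hg₀ ▸ hg)
    rw [rank_eq_of_greenH hH, max_eq_left (by omega)]
    exact this

end ProductCon

theorem ImageOrder.eq_one_of_act_eq {K : Kind} {n : ℕ} (o : ImageOrder K n) {f : Q K n} {i : ℕ}
    (hf : f.rank = i) {σ : Equiv.Perm (Fin i)} (h : o.act f hf σ = f) : σ = 1 := by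
  ext k
  obtain ⟨x, hx⟩ := Q.mem_im_iff.1 (o.enum f hf k).2
  have := o.act_apply_some f hf σ hx
  rw [h, hx] at this
  rw [← o.enum_inj f hf (Option.some.inj this)]
  rfl

namespace ProductCon

open Q

variable {K : Kind} {m n : ℕ}

/-- The group attached to the column over `i`. -/
def colGroup (θ : Con (Q K m × Q K n)) (o : ImageOrder K m) (i : ℕ) :
    Subgroup (Equiv.Perm (Fin i)) where
  carrier := {σ | ∀ (f : Q K m) (hf : f.rank = i) (g : Q K n), g.rank = K.zeroStar →
    θ (f, g) (o.act f hf σ, g)}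
  one_mem' f hf g _ := by rw [o.act_one]; exact θ.refl _
  mul_mem' {σ τ} hσ hτ f hf g hg := by
    have h := θ.trans (hτ f hf g hg) (hσ _ (o.rank_act f hf τ) g hg)
    rwa [o.act_act] at h
  inv_mem' {σ} hσ f hf g hg := by
    have h := hσ _ (o.rank_act f hf σ⁻¹) g hg
    rw [o.act_act, mul_inv_cancel, o.act_one] at h
    exact θ.symm h

/-- The group attached to a cell. -/
def cellGroup (θ : Con (Q K m × Q K n)) (o₁ : ImageOrder K m) (o₂ : ImageOrder K n) (i j : ℕ) :
    Subgroup (Equiv.Perm (Fin i) × Equiv.Perm (Fin j)) where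
  carrier := {σ | ∀ (f : Q K m) (hf : f.rank = i) (g : Q K n) (hg : g.rank = j),
    θ (f, g) (o₁.act f hf σ.1, o₂.act g hg σ.2)}
  one_mem' f hf g hg := by
    rw [Prod.fst_one, Prod.snd_one, o₁.act_one, o₂.act_one]
    exact θ.refl _
  mul_mem' {σ τ} hσ hτ f hf g hg := by
    have h := θ.trans (hτ f hf g hg) (hσ _ (o₁.rank_act f hf _) _ (o₂.rank_act g hg _))
    rwa [o₁.act_act, o₂.act_act] at h
  inv_mem' {σ} hσ f hf g hg := by
    have h := hσ _ (o₁.rank_act f hf σ.1⁻¹) _ (o₂.rank_act g hg σ.2⁻¹)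
    rw [o₁.act_act, mul_inv_cancel, o₁.act_one, o₂.act_act, mul_inv_cancel, o₂.act_one] at h
    exact θ.symm h

variable {θ : Con (Q K m × Q K n)} {o₁ : ImageOrder K m} {o₂ : ImageOrder K n}

theorem mem_colGroup (hn : 1 ≤ n) {f : Q K m} {g : Q K n} {i : ℕ} (hf : f.rank = i)
    {σ : Equiv.Perm (Fin i)} (h : θ (f, g) (o₁.act f hf σ, g)) : σ ∈ colGroup θ o₁ i := by
  intro f' hf' g' hg'
  obtain ⟨u, v, huv⟩ := o₁.exists_transport hf hf' 1
  obtain ⟨s, t, rfl⟩ := exists_mul_mul (f := g') (g := g) (hg' ▸ zeroStar_le_rank hn g)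
  have := mul_left_right h (u, s) (v, t)
  simp only [Prod.mk_mul_mk] at this
  have h1 := huv 1
  rw [o₁.act_one, mul_one, o₁.act_one] at h1
  rwa [h1, huv, one_mul] at this

theorem mem_cellGroup {f : Q K m} {g : Q K n} {i j : ℕ} (hf : f.rank = i) (hg : g.rank = j)
    {σ : Equiv.Perm (Fin i) × Equiv.Perm (Fin j)}
    (h : θ (f, g) (o₁.act f hf σ.1, o₂.act g hg σ.2)) : σ ∈ cellGroup θ o₁ o₂ i j := by
  intro f' hf' g' hg'
  obtain ⟨u, v, huv⟩ := o₁.exists_transport hf hf' 1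
  obtain ⟨s, t, hst⟩ := o₂.exists_transport hg hg' 1
  have := mul_left_right h (u, s) (v, t)
  simp only [Prod.mk_mul_mk] at this
  have h1 := huv 1
  have h2 := hst 1
  rw [o₁.act_one, mul_one, o₁.act_one] at h1
  rw [o₂.act_one, mul_one, o₂.act_one] at h2
  rwa [h1, h2, huv, hst, one_mul, one_mul] at this

theorem colGroup_normal (θ : Con (Q K m × Q K n)) (o : ImageOrder K m) (i : ℕ) :
    (colGroup θ o i).Normal := by
  refine ⟨fun σ hσ ρ f hf g hg => ?_⟩
  have hf' := o.rank_act f hf ρ⁻¹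
  obtain ⟨u, v, huv⟩ := o.exists_transport hf' hf' ρ
  have h := mul_fst (hσ _ hf' g hg) u v
  have h1 := huv 1
  rw [o.act_one, mul_one, o.act_act, mul_inv_cancel, o.act_one] at h1
  rwa [h1, huv, o.act_act] at h

theorem cellGroup_normal (θ : Con (Q K m × Q K n)) (o₁ : ImageOrder K m) (o₂ : ImageOrder K n)
    (i j : ℕ) : (cellGroup θ o₁ o₂ i j).Normal := by
  refine ⟨fun σ hσ ρ f hf g hg => ?_⟩
  have hf' := o₁.rank_act f hf ρ.1⁻¹
  have hg' := o₂.rank_act g hg ρ.2⁻¹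
  obtain ⟨u, v, huv⟩ := o₁.exists_transport hf' hf' ρ.1
  obtain ⟨s, t, hst⟩ := o₂.exists_transport hg' hg' ρ.2
  have h := mul_left_right (hσ _ hf' _ hg') (u, s) (v, t)
  simp only [Prod.mk_mul_mk] at h
  have h1 := huv 1
  have h2 := hst 1
  rw [o₁.act_one, mul_one, o₁.act_act, mul_inv_cancel, o₁.act_one] at h1
  rw [o₂.act_one, mul_one, o₂.act_act, mul_inv_cancel, o₂.act_one] at h2
  rwa [h1, h2, huv, hst, o₁.act_act, o₂.act_act] at h

theorem rel_of_mem_colGroup (hn : 1 ≤ n) {i j : ℕ} (h : ColFull θ i j) {f : Q K m}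
    {g g' : Q K n} (hf : f.rank = i) (hg : g.rank ≤ j) (hg' : g'.rank ≤ j)
    {σ : Equiv.Perm (Fin i)} (hσ : σ ∈ colGroup θ o₁ i) : θ (f, g) (o₁.act f hf σ, g') := by
  obtain ⟨g₀, hg₀⟩ := exists_rank_eq K
    (show K.zeroStar ∈ Set.Icc K.zeroStar n from ⟨le_rfl, zeroStar_le_one.trans hn⟩)
  have hle : g₀.rank ≤ j := hg₀.le.trans ((zeroStar_le_rank hn g).trans hg)
  exact θ.trans (h f g g₀ hf hg hle) (θ.trans (hσ f hf g₀ hg₀)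
    (h _ g₀ g' (o₁.rank_act f hf σ) hle hg'))

theorem two_le_of_ne_bot {i : ℕ} {N : Subgroup (Equiv.Perm (Fin i))} (h : N ≠ ⊥) : 2 ≤ i := by
  by_contra hi
  have : Subsingleton (Fin i) := by
    interval_cases i <;> infer_instance
  exact h ((Subgroup.eq_bot_iff_forall _).2 fun x _ => Subsingleton.elim _ _)

theorem ff_of_colGroup_ne_bot (hm : 1 ≤ m) (hn : 1 ≤ n) {i j : ℕ} (hi : K.zeroStar ≤ i)
    (him : i ≤ m) (hj : 1 ≤ j) (hjn : j ≤ n) (h : ColFull θ i j) (hN : colGroup θ o₁ i ≠ ⊥) :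
    FF θ (i - 1) j := by
  obtain ⟨σ, hσ, hne⟩ : ∃ σ ∈ colGroup θ o₁ i, σ ≠ 1 := by
    by_contra! h
    exact hN ((Subgroup.eq_bot_iff_forall _).2 h)
  obtain ⟨f, hf⟩ := exists_rank_eq K (show i ∈ Set.Icc K.zeroStar m from ⟨hi, him⟩)
  obtain ⟨g, hg⟩ := exists_rank_eq K
    (show j ∈ Set.Icc K.zeroStar n from ⟨zeroStar_le_one.trans hj, hjn⟩)
  have hr := rel_of_mem_colGroup hn h hf hg.le hg.le hσ
  obtain ⟨h2, hrow⟩ := colFull_of_greenH hm (swap_rel.2 hr) (o₁.greenH_act f hf σ)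
    fun e => hne (o₁.eq_one_of_act_eq hf e.symm)
  change RowFull θ (f.rank - 1) g.rank at hrow
  change 2 ≤ f.rank at h2
  rw [hf, hg] at hrow
  exact ff_of_full hm hn ⟨h.mono hm him (Nat.sub_le _ _) le_rfl, hrow⟩ (by omega) hj (by omega) hjn

theorem colFull_of_mem_cellGroup (hn : 1 ≤ n) {i j : ℕ}
    (hi : i ∈ Set.Icc K.zeroStar m) (hj : j ∈ Set.Icc K.zeroStar n)
    {σ : Equiv.Perm (Fin i) × Equiv.Perm (Fin j)} (hσ : σ ∈ cellGroup θ o₁ o₂ i j)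
    (hne : σ.2 ≠ 1) : ColFull θ i (j - 1) := by
  obtain ⟨f, hf⟩ := exists_rank_eq K hi
  obtain ⟨g, hg⟩ := exists_rank_eq K hj
  have := (colFull_of_greenH hn (hσ f hf g hg) (o₂.greenH_act g hg σ.2)
    fun e => hne (o₂.eq_one_of_act_eq hg e.symm)).2
  rwa [hf, hg] at this

theorem swap_mem_cellGroup {i j : ℕ} {σ : Equiv.Perm (Fin i) × Equiv.Perm (Fin j)} :
    σ.swap ∈ cellGroup (swap θ) o₂ o₁ j i ↔ σ ∈ cellGroup θ o₁ o₂ i j :=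
  ⟨fun h f hf g hg => h g hg f hf, fun h f hf g hg => h g hg f hf⟩

theorem fst_mem_colGroup {i j : ℕ} (hj : j ∈ Set.Icc K.zeroStar n)
    (hj' : K.zeroStar < j) {σ : Equiv.Perm (Fin i) × Equiv.Perm (Fin j)}
    (hσ : σ ∈ cellGroup θ o₁ o₂ i j) (h : ColFull θ i (j - 1)) : σ.1 ∈ colGroup θ o₁ i := by
  intro f hf g₀ hg₀
  obtain ⟨g, hg⟩ := exists_rank_eq K hj
  obtain ⟨u, v, rfl⟩ := exists_mul_mul (f := g₀) (g := g) (by rw [hg, hg₀]; exact hj'.le)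
  have h₁ := mul_snd (hσ f hf g hg) u v
  refine θ.trans h₁ (h _ _ _ (o₁.rank_act f hf _) ?_ ?_)
  · have := o₂.rank_mul_act_mul_lt hg (s := u) (t := v) (by omega) σ.2
    omega
  · omega

theorem mem_cellGroup_of_le {i i' j : ℕ} (hi : i ∈ Set.Icc K.zeroStar m) (hii : i' ≤ i)
    {τ : Equiv.Perm (Fin j)} (h : (1, τ) ∈ cellGroup θ o₁ o₂ i j) :
    (1, τ) ∈ cellGroup θ o₁ o₂ i' j := by
  intro f' hf' g hg
  obtain ⟨f, hf⟩ := exists_rank_eq K hi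
  obtain ⟨u, v, rfl⟩ := exists_mul_mul (f := f') (g := f) (by rw [hf, hf']; exact hii)
  have := h f hf g hg
  rw [o₁.act_one] at this ⊢
  exact mul_fst this u v

theorem snd_mem_colGroup_swap {i j : ℕ} (hi : i ∈ Set.Icc K.zeroStar m)
    {τ : Equiv.Perm (Fin j)} (h : (1, τ) ∈ cellGroup θ o₁ o₂ i j) :
    τ ∈ colGroup (swap θ) o₂ j := by
  intro g hg f' hf'
  have := mem_cellGroup_of_le hi (hi.1) h f' hf' g hg
  rw [o₁.act_one] at this
  exact this

/-- The kinds of parts. -/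
inductive Label : Type
  | ff
  | col (i : ℕ)
  | row (j : ℕ)
  | cell (i j : ℕ)

open Classical in
/-- The part to which the pairs of ranks `(i, j)` belong. -/
noncomputable def label (θ : Con (Q K m × Q K n)) (i j : ℕ) : Label :=
  if FF θ i j then Label.ff
  else if ColFull θ i (max j 1) then Label.col i
  else if RowFull θ (max i 1) j then Label.row j
  else Label.cell i j

theorem label_eq_ff_iff {i j : ℕ} : label θ i j = Label.ff ↔ FF θ i j := by
  unfold label
  split_ifs <;> simp_all

theorem not_rowFull_of_colFull (hm : 1 ≤ m) (hn : 1 ≤ n) {i j : ℕ}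
    (hi : i ∈ Set.Icc K.zeroStar m) (hj : j ∈ Set.Icc K.zeroStar n) (hF : ¬ FF θ i j)
    (h : ColFull θ i (max j 1)) : ¬ RowFull θ (max i 1) j := fun hr =>
  hF (ff_of_colFull_of_rowFull hm hn hi.1 hj.2 h (ColFull.mono hn hr hj.2 hj.1 le_rfl)
    (le_max_left _ _) (le_max_right _ _) (max_le hi.2 hm))

theorem label_eq_col_iff (hm : 1 ≤ m) (hn : 1 ≤ n) {i j i' : ℕ} (hi : i ∈ Set.Icc K.zeroStar m)
    (hj : j ∈ Set.Icc K.zeroStar n) :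
    label θ i j = Label.col i' ↔ i = i' ∧ IsCol θ i ∧ ColFull θ i (max j 1) := by
  unfold label
  split_ifs with h₁ h₂ h₃
  · simp only [false_iff, not_and]
    intro _ h
    exact absurd h₁ (not_ff_of_isCol hm hn h hj.1 hi.2 hj.2)
  · simp [h₂, isCol_of hm hn h₂ h₁ hi.2 hj.2]
  · simp [h₂]
  · simp [h₂]

theorem label_eq_row_iff (hm : 1 ≤ m) (hn : 1 ≤ n) {i j j' : ℕ} (hi : i ∈ Set.Icc K.zeroStar m)
    (hj : j ∈ Set.Icc K.zeroStar n) :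
    label θ i j = Label.row j' ↔ j = j' ∧ IsCol (swap θ) j ∧ RowFull θ (max i 1) j := by
  unfold label
  split_ifs with h₁ h₂ h₃
  · simp only [false_iff, not_and]
    intro _ h
    exact absurd h₁.swap (not_ff_of_isCol hn hm h hi.1 hj.2 hi.2)
  · simp [not_rowFull_of_colFull hm hn hi hj h₁ h₂]
  · simp [h₃, isCol_of hn hm h₃ (fun h => h₁ h.swap) hj.2 hi.2]
  · simp [h₃]

theorem label_eq_cell_iff {i j i' j' : ℕ} :
    label θ i j = Label.cell i' j' ↔ i = i' ∧ j = j' ∧ ¬ FF θ i j ∧ ¬ ColFull θ i (max j 1) ∧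
      ¬ RowFull θ (max i 1) j := by
  unfold label
  split_ifs <;> simp_all

theorem greenH_snd_of_rel (hm : 1 ≤ m) (hn : 1 ≤ n) {f f' : Q K m} {g g' : Q K n}
    (h : θ (f, g) (f', g')) (h₁ : ¬ ColFull θ f.rank (max g.rank 1))
    (h₂ : ¬ ColFull θ f'.rank (max g'.rank 1)) : GreenH g g' := by
  have key : ∀ {a a' : Q K m} {b b' : Q K n}, θ (a, b) (a', b') → b'.rank ≤ b.rank →
      ¬ ColFull θ a.rank (max b.rank 1) → GreenH b b' := by
    intro a a' b b' h hle hc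
    by_contra hH
    have hcol := colFull_of_not_greenH hm hn h hle hH
    by_cases h0 : b.rank = 0
    · rw [eq_of_rank_eq_zero h0 (by omega : b'.rank = 0)] at hH
      exact hH ⟨rfl, rfl⟩
    · rw [max_eq_left (by omega)] at hc
      exact hc hcol
  rcases le_total g'.rank g.rank with hle | hle
  · exact key h hle h₁
  · have := key (θ.symm h) hle h₂
    exact ⟨this.1.symm, this.2.symm⟩

/-- The label of a pair. -/
noncomputable def lab (θ : Con (Q K m × Q K n)) (p : Q K m × Q K n) : Label :=
  label θ p.1.rank p.2.rank

theorem lab_eq_of_rel (hm : 1 ≤ m) (hn : 1 ≤ n) {p q : Q K m × Q K n} (h : θ p q) :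
    lab θ p = lab θ q := by
  have key : ∀ p q : Q K m × Q K n, θ p q → ((∀ i j, lab θ p ≠ Label.cell i j) ∨
      (∀ i j, lab θ q ≠ Label.cell i j) → lab θ p = lab θ q) := by
    have key' : ∀ p q : Q K m × Q K n, θ p q → (∀ i j, lab θ p ≠ Label.cell i j) →
        lab θ p = lab θ q := by
      rintro ⟨f, g⟩ ⟨f', g'⟩ h hp
      have rf := rank_mem_Icc hm f
      have rf' := rank_mem_Icc hm f'
      have rg := rank_mem_Icc hn g
      have rg' := rank_mem_Icc hn g'
      rcases hl : lab θ (f, g) with _ | i | j | ⟨i, j⟩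
      · exact (label_eq_ff_iff.2 ((label_eq_ff_iff.1 hl).of_rel hm hn h)).symm
      · obtain ⟨rfl, hc, hcol⟩ := (label_eq_col_iff hm hn rf rg).1 hl
        obtain ⟨hH, hcol'⟩ := hc.of_rel hm hn hcol h
        have e := rank_eq_of_greenH hH
        refine ((label_eq_col_iff hm hn rf' rg').2 ⟨e.symm, ?_, ?_⟩).symm
        · exact e ▸ hc
        · exact e ▸ hcol'
      · obtain ⟨rfl, hc, hcol⟩ := (label_eq_row_iff hm hn rf rg).1 hl
        obtain ⟨hH, hcol'⟩ := IsCol.of_rel hn hm hc hcol (swap_rel.2 h)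
        have e := rank_eq_of_greenH hH
        refine ((label_eq_row_iff hm hn rf' rg').2 ⟨e.symm, ?_, ?_⟩).symm
        · exact e ▸ hc
        · exact e ▸ hcol'
      · exact absurd hl (hp i j)
    rintro p q h (hp | hq)
    · exact key' p q h hp
    · exact (key' q p (θ.symm h) hq).symm
  by_cases hp : ∀ i j, lab θ p ≠ Label.cell i j
  · exact key p q h (Or.inl hp)
  by_cases hq : ∀ i j, lab θ q ≠ Label.cell i j
  · exact key p q h (Or.inr hq)
  push Not at hp hq
  obtain ⟨i, j, hp⟩ := hp
  obtain ⟨i', j', hq⟩ := hq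
  obtain ⟨-, -, -, hp₁, hp₂⟩ := label_eq_cell_iff.1 hp
  obtain ⟨-, -, -, hq₁, hq₂⟩ := label_eq_cell_iff.1 hq
  have e₂ := rank_eq_of_greenH (greenH_snd_of_rel hm hn h hp₁ hq₁)
  have e₁ := rank_eq_of_greenH (greenH_snd_of_rel hn hm (swap_rel.2 h) hp₂ hq₂)
  change p.1.rank = q.1.rank at e₁
  rw [lab, lab, e₁, e₂]

open Classical in
/-- The height of the column part over `i`. -/
noncomputable def height (θ : Con (Q K m × Q K n)) (i : ℕ) : ℕ :=
  Nat.findGreatest (fun j => ColFull θ i j) n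

theorem height_le (i : ℕ) : height θ i ≤ n := by
  classical
  exact Nat.findGreatest_le n

theorem IsCol.one_le_height (hn : 1 ≤ n) {i : ℕ} (h : IsCol θ i) : 1 ≤ height θ i := by
  classical
  exact Nat.le_findGreatest hn h.1

theorem IsCol.colFull_height (hn : 1 ≤ n) {i : ℕ} (h : IsCol θ i) :
    ColFull θ i (height θ i) := by
  classical
  exact Nat.findGreatest_spec (P := fun j => ColFull θ i j) hn h.1

theorem le_height {i j : ℕ} (hj : j ≤ n) (h : ColFull θ i j) : j ≤ height θ i := by
  classical
  exact Nat.le_findGreatest hj h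

theorem IsCol.colFull_iff (hm : 1 ≤ m) (hn : 1 ≤ n) {i j : ℕ} (h : IsCol θ i) (him : i ≤ m)
    (hj : j ≤ n) : ColFull θ i (max j 1) ↔ j ≤ height θ i :=
  ⟨fun h' => (le_max_left _ _).trans (le_height (max_le hj hn) h'), fun h' =>
    (h.colFull_height hn).mono hm him le_rfl (max_le h' (h.one_le_height hn))⟩

end ProductCon

namespace LabelledPartition

open CompType

variable {K : Kind} {m n : ℕ} {L : LabelledPartition K m n} {o₁ : ImageOrder K m}
  {o₂ : ImageOrder K n} {B : Set (Q K m × Q K n)} {p q : Q K m × Q K n}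

theorem partRel_ff (ht : L.ty B = (F, F)) : L.partRel o₁ o₂ B p q ↔ p ∈ B ∧ q ∈ B := by
  unfold partRel
  rw [ht]
  simp

theorem partRel_col {a : CompType} (ha : a ≠ F) (ht : L.ty B = (a, F)) {i : ℕ}
    {N : Subgroup (Equiv.Perm (Fin i))} (hg : L.grp B = PartGroup.left i N) :
    L.partRel o₁ o₂ B p q ↔ p ∈ B ∧ q ∈ B ∧ ∃ (hp : p.1.rank = i), ∃ σ ∈ N,
      q.1 = o₁.act p.1 hp σ := by
  unfold partRel
  rw [ht, hg]
  refine and_congr_right fun _ => and_congr_right fun _ => ?_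
  have key : (∃ (i' : ℕ) (N' : Subgroup (Equiv.Perm (Fin i'))),
      PartGroup.left i N = PartGroup.left i' N' ∧
        GreenH p.1 q.1 ∧ ∃ (hp : p.1.rank = i'), ∃ σ ∈ N', q.1 = o₁.act p.1 hp σ) ↔
      ∃ (hp : p.1.rank = i), ∃ σ ∈ N, q.1 = o₁.act p.1 hp σ := by
    constructor
    · rintro ⟨i', N', h, -, h'⟩
      cases h
      exact h'
    · rintro ⟨hp, σ, hσ, h⟩
      exact ⟨i, N, rfl, h ▸ o₁.greenH_act _ hp σ, hp, σ, hσ, h⟩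
  cases a
  · exact absurd rfl ha
  · exact key
  · exact key

theorem partRel_row {a : CompType} (ha : a ≠ F) (ht : L.ty B = (F, a)) {i : ℕ}
    {N : Subgroup (Equiv.Perm (Fin i))} (hg : L.grp B = PartGroup.right i N) :
    L.partRel o₁ o₂ B p q ↔ p ∈ B ∧ q ∈ B ∧ ∃ (hp : p.2.rank = i), ∃ σ ∈ N,
      q.2 = o₂.act p.2 hp σ := by
  unfold partRel
  rw [ht, hg]
  refine and_congr_right fun _ => and_congr_right fun _ => ?_
  have key : (∃ (i' : ℕ) (N' : Subgroup (Equiv.Perm (Fin i'))),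
      PartGroup.right i N = PartGroup.right i' N' ∧
        GreenH p.2 q.2 ∧ ∃ (hp : p.2.rank = i'), ∃ σ ∈ N', q.2 = o₂.act p.2 hp σ) ↔
      ∃ (hp : p.2.rank = i), ∃ σ ∈ N, q.2 = o₂.act p.2 hp σ := by
    constructor
    · rintro ⟨i', N', h, -, h'⟩
      cases h
      exact h'
    · rintro ⟨hp, σ, hσ, h⟩
      exact ⟨i, N, rfl, h ▸ o₂.greenH_act _ hp σ, hp, σ, hσ, h⟩
  cases a
  · exact absurd rfl ha
  · exact key
  · exact key

theorem partRel_cell {a b : CompType} (ha : a ≠ F) (hb : b ≠ F) (ht : L.ty B = (a, b)) {i j : ℕ}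
    {N : Subgroup (Equiv.Perm (Fin i) × Equiv.Perm (Fin j))}
    (hg : L.grp B = PartGroup.both i j N) :
    L.partRel o₁ o₂ B p q ↔ p ∈ B ∧ q ∈ B ∧ ∃ (hp₁ : p.1.rank = i) (hp₂ : p.2.rank = j),
      ∃ σ ∈ N, q.1 = o₁.act p.1 hp₁ σ.1 ∧ q.2 = o₂.act p.2 hp₂ σ.2 := by
  unfold partRel
  rw [ht, hg]
  refine and_congr_right fun _ => and_congr_right fun _ => ?_
  have key : (∃ (i' j' : ℕ) (N' : Subgroup (Equiv.Perm (Fin i') × Equiv.Perm (Fin j'))),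
      PartGroup.both i j N = PartGroup.both i' j' N' ∧ GreenH p.1 q.1 ∧ GreenH p.2 q.2 ∧
        ∃ (hp₁ : p.1.rank = i') (hp₂ : p.2.rank = j'), ∃ στ ∈ N',
          q.1 = o₁.act p.1 hp₁ στ.1 ∧ q.2 = o₂.act p.2 hp₂ στ.2) ↔
      ∃ (hp₁ : p.1.rank = i) (hp₂ : p.2.rank = j),
      ∃ σ ∈ N, q.1 = o₁.act p.1 hp₁ σ.1 ∧ q.2 = o₂.act p.2 hp₂ σ.2 := by
    constructor
    · rintro ⟨i', j', N', h, -, -, h'⟩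
      cases h
      exact h'
    · rintro ⟨hp₁, hp₂, σ, hσ, h, h'⟩
      exact ⟨i, j, N, rfl, h ▸ o₁.greenH_act _ hp₁ _, h' ▸ o₂.greenH_act _ hp₂ _, hp₁, hp₂, σ, hσ,
        h, h'⟩
  cases a <;> cases b <;> first | exact absurd rfl ha | exact absurd rfl hb | exact key

end LabelledPartition

theorem Subgroup.ne_bot_of_mem {G : Type*} [Group G] {N : Subgroup G} {x : G} (hx : x ∈ N)
    (h : x ≠ 1) : N ≠ ⊥ := fun h' => h (Subgroup.mem_bot.1 (h' ▸ hx))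

theorem Subgroup.exists_mem_ne_one {G : Type*} [Group G] {N : Subgroup G} (h : N ≠ ⊥) :
    ∃ x ∈ N, x ≠ 1 := by
  by_contra! hcon
  exact h ((Subgroup.eq_bot_iff_forall _).2 hcon)

theorem Subgroup.eq_bot_prod_map_snd {G H : Type*} [Group G] [Group H] {N : Subgroup (G × H)}
    (h : N.map (MonoidHom.fst G H) = ⊥) : N = Subgroup.prod ⊥ (N.map (MonoidHom.snd G H)) := by
  have h1 : ∀ x ∈ N, x.1 = 1 := fun x hx => by
    have : x.1 ∈ N.map (MonoidHom.fst G H) := ⟨x, hx, rfl⟩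
    rwa [h, Subgroup.mem_bot] at this
  ext x
  rw [Subgroup.mem_prod, Subgroup.mem_bot]
  constructor
  · intro hx
    exact ⟨h1 x hx, x, hx, rfl⟩
  · rintro ⟨hx1, y, hy, hyx⟩
    rwa [show x = y from Prod.ext (hx1.trans (h1 y hy).symm) hyx.symm]

theorem Subgroup.eq_prod_bot_map_fst {G H : Type*} [Group G] [Group H] {N : Subgroup (G × H)}
    (h : N.map (MonoidHom.snd G H) = ⊥) : N = Subgroup.prod (N.map (MonoidHom.fst G H)) ⊥ := by
  have h1 : ∀ x ∈ N, x.2 = 1 := fun x hx => by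
    have : x.2 ∈ N.map (MonoidHom.snd G H) := ⟨x, hx, rfl⟩
    rwa [h, Subgroup.mem_bot] at this
  ext x
  rw [Subgroup.mem_prod, Subgroup.mem_bot]
  constructor
  · intro hx
    exact ⟨⟨x, hx, rfl⟩, h1 x hx⟩
  · rintro ⟨⟨y, hy, hyx⟩, hx2⟩
    rwa [show x = y from Prod.ext hyx.symm (hx2.trans (h1 y hy).symm)]

open Classical in
/-- The component type `ε` or `ℋ` belonging to a group. -/
noncomputable def CompType.ofGroup {G : Type*} [Group G] (N : Subgroup G) : CompType :=
  if N = ⊥ then CompType.E else CompType.H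

namespace CompType

variable {G : Type*} [Group G] {N : Subgroup G}

theorem ofGroup_ne_F : ofGroup N ≠ F := by
  unfold ofGroup
  split_ifs <;> simp

theorem ofGroup_eq_E : ofGroup N = E ↔ N = ⊥ := by
  unfold ofGroup
  split_ifs <;> simp_all

theorem ofGroup_eq_H : ofGroup N = H ↔ N ≠ ⊥ := by
  unfold ofGroup
  split_ifs <;> simp_all

end CompType

namespace Q

variable {K : Kind} {m n : ℕ}

theorem exists_pair {i j : ℕ} (hi : i ∈ Set.Icc K.zeroStar m) (hj : j ∈ Set.Icc K.zeroStar n) :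
    ∃ p : Q K m × Q K n, p.1.rank = i ∧ p.2.rank = j := by
  obtain ⟨f, hf⟩ := exists_rank_eq K hi
  obtain ⟨g, hg⟩ := exists_rank_eq K hj
  exact ⟨(f, g), hf, hg⟩

theorem rank_le_of_greenD {p q : Q K m × Q K n} (h : GreenD p q) :
    p.1.rank ≤ q.1.rank ∧ p.2.rank ≤ q.2.rank := by
  have hp : p ∈ {x | ∃ s t, x = s * q * t} := h ▸ ⟨1, 1, by simp⟩
  obtain ⟨s, t, rfl⟩ := hp
  exact ⟨rank_mul_mul_le _ _ _, rank_mul_mul_le _ _ _⟩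

theorem dSet_col_inj {i i' j j' : ℕ} (hi : i ∈ Set.Icc K.zeroStar m)
    (hj : j ∈ Set.Icc K.zeroStar n) (hj' : j' ∈ Set.Icc K.zeroStar n)
    (h : DSet K m n ({i} ×ˢ Set.Icc K.zeroStar j) = DSet K m n ({i'} ×ˢ Set.Icc K.zeroStar j')) :
    i = i' ∧ j = j' := by
  obtain ⟨p, hp⟩ := exists_pair hi hj
  obtain ⟨q, hq⟩ := exists_pair hi hj'
  have h₁ : p ∈ DSet K m n ({i'} ×ˢ Set.Icc K.zeroStar j') := by
    rw [← h]; exact ⟨hp.1, hp.2.symm ▸ hj.1, hp.2.le⟩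
  have e : i = i' := hp.1.symm.trans h₁.1
  have h₂ : q ∈ DSet K m n ({i} ×ˢ Set.Icc K.zeroStar j) := by
    rw [h]; exact ⟨hq.1.trans e, hq.2.symm ▸ hj'.1, hq.2.le⟩
  exact ⟨e, le_antisymm (hp.2 ▸ h₁.2.2) (hq.2 ▸ h₂.2.2)⟩

theorem dSet_row_inj {i i' j j' : ℕ} (hj : j ∈ Set.Icc K.zeroStar n)
    (hi : i ∈ Set.Icc K.zeroStar m) (hi' : i' ∈ Set.Icc K.zeroStar m)
    (h : DSet K m n (Set.Icc K.zeroStar i ×ˢ {j}) = DSet K m n (Set.Icc K.zeroStar i' ×ˢ {j'})) :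
    i = i' ∧ j = j' := by
  obtain ⟨p, hp⟩ := exists_pair hi hj
  obtain ⟨q, hq⟩ := exists_pair hi' hj
  have h₁ : p ∈ DSet K m n (Set.Icc K.zeroStar i' ×ˢ {j'}) := by
    rw [← h]; exact ⟨⟨hp.1.symm ▸ hi.1, hp.1.le⟩, hp.2⟩
  have e : j = j' := hp.2.symm.trans h₁.2
  have h₂ : q ∈ DSet K m n (Set.Icc K.zeroStar i ×ˢ {j}) := by
    rw [h]; exact ⟨⟨hq.1.symm ▸ hi'.1, hq.1.le⟩, hq.2.trans e⟩
  exact ⟨le_antisymm (hp.1 ▸ h₁.1.2) (hq.1 ▸ h₂.1.2), e⟩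

theorem dSet_cell_inj {i i' j j' : ℕ} (hi : i ∈ Set.Icc K.zeroStar m)
    (hj : j ∈ Set.Icc K.zeroStar n) (h : DSet K m n {(i, j)} = DSet K m n {(i', j')}) :
    i = i' ∧ j = j' := by
  obtain ⟨p, hp⟩ := exists_pair hi hj
  have h₁ : p ∈ DSet K m n {(i', j')} := by
    rw [← h]; exact Prod.ext hp.1 hp.2
  have h₁ : (p.1.rank, p.2.rank) = (i', j') := h₁
  rw [hp.1, hp.2] at h₁
  exact ⟨congrArg Prod.fst h₁, congrArg Prod.snd h₁⟩

end Q

namespace ProductCon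

open Q CompType

variable {K : Kind} {m n : ℕ}

/-- The type of the part with a given label. -/
noncomputable def Label.ty (θ : Con (Q K m × Q K n)) (o₁ : ImageOrder K m) (o₂ : ImageOrder K n) :
    Label → CompType × CompType
  | Label.ff => (F, F)
  | Label.col i => (ofGroup (colGroup θ o₁ i), F)
  | Label.row j => (F, ofGroup (colGroup (swap θ) o₂ j))
  | Label.cell i j => (ofGroup ((cellGroup θ o₁ o₂ i j).map (MonoidHom.fst _ _)),
      ofGroup ((cellGroup θ o₁ o₂ i j).map (MonoidHom.snd _ _)))

/-- The group of the part with a given label. -/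
def Label.grp (θ : Con (Q K m × Q K n)) (o₁ : ImageOrder K m) (o₂ : ImageOrder K n) :
    Label → PartGroup
  | Label.ff => PartGroup.left 0 ⊥
  | Label.col i => PartGroup.left i (colGroup θ o₁ i)
  | Label.row j => PartGroup.right j (colGroup (swap θ) o₂ j)
  | Label.cell i j => PartGroup.both i j (cellGroup θ o₁ o₂ i j)

/-- The part with a given label. -/
def partSet (θ : Con (Q K m × Q K n)) (l : Label) : Set (Q K m × Q K n) := {p | lab θ p = l}

open Classical in
/-- The label of a part. -/
noncomputable def labelOf (θ : Con (Q K m × Q K n)) (B : Set (Q K m × Q K n)) : Label :=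
  if h : B.Nonempty then lab θ h.some else Label.ff

theorem labelOf_partSet (θ : Con (Q K m × Q K n)) (p : Q K m × Q K n) :
    labelOf θ (partSet θ (lab θ p)) = lab θ p := by
  have h : (partSet θ (lab θ p)).Nonempty := ⟨p, rfl⟩
  rw [labelOf, dif_pos h]
  exact h.some_mem

/-- The labelled partition attached to a congruence. -/
noncomputable def partition (θ : Con (Q K m × Q K n)) (o₁ : ImageOrder K m)
    (o₂ : ImageOrder K n) : LabelledPartition K m n where
  parts := (Setoid.ker (lab θ)).classes
  isPartition := Setoid.isPartition_classes _
  preservesD := by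
    rintro _ ⟨p, rfl⟩ x y hxy hx
    have h₁ := rank_le_of_greenD hxy
    have h₂ := rank_le_of_greenD (Eq.symm hxy : GreenD y x)
    have e : lab θ y = lab θ x := by
      rw [lab, lab, le_antisymm h₁.1 h₂.1, le_antisymm h₁.2 h₂.2]
    exact e.trans hx
  ty B := (labelOf θ B).ty θ o₁ o₂
  grp B := (labelOf θ B).grp θ o₁ o₂

variable {θ : Con (Q K m × Q K n)} {o₁ : ImageOrder K m} {o₂ : ImageOrder K n}

theorem partSet_lab (θ : Con (Q K m × Q K n)) (o₁ : ImageOrder K m) (o₂ : ImageOrder K n)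
    (p : Q K m × Q K n) : partSet θ (lab θ p) ∈ (partition θ o₁ o₂).parts ∧
      (partition θ o₁ o₂).ty (partSet θ (lab θ p)) = (lab θ p).ty θ o₁ o₂ ∧
      (partition θ o₁ o₂).grp (partSet θ (lab θ p)) = (lab θ p).grp θ o₁ o₂ := by
  refine ⟨⟨p, rfl⟩, ?_, ?_⟩
  · change (labelOf θ _).ty θ o₁ o₂ = _
    rw [labelOf_partSet]
  · change (labelOf θ _).grp θ o₁ o₂ = _
    rw [labelOf_partSet]

theorem exists_lab_of_mem_parts {B : Set (Q K m × Q K n)} (hB : B ∈ (partition θ o₁ o₂).parts) :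
    ∃ (l : Label) (p : Q K m × Q K n), lab θ p = l ∧ B = partSet θ l ∧
      (partition θ o₁ o₂).ty B = l.ty θ o₁ o₂ ∧ (partition θ o₁ o₂).grp B = l.grp θ o₁ o₂ := by
  obtain ⟨p, rfl⟩ := hB
  exact ⟨_, p, rfl, rfl, (partSet_lab θ o₁ o₂ p).2.1, (partSet_lab θ o₁ o₂ p).2.2⟩

theorem part_at (θ : Con (Q K m × Q K n)) (o₁ : ImageOrder K m) (o₂ : ImageOrder K n) {i j : ℕ}
    (hi : i ∈ Set.Icc K.zeroStar m) (hj : j ∈ Set.Icc K.zeroStar n) :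
    partSet θ (label θ i j) ∈ (partition θ o₁ o₂).parts ∧
      DSet K m n {(i, j)} ⊆ partSet θ (label θ i j) ∧
      (partition θ o₁ o₂).ty (partSet θ (label θ i j)) = (label θ i j).ty θ o₁ o₂ ∧
      (partition θ o₁ o₂).grp (partSet θ (label θ i j)) = (label θ i j).grp θ o₁ o₂ := by
  obtain ⟨p, rfl, rfl⟩ := exists_pair hi hj
  obtain ⟨h₁, h₂, h₃⟩ := partSet_lab θ o₁ o₂ p
  refine ⟨h₁, ?_, h₂, h₃⟩
  intro q hq
  have hq : (q.1.rank, q.2.rank) = (p.1.rank, p.2.rank) := hq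
  change label θ _ _ = _
  obtain ⟨hq₁, hq₂⟩ := Prod.mk.injEq .. ▸ hq
  rw [hq₁, hq₂]

theorem label_of_colFull {i j : ℕ} (h : ColFull θ i (max j 1)) :
    label θ i j = Label.ff ∨ label θ i j = Label.col i := by
  unfold label
  split_ifs <;> simp_all

theorem label_of_rowFull (hm : 1 ≤ m) (hn : 1 ≤ n) {i j : ℕ} (hi : i ∈ Set.Icc K.zeroStar m)
    (hj : j ∈ Set.Icc K.zeroStar n) (h : RowFull θ (max i 1) j) :
    label θ i j = Label.ff ∨ label θ i j = Label.row j := by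
  unfold label
  split_ifs with h₁ h₂
  · exact Or.inl rfl
  · exact absurd h (not_rowFull_of_colFull hm hn hi hj h₁ h₂)
  · exact Or.inr rfl

theorem lab_eq_col_iff (hm : 1 ≤ m) (hn : 1 ≤ n) {p : Q K m × Q K n} {i : ℕ} :
    lab θ p = Label.col i ↔ p.1.rank = i ∧ IsCol θ i ∧ p.2.rank ≤ height θ i := by
  unfold lab
  rw [label_eq_col_iff hm hn (rank_mem_Icc hm _) (rank_mem_Icc hn _)]
  constructor
  · rintro ⟨rfl, hc, h⟩
    exact ⟨rfl, hc, (hc.colFull_iff hm hn (rank_le _) (rank_le _)).1 h⟩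
  · rintro ⟨rfl, hc, h⟩
    exact ⟨rfl, hc, (hc.colFull_iff hm hn (rank_le _) (rank_le _)).2 h⟩

theorem lab_eq_row_iff (hm : 1 ≤ m) (hn : 1 ≤ n) {p : Q K m × Q K n} {j : ℕ} :
    lab θ p = Label.row j ↔
      p.2.rank = j ∧ IsCol (swap θ) j ∧ p.1.rank ≤ height (swap θ) j := by
  unfold lab
  rw [label_eq_row_iff hm hn (rank_mem_Icc hm _) (rank_mem_Icc hn _)]
  constructor
  · rintro ⟨rfl, hc, h⟩
    exact ⟨rfl, hc, (hc.colFull_iff hn hm (rank_le _) (rank_le _)).1 h⟩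
  · rintro ⟨rfl, hc, h⟩
    exact ⟨rfl, hc, (hc.colFull_iff hn hm (rank_le _) (rank_le _)).2 h⟩

theorem partSet_ff (hm : 1 ≤ m) (hn : 1 ≤ n) : partSet θ Label.ff =
    DSet K m n {x | x ∈ Set.Icc K.zeroStar m ×ˢ Set.Icc K.zeroStar n ∧ FF θ x.1 x.2} := by
  ext p
  exact label_eq_ff_iff.trans
    ⟨fun h => ⟨⟨rank_mem_Icc hm _, rank_mem_Icc hn _⟩, h⟩, fun h => h.2⟩

theorem partSet_col (hm : 1 ≤ m) (hn : 1 ≤ n) {i : ℕ} (h : IsCol θ i) :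
    partSet θ (Label.col i) = DSet K m n ({i} ×ˢ Set.Icc K.zeroStar (height θ i)) := by
  ext p
  exact (lab_eq_col_iff hm hn).trans
    ⟨fun h => ⟨h.1, zeroStar_le_rank hn _, h.2.2⟩, fun h' => ⟨h'.1, h, h'.2.2⟩⟩

theorem partSet_row (hm : 1 ≤ m) (hn : 1 ≤ n) {j : ℕ} (h : IsCol (swap θ) j) :
    partSet θ (Label.row j) = DSet K m n (Set.Icc K.zeroStar (height (swap θ) j) ×ˢ {j}) := by
  ext p
  exact (lab_eq_row_iff hm hn).trans
    ⟨fun h => ⟨⟨zeroStar_le_rank hm _, h.2.2⟩, h.1⟩, fun h' => ⟨h'.2, h, h'.1.2⟩⟩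

theorem partSet_cell {p : Q K m × Q K n} {i j : ℕ} (h : lab θ p = Label.cell i j) :
    partSet θ (Label.cell i j) = DSet K m n {(i, j)} := by
  obtain ⟨rfl, rfl, h'⟩ := label_eq_cell_iff.1 h
  ext q
  refine label_eq_cell_iff.trans ⟨fun h => Prod.ext h.1 h.2.1, fun hq => ?_⟩
  have hq : (q.1.rank, q.2.rank) = (p.1.rank, p.2.rank) := hq
  obtain ⟨hq₁, hq₂⟩ := Prod.mk.injEq .. ▸ hq
  rw [hq₁, hq₂]
  exact ⟨rfl, rfl, h'⟩

theorem height_mem (hn : 1 ≤ n) {i : ℕ} (h : IsCol θ i) : height θ i ∈ Set.Icc K.zeroStar n :=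
  ⟨zeroStar_le_one.trans (h.one_le_height hn), height_le i⟩

theorem isCol_of_lab (hm : 1 ≤ m) (hn : 1 ≤ n) {p : Q K m × Q K n} {i : ℕ}
    (h : lab θ p = Label.col i) : i ∈ Set.Icc K.zeroStar m ∧ IsCol θ i := by
  obtain ⟨rfl, hc, -⟩ := (lab_eq_col_iff hm hn).1 h
  exact ⟨rank_mem_Icc hm _, hc⟩

theorem isCol_of_lab_row (hm : 1 ≤ m) (hn : 1 ≤ n) {p : Q K m × Q K n} {j : ℕ}
    (h : lab θ p = Label.row j) : j ∈ Set.Icc K.zeroStar n ∧ IsCol (swap θ) j := by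
  obtain ⟨rfl, hc, -⟩ := (lab_eq_row_iff hm hn).1 h
  exact ⟨rank_mem_Icc hn _, hc⟩

theorem mem_Icc_of_lab_cell (hm : 1 ≤ m) (hn : 1 ≤ n) {p : Q K m × Q K n} {i j : ℕ}
    (h : lab θ p = Label.cell i j) :
    i ∈ Set.Icc K.zeroStar m ∧ j ∈ Set.Icc K.zeroStar n := by
  obtain ⟨rfl, rfl, -⟩ := label_eq_cell_iff.1 h
  exact ⟨rank_mem_Icc hm _, rank_mem_Icc hn _⟩

theorem partition_col (hm : 1 ≤ m) (hn : 1 ≤ n) (o₁ : ImageOrder K m) (o₂ : ImageOrder K n)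
    {i : ℕ} (hi : i ∈ Set.Icc K.zeroStar m) (h : IsCol θ i) :
    partSet θ (Label.col i) ∈ (partition θ o₁ o₂).parts ∧
      (partition θ o₁ o₂).ty (partSet θ (Label.col i)) = (ofGroup (colGroup θ o₁ i), F) := by
  obtain ⟨p, hp₁, hp₂⟩ := exists_pair hi (height_mem hn h)
  have hl : lab θ p = Label.col i := (lab_eq_col_iff hm hn).2 ⟨hp₁, h, hp₂.le⟩
  have := partSet_lab θ o₁ o₂ p
  rw [hl] at this
  exact ⟨this.1, this.2.1⟩

theorem partition_row (hm : 1 ≤ m) (hn : 1 ≤ n) (o₁ : ImageOrder K m) (o₂ : ImageOrder K n)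
    {j : ℕ} (hj : j ∈ Set.Icc K.zeroStar n) (h : IsCol (swap θ) j) :
    partSet θ (Label.row j) ∈ (partition θ o₁ o₂).parts ∧
      (partition θ o₁ o₂).ty (partSet θ (Label.row j)) =
        (F, ofGroup (colGroup (swap θ) o₂ j)) := by
  obtain ⟨p, hp₁, hp₂⟩ := exists_pair (height_mem hm h) hj
  have hl : lab θ p = Label.row j := (lab_eq_row_iff hm hn).2 ⟨hp₂, h, hp₁.le⟩
  have := partSet_lab θ o₁ o₂ p
  rw [hl] at this
  exact ⟨this.1, this.2.1⟩

theorem partition_ff (hm : 1 ≤ m) (hn : 1 ≤ n) (o₁ : ImageOrder K m) (o₂ : ImageOrder K n)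
    {i j : ℕ} (hi : i ∈ Set.Icc K.zeroStar m) (hj : j ∈ Set.Icc K.zeroStar n) (h : FF θ i j) :
    partSet θ Label.ff ∈ (partition θ o₁ o₂).parts ∧
      (partition θ o₁ o₂).ty (partSet θ Label.ff) = (F, F) ∧
      DSet K m n (Set.Icc K.zeroStar i ×ˢ Set.Icc K.zeroStar j) ⊆ partSet θ Label.ff := by
  have := part_at θ o₁ o₂ hi hj
  rw [label_eq_ff_iff.2 h] at this
  refine ⟨this.1, this.2.2.1, ?_⟩
  rintro q ⟨⟨-, hq⟩, -, hq'⟩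
  exact label_eq_ff_iff.2 (h.mono hm hn hi.2 hj.2 hq hq')

theorem mem_colSet_iff (hm : 1 ≤ m) (hn : 1 ≤ n) {x : ℕ × ℕ} :
    x ∈ (partition θ o₁ o₂).colSet ↔ x.1 ∈ Set.Icc K.zeroStar m ∧ IsCol θ x.1 ∧
      colGroup θ o₁ x.1 = ⊥ ∧ x.2 = height θ x.1 := by
  constructor
  · rintro ⟨h₁, h₂, B, hB, ht, hBx⟩
    obtain ⟨l, p, hl, rfl, ht', -⟩ := exists_lab_of_mem_parts hB
    rw [ht'] at ht
    rcases l with _ | i | j | ⟨i, j⟩ <;> simp only [Label.ty, Prod.mk.injEq] at ht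
    · simp at ht
    · obtain ⟨hi, hc⟩ := isCol_of_lab hm hn hl
      rw [partSet_col hm hn hc] at hBx
      obtain ⟨rfl, h⟩ := dSet_col_inj hi (height_mem hn hc) h₂ hBx
      exact ⟨h₁, hc, ofGroup_eq_E.1 ht.1, h.symm⟩
    · simp at ht
    · exact absurd ht.2 ofGroup_ne_F
  · rintro ⟨h₁, hc, hN, h₂⟩
    obtain ⟨hp, ht⟩ := partition_col hm hn o₁ o₂ h₁ hc
    refine ⟨h₁, h₂ ▸ height_mem hn hc, _, hp, ?_, ?_⟩
    · rw [ht, ofGroup_eq_E.2 hN]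
    · rw [partSet_col hm hn hc, h₂]

theorem mem_rowSet_iff (hm : 1 ≤ m) (hn : 1 ≤ n) {x : ℕ × ℕ} :
    x ∈ (partition θ o₁ o₂).rowSet ↔ x.2 ∈ Set.Icc K.zeroStar n ∧ IsCol (swap θ) x.2 ∧
      colGroup (swap θ) o₂ x.2 = ⊥ ∧ x.1 = height (swap θ) x.2 := by
  constructor
  · rintro ⟨h₁, h₂, B, hB, ht, hBx⟩
    obtain ⟨l, p, hl, rfl, ht', -⟩ := exists_lab_of_mem_parts hB
    rw [ht'] at ht
    rcases l with _ | i | j | ⟨i, j⟩ <;> simp only [Label.ty, Prod.mk.injEq] at ht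
    · simp at ht
    · simp at ht
    · obtain ⟨hi, hc⟩ := isCol_of_lab_row hm hn hl
      rw [partSet_row hm hn hc] at hBx
      obtain ⟨h, rfl⟩ := dSet_row_inj hi (height_mem hm hc) h₁ hBx
      exact ⟨h₂, hc, ofGroup_eq_E.1 ht.2, h.symm⟩
    · exact absurd ht.1 ofGroup_ne_F
  · rintro ⟨h₁, hc, hN, h₂⟩
    obtain ⟨hp, ht⟩ := partition_row hm hn o₁ o₂ h₁ hc
    refine ⟨h₂ ▸ height_mem hm hc, h₁, _, hp, ?_, ?_⟩
    · rw [ht, ofGroup_eq_E.2 hN]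
    · rw [partSet_row hm hn hc, h₂]

theorem isCol_unique (hm : 1 ≤ m) (hn : 1 ≤ n) {i i' : ℕ}
    (hi' : i' ∈ Set.Icc K.zeroStar m) (hc : IsCol θ i) (hc' : IsCol θ i')
    (hN : colGroup θ o₁ i' ≠ ⊥) : i' ≤ i := by
  by_contra! hlt
  have h := ff_of_colGroup_ne_bot hm hn hi'.1 hi'.2 (hc'.one_le_height hn) (height_le _)
    (hc'.colFull_height hn) hN
  have := hi'.2
  exact hc.2 (h.mono hm hn (by omega) (height_le _) (by omega) (height_mem hn hc').1)

theorem isCol_between (hm : 1 ≤ m) (hn : 1 ≤ n) {i k i' : ℕ} (hi : i ∈ Set.Icc K.zeroStar m)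
    (hi' : i' ∈ Set.Icc K.zeroStar m) (hc : IsCol θ i) (hN : colGroup θ o₁ i = ⊥)
    (hc' : IsCol θ i') (h₁ : i ≤ k) (h₂ : k ≤ i') : IsCol θ k ∧ colGroup θ o₁ k = ⊥ := by
  have hk : k ∈ Set.Icc K.zeroStar m := ⟨hi.1.trans h₁, h₂.trans hi'.2⟩
  have hck : IsCol θ k := ⟨hc'.1.mono hm hi'.2 h₂ le_rfl, fun h =>
    hc.2 (h.mono hm hn hk.2 (zeroStar_le_one.trans hn) h₁ le_rfl)⟩
  refine ⟨hck, ?_⟩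
  by_contra hne
  have := isCol_unique hm hn hk hc hck hne
  obtain rfl : i = k := le_antisymm h₁ this
  exact hne hN

theorem height_antitone (hm : 1 ≤ m) (hn : 1 ≤ n) {i i' : ℕ} (hi' : i' ∈ Set.Icc K.zeroStar m)
    (hc' : IsCol θ i') (h : i ≤ i') : height θ i' ≤ height θ i :=
  le_height (height_le _) ((hc'.colFull_height hn).mono hm hi'.2 h le_rfl)

/-- Below a column there is a column or the part of type `FF`. -/
theorem ff_or_isCol_pred (hm : 1 ≤ m) (hn : 1 ≤ n) {i : ℕ} (hi : i ∈ Set.Icc K.zeroStar m)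
    (hc : IsCol θ i) : FF θ (i - 1) (height θ i) ∨ IsCol θ (i - 1) := by
  by_cases h : FF θ (i - 1) K.zeroStar
  · left
    have hcol := (hc.colFull_height hn).mono hm hi.2 (Nat.sub_le _ 1) le_rfl
    have him : i - 1 ≤ m := (Nat.sub_le _ _).trans hi.2
    exact ⟨⟨hcol, hcol.extend_row h.1.2 hm him (zeroStar_le_one.trans hn) le_rfl
      (height_mem hn hc).1⟩, h.2⟩
  · exact Or.inr ⟨hc.1.mono hm hi.2 (Nat.sub_le _ _) le_rfl, h⟩

end ProductCon

namespace ProductCon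

open Q CompType

variable {K : Kind} {m n : ℕ} {θ : Con (Q K m × Q K n)} {o₁ : ImageOrder K m}
  {o₂ : ImageOrder K n}

theorem eq_ff_of_ty {B : Set (Q K m × Q K n)} (hB : B ∈ (partition θ o₁ o₂).parts)
    (ht : (partition θ o₁ o₂).ty B = (F, F)) :
    B = partSet θ Label.ff ∧ ∃ p, lab θ p = Label.ff := by
  obtain ⟨l, p, hl, rfl, ht', -⟩ := exists_lab_of_mem_parts hB
  rw [ht'] at ht
  rcases l with _ | i | j | ⟨i, j⟩ <;> simp only [Label.ty, Prod.mk.injEq] at ht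
  · exact ⟨rfl, p, hl⟩
  · exact absurd ht.1 ofGroup_ne_F
  · exact absurd ht.2 ofGroup_ne_F
  · exact absurd ht.1 ofGroup_ne_F

theorem eq_col_of_ty (hm : 1 ≤ m) (hn : 1 ≤ n) {B : Set (Q K m × Q K n)}
    (hB : B ∈ (partition θ o₁ o₂).parts) {a : CompType} (ha : a ≠ F)
    (ht : (partition θ o₁ o₂).ty B = (a, F)) :
    ∃ i ∈ Set.Icc K.zeroStar m, IsCol θ i ∧
      B = DSet K m n ({i} ×ˢ Set.Icc K.zeroStar (height θ i)) ∧
      (partition θ o₁ o₂).grp B = PartGroup.left i (colGroup θ o₁ i) ∧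
      a = ofGroup (colGroup θ o₁ i) := by
  obtain ⟨l, p, hl, rfl, ht', hg⟩ := exists_lab_of_mem_parts hB
  rw [ht'] at ht
  rcases l with _ | i | j | ⟨i, j⟩ <;> simp only [Label.ty, Prod.mk.injEq] at ht
  · exact absurd ht.1.symm ha
  · obtain ⟨hi, hc⟩ := isCol_of_lab hm hn hl
    exact ⟨i, hi, hc, partSet_col hm hn hc, hg, ht.1.symm⟩
  · exact absurd ht.1.symm ha
  · exact absurd ht.2 ofGroup_ne_F

theorem eq_row_of_ty (hm : 1 ≤ m) (hn : 1 ≤ n) {B : Set (Q K m × Q K n)}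
    (hB : B ∈ (partition θ o₁ o₂).parts) {a : CompType} (ha : a ≠ F)
    (ht : (partition θ o₁ o₂).ty B = (F, a)) :
    ∃ j ∈ Set.Icc K.zeroStar n, IsCol (swap θ) j ∧
      B = DSet K m n (Set.Icc K.zeroStar (height (swap θ) j) ×ˢ {j}) ∧
      (partition θ o₁ o₂).grp B = PartGroup.right j (colGroup (swap θ) o₂ j) ∧
      a = ofGroup (colGroup (swap θ) o₂ j) := by
  obtain ⟨l, p, hl, rfl, ht', hg⟩ := exists_lab_of_mem_parts hB
  rw [ht'] at ht
  rcases l with _ | i | j | ⟨i, j⟩ <;> simp only [Label.ty, Prod.mk.injEq] at ht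
  · exact absurd ht.2.symm ha
  · exact absurd ht.2.symm ha
  · obtain ⟨hj, hc⟩ := isCol_of_lab_row hm hn hl
    exact ⟨j, hj, hc, partSet_row hm hn hc, hg, ht.2.symm⟩
  · exact absurd ht.1 ofGroup_ne_F

theorem eq_cell_of_ty (hm : 1 ≤ m) (hn : 1 ≤ n) {B : Set (Q K m × Q K n)}
    (hB : B ∈ (partition θ o₁ o₂).parts) {a b : CompType} (ha : a ≠ F) (hb : b ≠ F)
    (ht : (partition θ o₁ o₂).ty B = (a, b)) :
    ∃ i ∈ Set.Icc K.zeroStar m, ∃ j ∈ Set.Icc K.zeroStar n,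
      B = DSet K m n {(i, j)} ∧
      (partition θ o₁ o₂).grp B = PartGroup.both i j (cellGroup θ o₁ o₂ i j) ∧
      a = ofGroup ((cellGroup θ o₁ o₂ i j).map (MonoidHom.fst _ _)) ∧
      b = ofGroup ((cellGroup θ o₁ o₂ i j).map (MonoidHom.snd _ _)) := by
  obtain ⟨l, p, hl, rfl, ht', hg⟩ := exists_lab_of_mem_parts hB
  rw [ht'] at ht
  rcases l with _ | i | j | ⟨i, j⟩ <;> simp only [Label.ty, Prod.mk.injEq] at ht
  · exact absurd ht.1.symm ha
  · exact absurd ht.2.symm hb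
  · exact absurd ht.1.symm ha
  · obtain ⟨hi, hj⟩ := mem_Icc_of_lab_cell hm hn hl
    exact ⟨i, hi, j, hj, partSet_cell hl, hg, ht.1.symm, ht.2.symm⟩

theorem colFull_of_map_snd_ne_bot (hm : 1 ≤ m) (hn : 1 ≤ n) {i j : ℕ}
    (hi : i ∈ Set.Icc K.zeroStar m) (hj : j ∈ Set.Icc K.zeroStar n)
    (h : (cellGroup θ o₁ o₂ i j).map (MonoidHom.snd _ _) ≠ ⊥) :
    2 ≤ j ∧ ColFull θ i (j - 1) := by
  obtain ⟨_, ⟨σ, hσ, rfl⟩, hne⟩ := Subgroup.exists_mem_ne_one h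
  exact ⟨two_le_of_ne_bot h, colFull_of_mem_cellGroup hn hi hj hσ hne⟩

theorem rowFull_of_map_fst_ne_bot (hm : 1 ≤ m) (hn : 1 ≤ n) {i j : ℕ}
    (hi : i ∈ Set.Icc K.zeroStar m) (hj : j ∈ Set.Icc K.zeroStar n)
    (h : (cellGroup θ o₁ o₂ i j).map (MonoidHom.fst _ _) ≠ ⊥) :
    2 ≤ i ∧ RowFull θ (i - 1) j := by
  obtain ⟨_, ⟨σ, hσ, rfl⟩, hne⟩ := Subgroup.exists_mem_ne_one h
  exact ⟨two_le_of_ne_bot h,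
    colFull_of_mem_cellGroup hm hj hi (swap_mem_cellGroup.2 hσ) hne⟩

theorem part_below (hm : 1 ≤ m) (hn : 1 ≤ n) {i j : ℕ} (hi : i ∈ Set.Icc K.zeroStar m)
    (hj : j ∈ Set.Icc K.zeroStar n)
    (h : (cellGroup θ o₁ o₂ i j).map (MonoidHom.snd _ _) ≠ ⊥) :
    ∃ B' ∈ (partition θ o₁ o₂).parts, DSet K m n {(i, j - 1)} ⊆ B' ∧
      ((partition θ o₁ o₂).ty B' = (F, F) ∨
        (partition θ o₁ o₂).ty B' = (ofGroup (colGroup θ o₁ i), F) ∧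
          (partition θ o₁ o₂).grp B' = PartGroup.left i (colGroup θ o₁ i) ∧
          (cellGroup θ o₁ o₂ i j).map (MonoidHom.fst _ _) ≤ colGroup θ o₁ i) := by
  obtain ⟨h2, hc⟩ := colFull_of_map_snd_ne_bot hm hn hi hj h
  have hz : K.zeroStar ≤ 1 := zeroStar_le_one
  have hj' : j - 1 ∈ Set.Icc K.zeroStar n := ⟨by omega, (Nat.sub_le _ _).trans hj.2⟩
  obtain ⟨h₁, h₂, h₃, h₄⟩ := part_at θ o₁ o₂ hi hj'
  refine ⟨_, h₁, h₂, ?_⟩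
  rcases label_of_colFull (θ := θ) (i := i) (j := j - 1)
    (by rwa [max_eq_left (by omega)]) with hl | hl
  · exact Or.inl (by rw [h₃, hl]; rfl)
  · refine Or.inr ⟨by rw [h₃, hl]; rfl, by rw [h₄, hl]; rfl, ?_⟩
    rintro _ ⟨σ, hσ, rfl⟩
    exact fst_mem_colGroup hj (by omega) hσ hc

theorem part_left (hm : 1 ≤ m) (hn : 1 ≤ n) {i j : ℕ} (hi : i ∈ Set.Icc K.zeroStar m)
    (hj : j ∈ Set.Icc K.zeroStar n)
    (h : (cellGroup θ o₁ o₂ i j).map (MonoidHom.fst _ _) ≠ ⊥) :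
    ∃ B' ∈ (partition θ o₁ o₂).parts, DSet K m n {(i - 1, j)} ⊆ B' ∧
      ((partition θ o₁ o₂).ty B' = (F, F) ∨
        (partition θ o₁ o₂).ty B' = (F, ofGroup (colGroup (swap θ) o₂ j)) ∧
          (partition θ o₁ o₂).grp B' = PartGroup.right j (colGroup (swap θ) o₂ j) ∧
          (cellGroup θ o₁ o₂ i j).map (MonoidHom.snd _ _) ≤ colGroup (swap θ) o₂ j) := by
  obtain ⟨h2, hc⟩ := rowFull_of_map_fst_ne_bot hm hn hi hj h
  have hz : K.zeroStar ≤ 1 := zeroStar_le_one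
  have hi' : i - 1 ∈ Set.Icc K.zeroStar m := ⟨by omega, (Nat.sub_le _ _).trans hi.2⟩
  obtain ⟨h₁, h₂, h₃, h₄⟩ := part_at θ o₁ o₂ hi' hj
  refine ⟨_, h₁, h₂, ?_⟩
  rcases label_of_rowFull (θ := θ) hm hn hi' hj
    (by rwa [max_eq_left (by omega)]) with hl | hl
  · exact Or.inl (by rw [h₃, hl]; rfl)
  · refine Or.inr ⟨by rw [h₃, hl]; rfl, by rw [h₄, hl]; rfl, ?_⟩
    rintro _ ⟨σ, hσ, rfl⟩
    exact fst_mem_colGroup hi (by omega) (swap_mem_cellGroup.2 hσ) hc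

theorem partition_ff_shape (hm : 1 ≤ m) (hn : 1 ≤ n) {B : Set (Q K m × Q K n)}
    (hB : B ∈ (partition θ o₁ o₂).parts) (ht : (partition θ o₁ o₂).ty B = (F, F)) :
    ∃ P : Set (ℕ × ℕ), P ⊆ Set.Icc K.zeroStar m ×ˢ Set.Icc K.zeroStar n ∧
      (∀ x ∈ P, ∀ y ∈ Set.Icc K.zeroStar m ×ˢ Set.Icc K.zeroStar n, y ≤ x → y ∈ P) ∧
      B = DSet K m n P ∧
      (∀ j ≤ n, P ≠ {0} ×ˢ Set.Icc 0 j) ∧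
      (∀ i ≤ m, P ≠ Set.Icc 0 i ×ˢ {0}) := by
  obtain ⟨rfl, p, hp⟩ := eq_ff_of_ty hB ht
  have hF : FF θ p.1.rank p.2.rank := label_eq_ff_iff.1 hp
  have hz : K.zeroStar ≤ 1 := zeroStar_le_one
  have h01 : FF θ K.zeroStar 1 := ⟨hF.2.1, hF.2⟩
  have h10 : FF θ 1 K.zeroStar := ⟨hF.2.2, hF.2⟩
  refine ⟨_, fun x hx => hx.1, ?_, partSet_ff hm hn, ?_, ?_⟩
  · rintro x ⟨hx, hxF⟩ y hy hle
    exact ⟨hy, hxF.mono hm hn hx.1.2 hx.2.2 hle.1 hle.2⟩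
  · intro j _ h
    have : ((1, K.zeroStar) : ℕ × ℕ) ∈ ({0} ×ˢ Set.Icc 0 j : Set (ℕ × ℕ)) :=
      h ▸ ⟨⟨⟨hz, hm⟩, le_rfl, hz.trans hn⟩, h10⟩
    exact absurd this.1 one_ne_zero
  · intro i _ h
    have : ((K.zeroStar, 1) : ℕ × ℕ) ∈ (Set.Icc 0 i ×ˢ {0} : Set (ℕ × ℕ)) :=
      h ▸ ⟨⟨⟨le_rfl, hz.trans hm⟩, hz, hn⟩, h01⟩
    exact absurd this.2 one_ne_zero

theorem partition_cell_shape (hm : 1 ≤ m) (hn : 1 ≤ n) {B : Set (Q K m × Q K n)}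
    (hB : B ∈ (partition θ o₁ o₂).parts) (h₁ : ((partition θ o₁ o₂).ty B).1 ≠ F)
    (h₂ : ((partition θ o₁ o₂).ty B).2 ≠ F) :
    ∃ (i j : ℕ) (N : Subgroup (Equiv.Perm (Fin i) × Equiv.Perm (Fin j))),
      i ∈ Set.Icc K.zeroStar m ∧ j ∈ Set.Icc K.zeroStar n ∧
      B = DSet K m n {(i, j)} ∧ (partition θ o₁ o₂).grp B = PartGroup.both i j N ∧ N.Normal ∧
      ((partition θ o₁ o₂).ty B = (H, H) → 2 ≤ i ∧ 2 ≤ j ∧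
        N.map (MonoidHom.fst _ _) ≠ ⊥ ∧ N.map (MonoidHom.snd _ _) ≠ ⊥) ∧
      ((partition θ o₁ o₂).ty B = (E, H) → 2 ≤ j ∧
        ∃ N' : Subgroup (Equiv.Perm (Fin j)), N' ≠ ⊥ ∧ N = Subgroup.prod ⊥ N') ∧
      ((partition θ o₁ o₂).ty B = (H, E) → 2 ≤ i ∧
        ∃ N' : Subgroup (Equiv.Perm (Fin i)), N' ≠ ⊥ ∧ N = Subgroup.prod N' ⊥) ∧
      ((partition θ o₁ o₂).ty B = (E, E) → N = Subgroup.prod ⊥ ⊥) := by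
  obtain ⟨i, hi, j, hj, hBD, hg, e₁, e₂⟩ := eq_cell_of_ty hm hn hB h₁ h₂ rfl
  refine ⟨i, j, _, hi, hj, hBD, hg, cellGroup_normal _ _ _ _ _, ?_, ?_, ?_, ?_⟩ <;> intro ht <;>
    rw [ht] at e₁ e₂
  · have n₁ := ofGroup_eq_H.1 e₁.symm
    have n₂ := ofGroup_eq_H.1 e₂.symm
    exact ⟨two_le_of_ne_bot n₁, two_le_of_ne_bot n₂, n₁, n₂⟩
  · have n₂ := ofGroup_eq_H.1 e₂.symm
    exact ⟨two_le_of_ne_bot n₂, _, n₂, Subgroup.eq_bot_prod_map_snd (ofGroup_eq_E.1 e₁.symm)⟩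
  · have n₁ := ofGroup_eq_H.1 e₁.symm
    exact ⟨two_le_of_ne_bot n₁, _, n₁, Subgroup.eq_prod_bot_map_fst (ofGroup_eq_E.1 e₂.symm)⟩
  · have := Subgroup.eq_bot_prod_map_snd (ofGroup_eq_E.1 e₁.symm)
    rwa [ofGroup_eq_E.1 e₂.symm] at this

theorem partition_eh_place_fst (hm : 1 ≤ m) (hn : 1 ≤ n) {B : Set (Q K m × Q K n)}
    (hB : B ∈ (partition θ o₁ o₂).parts) (ht : (partition θ o₁ o₂).ty B = (E, H))
    {i j : ℕ} {N' : Subgroup (Equiv.Perm (Fin j))} (hBD : B = DSet K m n {(i, j)})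
    (hg : (partition θ o₁ o₂).grp B = PartGroup.both i j (Subgroup.prod ⊥ N'))
    (hi : K.zeroStar < i) :
    ∃ B' ∈ (partition θ o₁ o₂).parts, DSet K m n {(i - 1, j)} ⊆ B' ∧
      ((partition θ o₁ o₂).ty B' = (F, F) ∨ (partition θ o₁ o₂).ty B' = (H, F) ∨
        (partition θ o₁ o₂).ty B' = (E, F) ∨
        ((partition θ o₁ o₂).ty B' = (F, H) ∧ ∃ M : Subgroup (Equiv.Perm (Fin j)),
          (partition θ o₁ o₂).grp B' = PartGroup.right j M ∧ N' ≤ M) ∨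
        (((partition θ o₁ o₂).ty B' = (H, H) ∨ (partition θ o₁ o₂).ty B' = (E, H)) ∧
          ∃ M : Subgroup (Equiv.Perm (Fin (i - 1)) × Equiv.Perm (Fin j)),
            (partition θ o₁ o₂).grp B' = PartGroup.both (i - 1) j M ∧
              Subgroup.prod ⊥ N' ≤ M)) := by
  obtain ⟨i', hi', j', hj', hBD', hg', e₁, e₂⟩ :=
    eq_cell_of_ty hm hn hB (by simp) (by simp) ht
  obtain ⟨rfl, rfl⟩ := dSet_cell_inj hi' hj' (hBD'.symm.trans hBD)
  rw [hg'] at hg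
  have hN : cellGroup θ o₁ o₂ i' j' = Subgroup.prod ⊥ N' := by
    injection hg
  have hmem : ∀ τ ∈ N', (1, τ) ∈ cellGroup θ o₁ o₂ i' j' := fun τ hτ => by
    rw [hN]; exact ⟨Subgroup.mem_bot.2 rfl, hτ⟩
  obtain ⟨_, ⟨σ, hσ, rfl⟩, hne⟩ := Subgroup.exists_mem_ne_one (ofGroup_eq_H.1 e₂.symm)
  have hσN : σ.2 ∈ N' := by
    rw [hN] at hσ
    exact hσ.2
  have hi₁ : i' - 1 ∈ Set.Icc K.zeroStar m := ⟨by omega, (Nat.sub_le _ _).trans hi'.2⟩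
  obtain ⟨h₁, h₂, h₃, h₄⟩ := part_at θ o₁ o₂ hi₁ hj'
  refine ⟨_, h₁, h₂, ?_⟩
  rcases hl : label θ (i' - 1) j' with _ | a | b | ⟨a, b⟩ <;> rw [hl] at h₃ h₄
  · exact Or.inl h₃
  · rcases hc : ofGroup (colGroup θ o₁ a)
    · exact absurd hc ofGroup_ne_F
    · exact Or.inr (Or.inl (by rw [h₃, Label.ty, hc]))
    · exact Or.inr (Or.inr (Or.inl (by rw [h₃, Label.ty, hc])))
  · obtain ⟨rfl, -⟩ := (label_eq_row_iff hm hn hi₁ hj').1 hl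
    have hle : N' ≤ colGroup (swap θ) o₂ j' := fun τ hτ => snd_mem_colGroup_swap hi' (hmem τ hτ)
    refine Or.inr (Or.inr (Or.inr (Or.inl ⟨?_, _, h₄, hle⟩)))
    rw [h₃, Label.ty, ofGroup_eq_H.2 (Subgroup.ne_bot_of_mem (hle hσN) hne)]
  · obtain ⟨rfl, rfl, -⟩ := label_eq_cell_iff.1 hl
    have hle : Subgroup.prod ⊥ N' ≤ cellGroup θ o₁ o₂ (i' - 1) j' := by
      rintro ⟨σ, τ⟩ ⟨h, hτ⟩
      obtain rfl : σ = 1 := Subgroup.mem_bot.1 h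
      exact mem_cellGroup_of_le hi' (Nat.sub_le _ _) (hmem τ hτ)
    refine Or.inr (Or.inr (Or.inr (Or.inr ⟨?_, _, h₄, hle⟩)))
    have hH : ofGroup ((cellGroup θ o₁ o₂ (i' - 1) j').map (MonoidHom.snd _ _)) = H :=
      ofGroup_eq_H.2 (Subgroup.ne_bot_of_mem (x := σ.2)
        ⟨(1, σ.2), hle ⟨Subgroup.mem_bot.2 rfl, hσN⟩, rfl⟩ hne)
    rw [h₃, Label.ty, hH]
    rcases hc : ofGroup ((cellGroup θ o₁ o₂ (i' - 1) j').map (MonoidHom.fst _ _))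
    · exact absurd hc ofGroup_ne_F
    · exact Or.inl (by rw [hc])
    · exact Or.inr (by rw [hc])

theorem partition_he_place_snd (hm : 1 ≤ m) (hn : 1 ≤ n) {B : Set (Q K m × Q K n)}
    (hB : B ∈ (partition θ o₁ o₂).parts) (ht : (partition θ o₁ o₂).ty B = (H, E))
    {i j : ℕ} {N' : Subgroup (Equiv.Perm (Fin i))} (hBD : B = DSet K m n {(i, j)})
    (hg : (partition θ o₁ o₂).grp B = PartGroup.both i j (Subgroup.prod N' ⊥))
    (hj : K.zeroStar < j) :
    ∃ B' ∈ (partition θ o₁ o₂).parts, DSet K m n {(i, j - 1)} ⊆ B' ∧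
      ((partition θ o₁ o₂).ty B' = (F, F) ∨ (partition θ o₁ o₂).ty B' = (F, H) ∨
        (partition θ o₁ o₂).ty B' = (F, E) ∨
        ((partition θ o₁ o₂).ty B' = (H, F) ∧ ∃ M : Subgroup (Equiv.Perm (Fin i)),
          (partition θ o₁ o₂).grp B' = PartGroup.left i M ∧ N' ≤ M) ∨
        (((partition θ o₁ o₂).ty B' = (H, H) ∨ (partition θ o₁ o₂).ty B' = (H, E)) ∧
          ∃ M : Subgroup (Equiv.Perm (Fin i) × Equiv.Perm (Fin (j - 1))),
            (partition θ o₁ o₂).grp B' = PartGroup.both i (j - 1) M ∧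
              Subgroup.prod N' ⊥ ≤ M)) := by
  obtain ⟨i', hi', j', hj', hBD', hg', e₁, e₂⟩ :=
    eq_cell_of_ty hm hn hB (by simp) (by simp) ht
  obtain ⟨rfl, rfl⟩ := dSet_cell_inj hi' hj' (hBD'.symm.trans hBD)
  rw [hg'] at hg
  have hN : cellGroup θ o₁ o₂ i' j' = Subgroup.prod N' ⊥ := by
    injection hg
  have hmem : ∀ τ ∈ N', (1, τ) ∈ cellGroup (swap θ) o₂ o₁ j' i' := fun τ hτ => by
    refine swap_mem_cellGroup.2 (?_ : (τ, 1) ∈ cellGroup θ o₁ o₂ i' j')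
    rw [hN]; exact ⟨hτ, Subgroup.mem_bot.2 rfl⟩
  obtain ⟨_, ⟨σ, hσ, rfl⟩, hne⟩ := Subgroup.exists_mem_ne_one (ofGroup_eq_H.1 e₁.symm)
  have hσN : σ.1 ∈ N' := by
    rw [hN] at hσ
    exact hσ.1
  have hj₁ : j' - 1 ∈ Set.Icc K.zeroStar n := ⟨by omega, (Nat.sub_le _ _).trans hj'.2⟩
  obtain ⟨h₁, h₂, h₃, h₄⟩ := part_at θ o₁ o₂ hi' hj₁
  refine ⟨_, h₁, h₂, ?_⟩
  rcases hl : label θ i' (j' - 1) with _ | a | b | ⟨a, b⟩ <;> rw [hl] at h₃ h₄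
  · exact Or.inl h₃
  · obtain ⟨rfl, -⟩ := (label_eq_col_iff hm hn hi' hj₁).1 hl
    have hle : N' ≤ colGroup θ o₁ i' := fun τ hτ =>
      snd_mem_colGroup_swap (θ := swap θ) hj' (hmem τ hτ)
    refine Or.inr (Or.inr (Or.inr (Or.inl ⟨?_, _, h₄, hle⟩)))
    rw [h₃, Label.ty, ofGroup_eq_H.2 (Subgroup.ne_bot_of_mem (hle hσN) hne)]
  · rcases hc : ofGroup (colGroup (swap θ) o₂ b)
    · exact absurd hc ofGroup_ne_F
    · exact Or.inr (Or.inl (by rw [h₃, Label.ty, hc]))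
    · exact Or.inr (Or.inr (Or.inl (by rw [h₃, Label.ty, hc])))
  · obtain ⟨rfl, rfl, -⟩ := label_eq_cell_iff.1 hl
    have hle : Subgroup.prod N' ⊥ ≤ cellGroup θ o₁ o₂ i' (j' - 1) := by
      rintro ⟨τ, σ⟩ ⟨hτ, h⟩
      obtain rfl : σ = 1 := Subgroup.mem_bot.1 h
      exact swap_mem_cellGroup.1 (mem_cellGroup_of_le hj' (Nat.sub_le _ _) (hmem τ hτ))
    refine Or.inr (Or.inr (Or.inr (Or.inr ⟨?_, _, h₄, hle⟩)))
    have hH : ofGroup ((cellGroup θ o₁ o₂ i' (j' - 1)).map (MonoidHom.fst _ _)) = H :=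
      ofGroup_eq_H.2 (Subgroup.ne_bot_of_mem (x := σ.1)
        ⟨(σ.1, 1), hle ⟨hσN, Subgroup.mem_bot.2 rfl⟩, rfl⟩ hne)
    rw [h₃, Label.ty, hH]
    rcases hc : ofGroup ((cellGroup θ o₁ o₂ i' (j' - 1)).map (MonoidHom.snd _ _))
    · exact absurd hc ofGroup_ne_F
    · exact Or.inl (by rw [hc])
    · exact Or.inr (by rw [hc])

theorem partition_admissible (hm : 1 ≤ m) (hn : 1 ≤ n) (θ : Con (Q K m × Q K n))
    (o₁ : ImageOrder K m) (o₂ : ImageOrder K n) : (partition θ o₁ o₂).Admissible where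
  ff_unique B hB B' hB' ht ht' := (eq_ff_of_ty hB ht).1.trans (eq_ff_of_ty hB' ht').1.symm
  ff_shape B hB ht := partition_ff_shape hm hn hB ht
  col_shape B hB ht := by
    obtain ⟨a, ha, ht⟩ : ∃ a, a ≠ F ∧ (partition θ o₁ o₂).ty B = (a, F) := by
      rcases ht with ht | ht <;> exact ⟨_, by simp, ht⟩
    obtain ⟨i, hi, hc, hBD, hg, rfl⟩ := eq_col_of_ty hm hn hB ha ht
    refine ⟨i, _, _, hi, ⟨hc.one_le_height hn, height_le _⟩, hBD, hg, colGroup_normal _ _ _, ?_, ?_⟩ <;>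
      rw [ht] <;> intro h <;> simp only [Prod.mk.injEq, and_true] at h
    · exact ⟨two_le_of_ne_bot (ofGroup_eq_H.1 h), ofGroup_eq_H.1 h⟩
    · exact ofGroup_eq_E.1 h
  row_shape B hB ht := by
    obtain ⟨a, ha, ht⟩ : ∃ a, a ≠ F ∧ (partition θ o₁ o₂).ty B = (F, a) := by
      rcases ht with ht | ht <;> exact ⟨_, by simp, ht⟩
    obtain ⟨j, hj, hc, hBD, hg, rfl⟩ := eq_row_of_ty hm hn hB ha ht
    refine ⟨_, j, _, ⟨hc.one_le_height hm, height_le _⟩, hj, hBD, hg, colGroup_normal _ _ _, ?_, ?_⟩ <;>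
      rw [ht] <;> intro h <;> simp only [Prod.mk.injEq, true_and] at h
    · exact ⟨two_le_of_ne_bot (ofGroup_eq_H.1 h), ofGroup_eq_H.1 h⟩
    · exact ofGroup_eq_E.1 h
  hf_unique B hB B' hB' ht ht' := by
    obtain ⟨i, hi, hc, rfl, -, h⟩ := eq_col_of_ty hm hn hB (by simp) ht
    obtain ⟨i', hi', hc', rfl, -, h'⟩ := eq_col_of_ty hm hn hB' (by simp) ht'
    rw [le_antisymm (isCol_unique hm hn hi hc' hc (ofGroup_eq_H.1 h.symm))
      (isCol_unique hm hn hi' hc hc' (ofGroup_eq_H.1 h'.symm))]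
  hf_place B hB ht i _ j hj hBD := by
    obtain ⟨i', hi', hc, hBD', -, h⟩ := eq_col_of_ty hm hn hB (by simp) ht
    have hz : K.zeroStar ≤ 1 := zeroStar_le_one
    obtain ⟨rfl, rfl⟩ := dSet_col_inj hi' (height_mem hn hc) ⟨hz.trans hj.1, hj.2⟩
      (hBD'.symm.trans hBD)
    have hN := ofGroup_eq_H.1 h.symm
    have h2 := two_le_of_ne_bot hN
    obtain ⟨h₁, h₂, h₃⟩ := partition_ff hm hn o₁ o₂ (i := i' - 1)
      ⟨by omega, (Nat.sub_le _ _).trans hi'.2⟩ (height_mem hn hc)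
      (ff_of_colGroup_ne_bot hm hn hi'.1 hi'.2 hj.1 hj.2 (hc.colFull_height hn) hN)
    exact ⟨_, h₁, h₂, h₃⟩
  fh_unique B hB B' hB' ht ht' := by
    obtain ⟨i, hi, hc, rfl, -, h⟩ := eq_row_of_ty hm hn hB (by simp) ht
    obtain ⟨i', hi', hc', rfl, -, h'⟩ := eq_row_of_ty hm hn hB' (by simp) ht'
    rw [le_antisymm (isCol_unique hn hm hi hc' hc (ofGroup_eq_H.1 h.symm))
      (isCol_unique hn hm hi' hc hc' (ofGroup_eq_H.1 h'.symm))]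
  fh_place B hB ht i hi j _ hBD := by
    obtain ⟨j', hj', hc, hBD', -, h⟩ := eq_row_of_ty hm hn hB (by simp) ht
    have hz : K.zeroStar ≤ 1 := zeroStar_le_one
    obtain ⟨rfl, rfl⟩ := dSet_row_inj hj' (height_mem hm hc) ⟨hz.trans hi.1, hi.2⟩
      (hBD'.symm.trans hBD)
    have hN := ofGroup_eq_H.1 h.symm
    have h2 := two_le_of_ne_bot hN
    obtain ⟨h₁, h₂, h₃⟩ := partition_ff hm hn o₁ o₂ (j := j' - 1) (height_mem hm hc)
      ⟨by omega, (Nat.sub_le _ _).trans hj'.2⟩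
      (ff_of_colGroup_ne_bot hn hm hj'.1 hj'.2 hi.1 hi.2 (hc.colFull_height hm) hN).swap
    exact ⟨_, h₁, h₂, h₃⟩
  ef_consecutive := by
    refine ⟨?_⟩
    rintro _ ⟨x, hx, rfl⟩ _ ⟨y, hy, rfl⟩ k ⟨hk₁, hk₂⟩
    obtain ⟨hx₁, hx₂, hx₃, -⟩ := (mem_colSet_iff hm hn).1 hx
    obtain ⟨hy₁, hy₂, -, -⟩ := (mem_colSet_iff hm hn).1 hy
    obtain ⟨h₁, h₂⟩ := isCol_between hm hn hx₁ hy₁ hx₂ hx₃ hy₂ hk₁ hk₂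
    exact ⟨(k, height θ k), (mem_colSet_iff hm hn).2
      ⟨⟨hx₁.1.trans hk₁, hk₂.trans hy₁.2⟩, h₁, h₂, rfl⟩, rfl⟩
  ef_antitone x hx y hy hxy := by
    obtain ⟨-, -, -, hx⟩ := (mem_colSet_iff hm hn).1 hx
    obtain ⟨hy₁, hy₂, -, hy⟩ := (mem_colSet_iff hm hn).1 hy
    rw [hx, hy]
    exact height_antitone hm hn hy₁ hy₂ hxy
  ef_place x hx hleast hlt := by
    obtain ⟨hx₁, hx₂, hx₃, hx₄⟩ := (mem_colSet_iff hm hn).1 hx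
    have hi : x.1 - 1 ∈ Set.Icc K.zeroStar m := ⟨by omega, (Nat.sub_le _ _).trans hx₁.2⟩
    rw [hx₄]
    rcases ff_or_isCol_pred hm hn hx₁ hx₂ with hF | hc
    · obtain ⟨h₁, h₂, h₃⟩ := partition_ff hm hn o₁ o₂ hi (height_mem hn hx₂) hF
      refine ⟨_, h₁, Or.inr h₂, fun q hq => h₃ ⟨?_, hq.2⟩⟩
      have : q.1.rank = x.1 - 1 := hq.1
      exact ⟨zeroStar_le_rank hm _, this.le⟩
    · obtain ⟨h₁, h₂⟩ := partition_col hm hn o₁ o₂ hi hc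
      have hN : colGroup θ o₁ (x.1 - 1) ≠ ⊥ := by
        intro h
        have := hleast.2 ⟨(x.1 - 1, height θ (x.1 - 1)), (mem_colSet_iff hm hn).2 ⟨hi, hc, h, rfl⟩, rfl⟩
        change x.1 ≤ x.1 - 1 at this
        omega
      rw [ofGroup_eq_H.2 hN] at h₂
      refine ⟨_, h₁, Or.inl h₂, ?_⟩
      rw [partSet_col hm hn hc]
      exact fun q hq => ⟨hq.1, hq.2.1,
        hq.2.2.trans (height_antitone hm hn hx₁ hx₂ (Nat.sub_le _ _))⟩
  fe_consecutive := by
    refine ⟨?_⟩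
    rintro _ ⟨x, hx, rfl⟩ _ ⟨y, hy, rfl⟩ k ⟨hk₁, hk₂⟩
    obtain ⟨hx₁, hx₂, hx₃, -⟩ := (mem_rowSet_iff hm hn).1 hx
    obtain ⟨hy₁, hy₂, -, -⟩ := (mem_rowSet_iff hm hn).1 hy
    obtain ⟨h₁, h₂⟩ := isCol_between hn hm hx₁ hy₁ hx₂ hx₃ hy₂ hk₁ hk₂
    exact ⟨(height (swap θ) k, k), (mem_rowSet_iff hm hn).2
      ⟨⟨hx₁.1.trans hk₁, hk₂.trans hy₁.2⟩, h₁, h₂, rfl⟩, rfl⟩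
  fe_antitone x hx y hy hxy := by
    obtain ⟨-, -, -, hx⟩ := (mem_rowSet_iff hm hn).1 hx
    obtain ⟨hy₁, hy₂, -, hy⟩ := (mem_rowSet_iff hm hn).1 hy
    rw [hx, hy]
    exact height_antitone hn hm hy₁ hy₂ hxy
  fe_place x hx hleast hlt := by
    obtain ⟨hx₁, hx₂, hx₃, hx₄⟩ := (mem_rowSet_iff hm hn).1 hx
    have hj : x.2 - 1 ∈ Set.Icc K.zeroStar n := ⟨by omega, (Nat.sub_le _ _).trans hx₁.2⟩
    rw [hx₄]
    rcases ff_or_isCol_pred hn hm hx₁ hx₂ with hF | hc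
    · obtain ⟨h₁, h₂, h₃⟩ := partition_ff hm hn o₁ o₂ (height_mem hm hx₂) hj hF.swap
      refine ⟨_, h₁, Or.inr h₂, fun q hq => h₃ ⟨hq.1, ?_⟩⟩
      have : q.2.rank = x.2 - 1 := hq.2
      exact ⟨zeroStar_le_rank hn _, this.le⟩
    · obtain ⟨h₁, h₂⟩ := partition_row hm hn o₁ o₂ hj hc
      have hN : colGroup (swap θ) o₂ (x.2 - 1) ≠ ⊥ := by
        intro h
        have := hleast.2 ⟨(height (swap θ) (x.2 - 1), x.2 - 1), (mem_rowSet_iff hm hn).2 ⟨hj, hc, h, rfl⟩, rfl⟩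
        change x.2 ≤ x.2 - 1 at this
        omega
      rw [ofGroup_eq_H.2 hN] at h₂
      refine ⟨_, h₁, Or.inl h₂, ?_⟩
      rw [partSet_row hm hn hc]
      exact fun q hq => ⟨⟨hq.1.1,
        hq.1.2.trans (height_antitone hn hm hx₁ hx₂ (Nat.sub_le _ _))⟩, hq.2⟩
  cell_shape B hB h₁ h₂ := partition_cell_shape hm hn hB h₁ h₂
  hh_place_snd B hB ht i j N hBD hg := by
    obtain ⟨i', hi, j', hj, hBD', hg', e₁, e₂⟩ := eq_cell_of_ty hm hn hB (by simp) (by simp) ht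
    obtain ⟨rfl, rfl⟩ := dSet_cell_inj hi hj (hBD'.symm.trans hBD)
    rw [hg'] at hg
    cases hg
    obtain ⟨B', hB', hs, h | ⟨h, h', hle⟩⟩ := part_below hm hn hi hj (ofGroup_eq_H.1 e₂.symm)
    · exact ⟨B', hB', hs, Or.inl h⟩
    · have hN : colGroup θ o₁ i' ≠ ⊥ := fun hbot =>
        ofGroup_eq_H.1 e₁.symm (le_bot_iff.1 (hbot ▸ hle))
      rw [ofGroup_eq_H.2 hN] at h
      exact ⟨B', hB', hs, Or.inr ⟨h, _, h', hle⟩⟩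
  hh_place_fst B hB ht i j N hBD hg := by
    obtain ⟨i', hi, j', hj, hBD', hg', e₁, e₂⟩ := eq_cell_of_ty hm hn hB (by simp) (by simp) ht
    obtain ⟨rfl, rfl⟩ := dSet_cell_inj hi hj (hBD'.symm.trans hBD)
    rw [hg'] at hg
    cases hg
    obtain ⟨B', hB', hs, h | ⟨h, h', hle⟩⟩ := part_left hm hn hi hj (ofGroup_eq_H.1 e₁.symm)
    · exact ⟨B', hB', hs, Or.inl h⟩
    · have hN : colGroup (swap θ) o₂ j' ≠ ⊥ := fun hbot =>
        ofGroup_eq_H.1 e₂.symm (le_bot_iff.1 (hbot ▸ hle))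
      rw [ofGroup_eq_H.2 hN] at h
      exact ⟨B', hB', hs, Or.inr ⟨h, _, h', hle⟩⟩
  eh_place_snd B hB ht i j hBD := by
    obtain ⟨i', hi, j', hj, hBD', hg', e₁, e₂⟩ := eq_cell_of_ty hm hn hB (by simp) (by simp) ht
    obtain ⟨rfl, rfl⟩ := dSet_cell_inj hi hj (hBD'.symm.trans hBD)
    obtain ⟨B', hB', hs, h | ⟨h, -⟩⟩ := part_below hm hn hi hj (ofGroup_eq_H.1 e₂.symm)
    · exact ⟨B', hB', hs, Or.inl h⟩
    · rcases hc : ofGroup (colGroup θ o₁ i')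
      · exact absurd hc ofGroup_ne_F
      · exact ⟨B', hB', hs, Or.inr (Or.inl (by rw [h, hc]))⟩
      · exact ⟨B', hB', hs, Or.inr (Or.inr (by rw [h, hc]))⟩
  eh_place_fst B hB ht i j N' hBD hg hi := partition_eh_place_fst hm hn hB ht hBD hg hi
  he_place_fst B hB ht i j hBD := by
    obtain ⟨i', hi, j', hj, hBD', hg', e₁, e₂⟩ := eq_cell_of_ty hm hn hB (by simp) (by simp) ht
    obtain ⟨rfl, rfl⟩ := dSet_cell_inj hi hj (hBD'.symm.trans hBD)
    obtain ⟨B', hB', hs, h | ⟨h, -⟩⟩ := part_left hm hn hi hj (ofGroup_eq_H.1 e₁.symm)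
    · exact ⟨B', hB', hs, Or.inl h⟩
    · rcases hc : ofGroup (colGroup (swap θ) o₂ j')
      · exact absurd hc ofGroup_ne_F
      · exact ⟨B', hB', hs, Or.inr (Or.inl (by rw [h, hc]))⟩
      · exact ⟨B', hB', hs, Or.inr (Or.inr (by rw [h, hc]))⟩
  he_place_snd B hB ht i j N' hBD hg hj := partition_he_place_snd hm hn hB ht hBD hg hj

/-- A congruence is recovered from its labelled partition. -/
theorem rel_iff_partition_rel (hm : 1 ≤ m) (hn : 1 ≤ n) (θ : Con (Q K m × Q K n))
    (o₁ : ImageOrder K m) (o₂ : ImageOrder K n) (p q : Q K m × Q K n) :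
    θ p q ↔ (partition θ o₁ o₂).rel o₁ o₂ p q := by
  have key : (partition θ o₁ o₂).rel o₁ o₂ p q ↔
      (partition θ o₁ o₂).partRel o₁ o₂ (partSet θ (lab θ p)) p q := by
    constructor
    · rintro ⟨_, ⟨r, rfl⟩, h⟩
      have hr : lab θ p = lab θ r := h.1
      have : {x | (Setoid.ker (lab θ)) x r} = partSet θ (lab θ p) := by
        rw [hr]; rfl
      rwa [this] at h
    · exact fun h => ⟨_, (partSet_lab θ o₁ o₂ p).1, h⟩
  rw [key]
  obtain ⟨-, ht, hg⟩ := partSet_lab θ o₁ o₂ p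
  have hp : p ∈ partSet θ (lab θ p) := rfl
  have hq : q ∈ partSet θ (lab θ p) ↔ lab θ q = lab θ p := Iff.rfl
  have hlab : θ p q → lab θ q = lab θ p := fun h => (lab_eq_of_rel hm hn h).symm
  obtain ⟨f, g⟩ := p
  obtain ⟨f', g'⟩ := q
  rcases hl : lab θ (f, g) with _ | i | j | ⟨i, j⟩ <;> rw [hl] at ht hg hp hq hlab
  · rw [LabelledPartition.partRel_ff ht, hq]
    refine ⟨fun h => ⟨hp, hlab h⟩, fun h => ?_⟩
    exact (label_eq_ff_iff.1 hl).rel hm hn (label_eq_ff_iff.1 h.2)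
  · rw [LabelledPartition.partRel_col ofGroup_ne_F ht hg, hq]
    obtain ⟨hf, hc, hcol⟩ := (lab_eq_col_iff hm hn).1 hl
    change f.rank = i at hf
    have hfull := hc.colFull_height hn
    refine ⟨fun h => ⟨hp, hlab h, hf, ?_⟩, ?_⟩
    · subst hf
      obtain ⟨-, -, hcol'⟩ := (lab_eq_col_iff hm hn).1 (hlab h)
      obtain ⟨hH, -⟩ := hc.of_rel hm hn ((hc.colFull_iff hm hn (rank_le _) (rank_le _)).2 hcol) h
      obtain ⟨σ, rfl⟩ := o₁.exists_act_of_greenH hH rfl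
      refine ⟨σ, mem_colGroup hn (g := g) rfl ?_, rfl⟩
      exact θ.trans h (hfull _ _ _ (o₁.rank_act _ _ _) hcol' hcol)
    · rintro ⟨-, h, _, σ, hσ, rfl⟩
      obtain ⟨-, -, hcol'⟩ := (lab_eq_col_iff hm hn).1 h
      exact rel_of_mem_colGroup hn hfull hf hcol hcol' hσ
  · rw [LabelledPartition.partRel_row ofGroup_ne_F ht hg, hq]
    obtain ⟨hf, hc, hcol⟩ := (lab_eq_row_iff hm hn).1 hl
    change g.rank = j at hf
    have hfull := hc.colFull_height hm
    refine ⟨fun h => ⟨hp, hlab h, hf, ?_⟩, ?_⟩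
    · subst hf
      obtain ⟨-, -, hcol'⟩ := (lab_eq_row_iff hm hn).1 (hlab h)
      obtain ⟨hH, -⟩ := hc.of_rel hn hm ((hc.colFull_iff hn hm (rank_le _) (rank_le _)).2 hcol)
        (swap_rel.2 h)
      obtain ⟨σ, rfl⟩ := o₂.exists_act_of_greenH hH rfl
      refine ⟨σ, mem_colGroup hm (g := f) rfl ?_, rfl⟩
      exact (swap θ).trans (swap_rel.2 h) (hfull _ _ _ (o₂.rank_act _ _ _) hcol' hcol)
    · rintro ⟨-, h, _, σ, hσ, rfl⟩
      obtain ⟨-, -, hcol'⟩ := (lab_eq_row_iff hm hn).1 h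
      exact rel_of_mem_colGroup hm hfull hf hcol hcol' hσ
  · rw [LabelledPartition.partRel_cell ofGroup_ne_F ofGroup_ne_F ht hg, hq]
    obtain ⟨hf, hg, -, h₁, h₂⟩ := label_eq_cell_iff.1 hl
    refine ⟨fun h => ⟨hp, hlab h, hf, hg, ?_⟩, ?_⟩
    · obtain ⟨-, -, -, h₁', h₂'⟩ := label_eq_cell_iff.1 (hlab h)
      obtain ⟨τ, hτ⟩ := o₂.exists_act_of_greenH (greenH_snd_of_rel hm hn h h₁ h₁') hg
      obtain ⟨σ, hσ⟩ := o₁.exists_act_of_greenH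
        (greenH_snd_of_rel hn hm (swap_rel.2 h) h₂ h₂') hf
      refine ⟨(σ, τ), mem_cellGroup hf hg ?_, hσ, hτ⟩
      rw [← hσ, ← hτ]
      exact h
    · rintro ⟨-, -, hf, hg, σ, hσ, rfl, rfl⟩
      exact hσ f hf g hg

end ProductCon

namespace LabelledPartition

open Q CompType

variable {K : Kind} {m n : ℕ} {L : LabelledPartition K m n} {o₁ : ImageOrder K m}
  {o₂ : ImageOrder K n} {B B' : Set (Q K m × Q K n)} {p q : Q K m × Q K n}

theorem part_unique (hB : B ∈ L.parts) (hB' : B' ∈ L.parts) (hp : p ∈ B) (hp' : p ∈ B') :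
    B = B' :=
  (L.isPartition.2 p).unique ⟨hB, hp⟩ ⟨hB', hp'⟩

namespace Admissible

theorem col_part (hL : L.Admissible) (hB : B ∈ L.parts) {a : CompType} (ha : a ≠ F)
    (ht : L.ty B = (a, F)) : ∃ (i j : ℕ) (N : Subgroup (Equiv.Perm (Fin i))),
      i ∈ Set.Icc K.zeroStar m ∧ j ∈ Set.Icc 1 n ∧
      B = DSet K m n ({i} ×ˢ Set.Icc K.zeroStar j) ∧ L.grp B = PartGroup.left i N ∧ N.Normal ∧
      (a = H → 2 ≤ i ∧ N ≠ ⊥) ∧ (a = E → N = ⊥) := by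
  have h := hL.col_shape B hB (by cases a <;> simp_all)
  rw [ht] at h
  simpa using h

theorem row_part (hL : L.Admissible) (hB : B ∈ L.parts) {a : CompType} (ha : a ≠ F)
    (ht : L.ty B = (F, a)) : ∃ (i j : ℕ) (N : Subgroup (Equiv.Perm (Fin j))),
      i ∈ Set.Icc 1 m ∧ j ∈ Set.Icc K.zeroStar n ∧
      B = DSet K m n (Set.Icc K.zeroStar i ×ˢ {j}) ∧ L.grp B = PartGroup.right j N ∧ N.Normal ∧
      (a = H → 2 ≤ j ∧ N ≠ ⊥) ∧ (a = E → N = ⊥) := by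
  have h := hL.row_shape B hB (by cases a <;> simp_all)
  rw [ht] at h
  simpa using h

theorem rel_refl (hL : L.Admissible) (p : Q K m × Q K n) : L.rel o₁ o₂ p p := by
  obtain ⟨B, ⟨hB, hp⟩, -⟩ := L.isPartition.2 p
  refine ⟨B, hB, ?_⟩
  rcases ht : L.ty B with ⟨a, b⟩
  by_cases ha : a = F <;> by_cases hb : b = F
  · subst ha hb
    exact (partRel_ff ht).2 ⟨hp, hp⟩
  · subst ha
    obtain ⟨i, j, N, -, -, hBD, hg, -⟩ := hL.row_part hB hb ht
    have hr := hp
    rw [hBD] at hr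
    exact (partRel_row hb ht hg).2 ⟨hp, hp, hr.2, 1, N.one_mem, (o₂.act_one _ _).symm⟩
  · subst hb
    obtain ⟨i, j, N, -, -, hBD, hg, -⟩ := hL.col_part hB ha ht
    have hr := hp
    rw [hBD] at hr
    exact (partRel_col ha ht hg).2 ⟨hp, hp, hr.1, 1, N.one_mem, (o₁.act_one _ _).symm⟩
  · obtain ⟨i, j, N, -, -, hBD, hg, -⟩ := hL.cell_shape B hB (by rwa [ht]) (by rwa [ht])
    have hr := hp
    rw [hBD] at hr
    obtain ⟨h₁, h₂⟩ := Prod.mk.inj (show (p.1.rank, p.2.rank) = (i, j) from hr)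
    exact (partRel_cell ha hb ht hg).2 ⟨hp, hp, h₁, h₂, 1, N.one_mem, (o₁.act_one _ _).symm,
      (o₂.act_one _ _).symm⟩

theorem rel_symm (hL : L.Admissible) (h : L.rel o₁ o₂ p q) : L.rel o₁ o₂ q p := by
  obtain ⟨B, hB, h⟩ := h
  refine ⟨B, hB, ?_⟩
  rcases ht : L.ty B with ⟨a, b⟩
  obtain ⟨f, g⟩ := p
  obtain ⟨f', g'⟩ := q
  by_cases ha : a = F <;> by_cases hb : b = F
  · subst ha hb
    exact (partRel_ff ht).2 ((partRel_ff ht).1 h).symm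
  · subst ha
    obtain ⟨i, j, N, -, -, hBD, hg, -⟩ := hL.row_part hB hb ht
    obtain ⟨hp, hq, hr, σ, hσ, rfl⟩ := (partRel_row hb ht hg).1 h
    refine (partRel_row hb ht hg).2 ⟨hq, hp, o₂.rank_act _ _ _, σ⁻¹, N.inv_mem hσ, ?_⟩
    rw [o₂.act_act, inv_mul_cancel, o₂.act_one]
  · subst hb
    obtain ⟨i, j, N, -, -, hBD, hg, -⟩ := hL.col_part hB ha ht
    obtain ⟨hp, hq, hr, σ, hσ, rfl⟩ := (partRel_col ha ht hg).1 h
    refine (partRel_col ha ht hg).2 ⟨hq, hp, o₁.rank_act _ _ _, σ⁻¹, N.inv_mem hσ, ?_⟩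
    rw [o₁.act_act, inv_mul_cancel, o₁.act_one]
  · obtain ⟨i, j, N, -, -, hBD, hg, -⟩ := hL.cell_shape B hB (by rwa [ht]) (by rwa [ht])
    obtain ⟨hp, hq, hr₁, hr₂, σ, hσ, rfl, rfl⟩ := (partRel_cell ha hb ht hg).1 h
    refine (partRel_cell ha hb ht hg).2 ⟨hq, hp, o₁.rank_act _ _ _, o₂.rank_act _ _ _, σ⁻¹,
      N.inv_mem hσ, ?_, ?_⟩
    · rw [o₁.act_act, Prod.fst_inv, inv_mul_cancel, o₁.act_one]
    · rw [o₂.act_act, Prod.snd_inv, inv_mul_cancel, o₂.act_one]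

theorem rel_trans (hL : L.Admissible) {r : Q K m × Q K n} (h : L.rel o₁ o₂ p q)
    (h' : L.rel o₁ o₂ q r) : L.rel o₁ o₂ p r := by
  obtain ⟨B, hB, h⟩ := h
  obtain ⟨B', hB', h'⟩ := h'
  obtain rfl : B = B' := part_unique hB hB' h.2.1 h'.1
  refine ⟨B, hB, ?_⟩
  rcases ht : L.ty B with ⟨a, b⟩
  obtain ⟨f, g⟩ := p
  obtain ⟨f', g'⟩ := q
  obtain ⟨f'', g''⟩ := r
  by_cases ha : a = F <;> by_cases hb : b = F
  · subst ha hb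
    exact (partRel_ff ht).2 ⟨((partRel_ff ht).1 h).1, ((partRel_ff ht).1 h').2⟩
  · subst ha
    obtain ⟨i, j, N, -, -, hBD, hg, -⟩ := hL.row_part hB hb ht
    obtain ⟨hp, hq, hr, σ, hσ, rfl⟩ := (partRel_row hb ht hg).1 h
    obtain ⟨-, hq', hr', τ, hτ, rfl⟩ := (partRel_row hb ht hg).1 h'
    exact (partRel_row hb ht hg).2 ⟨hp, hq', hr, τ * σ, N.mul_mem hτ hσ, o₂.act_act _ _ _ _ _⟩
  · subst hb
    obtain ⟨i, j, N, -, -, hBD, hg, -⟩ := hL.col_part hB ha ht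
    obtain ⟨hp, hq, hr, σ, hσ, rfl⟩ := (partRel_col ha ht hg).1 h
    obtain ⟨-, hq', hr', τ, hτ, rfl⟩ := (partRel_col ha ht hg).1 h'
    exact (partRel_col ha ht hg).2 ⟨hp, hq', hr, τ * σ, N.mul_mem hτ hσ, o₁.act_act _ _ _ _ _⟩
  · obtain ⟨i, j, N, -, -, hBD, hg, -⟩ := hL.cell_shape B hB (by rwa [ht]) (by rwa [ht])
    obtain ⟨hp, hq, hr₁, hr₂, σ, hσ, rfl, rfl⟩ := (partRel_cell ha hb ht hg).1 h
    obtain ⟨-, hq', hr₁', hr₂', τ, hτ, rfl, rfl⟩ := (partRel_cell ha hb ht hg).1 h'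
    exact (partRel_cell ha hb ht hg).2 ⟨hp, hq', hr₁, hr₂, τ * σ, N.mul_mem hτ hσ,
      o₁.act_act _ _ _ _ _, o₂.act_act _ _ _ _ _⟩

theorem mem_of_ff (hL : L.Admissible) (hm : 1 ≤ m) (hn : 1 ≤ n) (hB : B ∈ L.parts)
    (ht : L.ty B = (F, F)) (hp : p ∈ B) (h₁ : q.1.rank ≤ p.1.rank)
    (h₂ : q.2.rank ≤ p.2.rank) : q ∈ B := by
  obtain ⟨P, -, hdown, rfl, -⟩ := hL.ff_shape B hB ht
  exact hdown _ hp _ ⟨rank_mem_Icc hm _, rank_mem_Icc hn _⟩ ⟨h₁, h₂⟩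

theorem ff_of_hf (hL : L.Admissible) (hm : 1 ≤ m) (hn : 1 ≤ n) (hB : B ∈ L.parts)
    (ht : L.ty B = (H, F)) : ∃ B' ∈ L.parts, L.ty B' = (F, F) ∧
      ∀ p ∈ B, ∀ q : Q K m × Q K n, q.1.rank < p.1.rank → q.2.rank ≤ p.2.rank → q ∈ B' := by
  obtain ⟨i, j, N, hi, hj, hBD, -⟩ := hL.col_part hB (by simp) ht
  obtain ⟨B', hB', ht', hs⟩ := hL.hf_place B hB ht i hi j hj hBD
  refine ⟨B', hB', ht', fun p hp q h₁ h₂ => hs ⟨⟨zeroStar_le_rank hm _, ?_⟩,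
    zeroStar_le_rank hn _, ?_⟩⟩ <;> rw [hBD] at hp
  · have : p.1.rank = i := hp.1
    change q.1.rank ≤ i - 1
    omega
  · exact h₂.trans hp.2.2

theorem ff_of_fh (hL : L.Admissible) (hm : 1 ≤ m) (hn : 1 ≤ n) (hB : B ∈ L.parts)
    (ht : L.ty B = (F, H)) : ∃ B' ∈ L.parts, L.ty B' = (F, F) ∧
      ∀ p ∈ B, ∀ q : Q K m × Q K n, q.1.rank ≤ p.1.rank → q.2.rank < p.2.rank → q ∈ B' := by
  obtain ⟨i, j, N, hi, hj, hBD, -⟩ := hL.row_part hB (by simp) ht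
  obtain ⟨B', hB', ht', hs⟩ := hL.fh_place B hB ht i hi j hj hBD
  refine ⟨B', hB', ht', fun p hp q h₁ h₂ => hs ⟨⟨zeroStar_le_rank hm _, ?_⟩,
    zeroStar_le_rank hn _, ?_⟩⟩ <;> rw [hBD] at hp
  · exact h₁.trans hp.1.2
  · have : p.2.rank = j := hp.2
    change q.2.rank ≤ j - 1
    omega

theorem rel_of_col_part (hL : L.Admissible) (hn : 1 ≤ n) (hB : B ∈ L.parts)
    {a : CompType} (ha : a ≠ F) (ht : L.ty B = (a, F)) (hp : p ∈ B) {h : Q K m} {k k' : Q K n}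
    (hh : h.rank = p.1.rank) (hk : k.rank ≤ p.2.rank) (hk' : k'.rank ≤ p.2.rank) :
    L.rel o₁ o₂ (h, k) (h, k') := by
  obtain ⟨i, j, N, -, -, hBD, hg, -⟩ := hL.col_part hB ha ht
  rw [hBD] at hp
  have hh' : h.rank = i := hh.trans hp.1
  refine ⟨B, hB, (partRel_col ha ht hg).2 ⟨?_, ?_, hh', 1, N.one_mem, (o₁.act_one _ _).symm⟩⟩
  · rw [hBD]; exact ⟨hh', zeroStar_le_rank hn _, hk.trans hp.2.2⟩
  · rw [hBD]; exact ⟨hh', zeroStar_le_rank hn _, hk'.trans hp.2.2⟩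

theorem rel_of_row_part (hL : L.Admissible) (hm : 1 ≤ m) (hB : B ∈ L.parts)
    {a : CompType} (ha : a ≠ F) (ht : L.ty B = (F, a)) (hp : p ∈ B) {h h' : Q K m} {k : Q K n}
    (hk : k.rank = p.2.rank) (hh : h.rank ≤ p.1.rank) (hh' : h'.rank ≤ p.1.rank) :
    L.rel o₁ o₂ (h, k) (h', k) := by
  obtain ⟨i, j, N, -, -, hBD, hg, -⟩ := hL.row_part hB ha ht
  rw [hBD] at hp
  have hk' : k.rank = j := hk.trans hp.2
  refine ⟨B, hB, (partRel_row ha ht hg).2 ⟨?_, ?_, hk', 1, N.one_mem, (o₂.act_one _ _).symm⟩⟩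
  · rw [hBD]; exact ⟨⟨zeroStar_le_rank hm _, hh.trans hp.1.2⟩, hk'⟩
  · rw [hBD]; exact ⟨⟨zeroStar_le_rank hm _, hh'.trans hp.1.2⟩, hk'⟩

/-- Below a part whose second component type is `F`, second coordinates are identified. -/
theorem rel_of_snd_eq_F (hL : L.Admissible) (hm : 1 ≤ m) (hn : 1 ≤ n) (hB : B ∈ L.parts)
    {a : CompType} (ht : L.ty B = (a, F)) (hp : p ∈ B) {h : Q K m} {k k' : Q K n}
    (hh : h.rank ≤ p.1.rank) (hk : k.rank ≤ p.2.rank) (hk' : k'.rank ≤ p.2.rank) :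
    L.rel o₁ o₂ (h, k) (h, k') := by
  have key : ∀ {a : CompType} {B : Set (Q K m × Q K n)} {p : Q K m × Q K n}, B ∈ L.parts →
      a ≠ E → L.ty B = (a, F) → p ∈ B → h.rank ≤ p.1.rank → k.rank ≤ p.2.rank →
      k'.rank ≤ p.2.rank → L.rel o₁ o₂ (h, k) (h, k') := by
    intro a B p hB ha ht hp hh hk hk'
    cases a
    · exact ⟨B, hB, (partRel_ff ht).2
        ⟨hL.mem_of_ff hm hn hB ht hp hh hk, hL.mem_of_ff hm hn hB ht hp hh hk'⟩⟩
    · rcases hh.eq_or_lt with he | hlt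
      · exact hL.rel_of_col_part hn hB (by simp) ht hp he hk hk'
      · obtain ⟨B', hB', ht', hs⟩ := hL.ff_of_hf hm hn hB ht
        exact ⟨B', hB', (partRel_ff ht').2 ⟨hs p hp _ hlt hk, hs p hp _ hlt hk'⟩⟩
    · exact absurd rfl ha
  by_cases ha : a = E
  · subst ha
    obtain ⟨i, j, N, hi, hj, hBD, -⟩ := hL.col_part hB (by simp) ht
    have hz : K.zeroStar ≤ 1 := zeroStar_le_one
    have hx : (i, j) ∈ L.colSet := ⟨hi, ⟨hz.trans hj.1, hj.2⟩, B, hB, ht, hBD⟩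
    have hp₁ : p.1.rank = i ∧ p.2.rank ≤ j := by
      rw [hBD] at hp
      exact ⟨hp.1, hp.2.2⟩
    by_cases hmem : h.rank ∈ Prod.fst '' L.colSet
    · obtain ⟨⟨i₁, j₁⟩, hy, hyh⟩ := hmem
      have hj₁ : j ≤ j₁ := hL.ef_antitone _ hy _ hx (hyh.le.trans (hh.trans hp₁.1.le))
      obtain ⟨hi₁, hj₁', B₁, hB₁, ht₁, hBD₁⟩ := hy
      obtain ⟨q, hq₁, hq₂⟩ := exists_pair hi₁ hj₁'
      have hq : q ∈ B₁ := by
        rw [hBD₁]; exact ⟨hq₁, zeroStar_le_rank hn _, hq₂.le⟩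
      refine hL.rel_of_col_part hn hB₁ (by simp) ht₁ hq (hyh.symm.trans hq₁.symm) ?_ ?_
      · exact (hk.trans (hp₁.2.trans hj₁)).trans hq₂.ge
      · exact (hk'.trans (hp₁.2.trans hj₁)).trans hq₂.ge
    · obtain ⟨i₀', hleast⟩ : ∃ i₀, IsLeast (Prod.fst '' L.colSet) i₀ :=
        ⟨_, isLeast_csInf ⟨_, _, hx, rfl⟩⟩
      obtain ⟨⟨i₀, j₀⟩, hy, hy₀⟩ := hleast.1
      change i₀ = i₀' at hy₀
      subst hy₀
      have hle : i₀ ≤ i := hleast.2 ⟨_, hx, rfl⟩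
      have hlt : h.rank < i₀ := by
        by_contra! hge
        exact hmem (hL.ef_consecutive.out hleast.1 ⟨_, hx, rfl⟩ ⟨hge, hh.trans hp₁.1.le⟩)
      have hj₀ : j ≤ j₀ := hL.ef_antitone _ hy _ hx hle
      have hz' := zeroStar_le_rank hm h
      obtain ⟨B', hB', ht', hs⟩ := hL.ef_place _ hy hleast (by change K.zeroStar < i₀; omega)
      change DSet K m n ({i₀ - 1} ×ˢ Set.Icc K.zeroStar j₀) ⊆ B' at hs
      have hi₀ : i₀ ≤ m := hy.1.2
      obtain ⟨q, hq₁, hq₂⟩ := exists_pair (K := K) (m := m) (i := i₀ - 1) ⟨by omega, by omega⟩ hy.2.1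
      change q.2.rank = j₀ at hq₂
      have hq : q ∈ B' := hs ⟨hq₁, zeroStar_le_rank hn _, hq₂.le⟩
      obtain ⟨b, hb, ht'⟩ : ∃ b, b ≠ E ∧ L.ty B' = (b, F) := by
        rcases ht' with ht' | ht' <;> exact ⟨_, by simp, ht'⟩
      refine key hB' hb ht' hq (by omega) ?_ ?_
      · exact (hk.trans (hp₁.2.trans hj₀)).trans hq₂.ge
      · exact (hk'.trans (hp₁.2.trans hj₀)).trans hq₂.ge
  · exact key hB ha ht hp hh hk hk'

/-- Below a part whose first component type is `F`, first coordinates are identified. -/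
theorem rel_of_fst_eq_F (hL : L.Admissible) (hm : 1 ≤ m) (hn : 1 ≤ n) (hB : B ∈ L.parts)
    {a : CompType} (ht : L.ty B = (F, a)) (hp : p ∈ B) {h h' : Q K m} {k : Q K n}
    (hk : k.rank ≤ p.2.rank) (hh : h.rank ≤ p.1.rank) (hh' : h'.rank ≤ p.1.rank) :
    L.rel o₁ o₂ (h, k) (h', k) := by
  have key : ∀ {a : CompType} {B : Set (Q K m × Q K n)} {p : Q K m × Q K n}, B ∈ L.parts →
      a ≠ E → L.ty B = (F, a) → p ∈ B → k.rank ≤ p.2.rank → h.rank ≤ p.1.rank →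
      h'.rank ≤ p.1.rank → L.rel o₁ o₂ (h, k) (h', k) := by
    intro a B p hB ha ht hp hk hh hh'
    cases a
    · exact ⟨B, hB, (partRel_ff ht).2
        ⟨hL.mem_of_ff hm hn hB ht hp hh hk, hL.mem_of_ff hm hn hB ht hp hh' hk⟩⟩
    · rcases hk.eq_or_lt with he | hlt
      · exact hL.rel_of_row_part hm hB (by simp) ht hp he hh hh'
      · obtain ⟨B', hB', ht', hs⟩ := hL.ff_of_fh hm hn hB ht
        exact ⟨B', hB', (partRel_ff ht').2 ⟨hs p hp _ hh hlt, hs p hp _ hh' hlt⟩⟩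
    · exact absurd rfl ha
  by_cases ha : a = E
  · subst ha
    obtain ⟨i, j, N, hi, hj, hBD, -⟩ := hL.row_part hB (by simp) ht
    have hz : K.zeroStar ≤ 1 := zeroStar_le_one
    have hx : (i, j) ∈ L.rowSet := ⟨⟨hz.trans hi.1, hi.2⟩, hj, B, hB, ht, hBD⟩
    have hp₁ : p.1.rank ≤ i ∧ p.2.rank = j := by
      rw [hBD] at hp
      exact ⟨hp.1.2, hp.2⟩
    by_cases hmem : k.rank ∈ Prod.snd '' L.rowSet
    · obtain ⟨⟨i₁, j₁⟩, hy, hyk⟩ := hmem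
      have hi₁ : i ≤ i₁ := hL.fe_antitone _ hy _ hx (hyk.le.trans (hk.trans hp₁.2.le))
      obtain ⟨hi₁', hj₁, B₁, hB₁, ht₁, hBD₁⟩ := hy
      obtain ⟨q, hq₁, hq₂⟩ := exists_pair hi₁' hj₁
      have hq : q ∈ B₁ := by
        rw [hBD₁]; exact ⟨⟨zeroStar_le_rank hm _, hq₁.le⟩, hq₂⟩
      refine hL.rel_of_row_part hm hB₁ (by simp) ht₁ hq (hyk.symm.trans hq₂.symm) ?_ ?_
      · exact (hh.trans (hp₁.1.trans hi₁)).trans hq₁.ge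
      · exact (hh'.trans (hp₁.1.trans hi₁)).trans hq₁.ge
    · obtain ⟨j₀', hleast⟩ : ∃ j₀, IsLeast (Prod.snd '' L.rowSet) j₀ :=
        ⟨_, isLeast_csInf ⟨_, _, hx, rfl⟩⟩
      obtain ⟨⟨i₀, j₀⟩, hy, hy₀⟩ := hleast.1
      change j₀ = j₀' at hy₀
      subst hy₀
      have hle : j₀ ≤ j := hleast.2 ⟨_, hx, rfl⟩
      have hlt : k.rank < j₀ := by
        by_contra! hge
        exact hmem (hL.fe_consecutive.out hleast.1 ⟨_, hx, rfl⟩ ⟨hge, hk.trans hp₁.2.le⟩)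
      have hi₀ : i ≤ i₀ := hL.fe_antitone _ hy _ hx hle
      have hz' := zeroStar_le_rank hn k
      obtain ⟨B', hB', ht', hs⟩ := hL.fe_place _ hy hleast (by change K.zeroStar < j₀; omega)
      change DSet K m n (Set.Icc K.zeroStar i₀ ×ˢ {j₀ - 1}) ⊆ B' at hs
      have hj₀ : j₀ ≤ n := hy.2.1.2
      obtain ⟨q, hq₁, hq₂⟩ := exists_pair (K := K) (n := n) (j := j₀ - 1) hy.1 ⟨by omega, by omega⟩
      change q.1.rank = i₀ at hq₁
      have hq : q ∈ B' := hs ⟨⟨zeroStar_le_rank hm _, hq₁.le⟩, hq₂⟩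
      obtain ⟨b, hb, ht'⟩ : ∃ b, b ≠ E ∧ L.ty B' = (F, b) := by
        rcases ht' with ht' | ht' <;> exact ⟨_, by simp, ht'⟩
      refine key hB' hb ht' hq (by omega) ?_ ?_
      · exact (hh.trans (hp₁.1.trans hi₀)).trans hq₁.ge
      · exact (hh'.trans (hp₁.1.trans hi₀)).trans hq₁.ge
  · exact key hB ha ht hp hk hh hh'

/-- In a part of type `Fℋ` the attached group is contained in the relation. -/
theorem rel_act_snd_of_row (hL : L.Admissible) (hm : 1 ≤ m) (hB : B ∈ L.parts)
    {a : CompType} (ha : a ≠ F) (ht : L.ty B = (F, a)) {j : ℕ}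
    {N : Subgroup (Equiv.Perm (Fin j))} (hg : L.grp B = PartGroup.right j N) (hp : p ∈ B)
    {h h' : Q K m} {k : Q K n} (hk : k.rank = j) (hh : h.rank ≤ p.1.rank)
    (hh' : h'.rank ≤ p.1.rank) {τ : Equiv.Perm (Fin j)} (hτ : τ ∈ N) :
    L.rel o₁ o₂ (h, k) (h', o₂.act k hk τ) := by
  obtain ⟨i', j', N', -, -, hBD, hg', -⟩ := hL.row_part hB ha ht
  rw [hg'] at hg
  cases hg
  rw [hBD] at hp
  refine ⟨B, hB, (partRel_row ha ht hg').2 ⟨?_, ?_, hk, τ, hτ, rfl⟩⟩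
  · rw [hBD]; exact ⟨⟨zeroStar_le_rank hm _, hh.trans hp.1.2⟩, hk⟩
  · rw [hBD]; exact ⟨⟨zeroStar_le_rank hm _, hh'.trans hp.1.2⟩, o₂.rank_act _ _ _⟩

/-- In a part of type `ℋF` the attached group is contained in the relation. -/
theorem rel_act_fst_of_col (hL : L.Admissible) (hn : 1 ≤ n) (hB : B ∈ L.parts)
    {a : CompType} (ha : a ≠ F) (ht : L.ty B = (a, F)) {i : ℕ}
    {N : Subgroup (Equiv.Perm (Fin i))} (hg : L.grp B = PartGroup.left i N) (hp : p ∈ B)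
    {h : Q K m} {k k' : Q K n} (hh : h.rank = i) (hk : k.rank ≤ p.2.rank)
    (hk' : k'.rank ≤ p.2.rank) {τ : Equiv.Perm (Fin i)} (hτ : τ ∈ N) :
    L.rel o₁ o₂ (h, k) (o₁.act h hh τ, k') := by
  obtain ⟨i', j', N', -, -, hBD, hg', -⟩ := hL.col_part hB ha ht
  rw [hg'] at hg
  cases hg
  rw [hBD] at hp
  refine ⟨B, hB, (partRel_col ha ht hg').2 ⟨?_, ?_, hh, τ, hτ, rfl⟩⟩
  · rw [hBD]; exact ⟨hh, zeroStar_le_rank hn _, hk.trans hp.2.2⟩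
  · rw [hBD]; exact ⟨o₁.rank_act _ _ _, zeroStar_le_rank hn _, hk'.trans hp.2.2⟩

theorem rel_act_of_cell (hB : B ∈ L.parts) {a b : CompType} (ha : a ≠ F) (hb : b ≠ F)
    (ht : L.ty B = (a, b)) {i j : ℕ} {N : Subgroup (Equiv.Perm (Fin i) × Equiv.Perm (Fin j))}
    (hBD : B = DSet K m n {(i, j)}) (hg : L.grp B = PartGroup.both i j N) {h : Q K m} {k : Q K n}
    (hh : h.rank = i) (hk : k.rank = j) {σ : Equiv.Perm (Fin i) × Equiv.Perm (Fin j)}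
    (hσ : σ ∈ N) : L.rel o₁ o₂ (h, k) (o₁.act h hh σ.1, o₂.act k hk σ.2) := by
  refine ⟨B, hB, (partRel_cell ha hb ht hg).2 ⟨?_, ?_, hh, hk, σ, hσ, rfl, rfl⟩⟩
  · rw [hBD]; exact Prod.ext hh hk
  · rw [hBD]; exact Prod.ext (o₁.rank_act _ _ _) (o₂.rank_act _ _ _)

theorem rel_of_eh (hL : L.Admissible) (hm : 1 ≤ m) (hn : 1 ≤ n) {i j : ℕ} (hB : B ∈ L.parts)
    (ht : L.ty B = (E, H)) {N : Subgroup (Equiv.Perm (Fin j))} (hBD : B = DSet K m n {(i, j)})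
    (hi : i ≤ m) (hg : L.grp B = PartGroup.both i j (Subgroup.prod ⊥ N))
    {τ : Equiv.Perm (Fin j)}
    (hτ : τ ∈ N) {h : Q K m} {k : Q K n} (hk : k.rank = j) (hh : h.rank ≤ i) :
    L.rel o₁ o₂ (h, k) (h, o₂.act k hk τ) := by
  have direct : ∀ {i : ℕ} {B : Set (Q K m × Q K n)} {b : CompType}
      {M : Subgroup (Equiv.Perm (Fin i) × Equiv.Perm (Fin j))}, B ∈ L.parts → b ≠ F →
      L.ty B = (b, H) → B = DSet K m n {(i, j)} → L.grp B = PartGroup.both i j M →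
      (1, τ) ∈ M → h.rank = i → L.rel o₁ o₂ (h, k) (h, o₂.act k hk τ) := by
    intro i B b M hB hb ht hBD hg hM hhi
    have := rel_act_of_cell (o₁ := o₁) (o₂ := o₂) hB hb (by simp) ht hBD hg hhi hk hM
    rwa [o₁.act_one] at this
  induction i generalizing B N with
  | zero => exact direct hB (by simp) ht hBD hg ⟨Subgroup.mem_bot.2 rfl, hτ⟩ (by omega)
  | succ i ih =>
    rcases hh.eq_or_lt with he | hlt
    · exact direct hB (by simp) ht hBD hg ⟨Subgroup.mem_bot.2 rfl, hτ⟩ he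
    have hhz := zeroStar_le_rank hm h
    have hj : j ∈ Set.Icc K.zeroStar n := hk ▸ rank_mem_Icc hn k
    obtain ⟨B', hB', hs, ht'⟩ := hL.eh_place_fst B hB ht _ _ N hBD hg (by omega)
    simp only [Nat.add_sub_cancel] at hs ht'
    obtain ⟨q, hq₁, hq₂⟩ := exists_pair (K := K) (m := m) (i := i) ⟨by omega, by omega⟩ hj
    have hq : q ∈ B' := hs (Prod.ext hq₁ hq₂)
    have hcol : ∀ {a : CompType}, L.ty B' = (a, F) →
        L.rel o₁ o₂ (h, k) (h, o₂.act k hk τ) := fun ht' =>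
      hL.rel_of_snd_eq_F hm hn hB' ht' hq (by omega) (by omega)
        (by rw [o₂.rank_act]; omega)
    have hrow : ∀ {B' : Set (Q K m × Q K n)}, B' ∈ L.parts → L.ty B' = (F, H) → ∀ {M}, L.grp B' = PartGroup.right j M →
        τ ∈ M → ∀ q ∈ B', h.rank ≤ q.1.rank → L.rel o₁ o₂ (h, k) (h, o₂.act k hk τ) :=
      fun hB' ht' M hM hτM q hq hle =>
        hL.rel_act_snd_of_row hm hB' (by simp) ht' hM hq hk hle hle hτM
    rcases ht' with ht' | ht' | ht' | ⟨ht', M, hM, hle⟩ | ⟨ht', M, hM, hle⟩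
    · exact hcol ht'
    · exact hcol ht'
    · exact hcol ht'
    · exact hrow hB' ht' hM (hle hτ) q hq (by omega)
    have hτM : (1, τ) ∈ M := hle ⟨Subgroup.mem_bot.2 rfl, hτ⟩
    obtain ⟨b, hb, ht''⟩ : ∃ b, b ≠ F ∧ L.ty B' = (b, H) := by
      rcases ht' with ht' | ht' <;> exact ⟨_, by simp, ht'⟩
    obtain ⟨i', j', M', hi', hj', hBD', hM', -, c₁, c₂, -⟩ :=
      hL.cell_shape B' hB' (by rw [ht'']; exact hb) (by rw [ht'']; simp)
    rw [hM'] at hM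
    cases hM
    rcases (show h.rank ≤ i by omega).eq_or_lt with he | hlt'
    · exact direct hB' hb ht'' hBD' hM' hτM he
    rcases ht' with ht' | ht'
    · obtain ⟨B'', hB'', hs', h''⟩ := hL.hh_place_fst B' hB' ht' _ _ _ hBD' hM'
      obtain ⟨r, hr₁, hr₂⟩ := exists_pair (K := K) (m := m) (i := i - 1) ⟨by omega, by omega⟩ hj
      have hr : r ∈ B'' := hs' (Prod.ext hr₁ hr₂)
      rcases h'' with h'' | ⟨h'', M'', hg'', hle''⟩
      · exact hL.rel_of_snd_eq_F hm hn hB'' h'' hr (by omega) (by omega)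
          (by rw [o₂.rank_act]; omega)
      · exact hrow hB'' h'' hg'' (hle'' ⟨(1, τ), hτM, rfl⟩) r hr (by omega)
    · obtain ⟨-, N'', -, rfl⟩ := c₂ ht'
      exact ih hB' ht' hBD' (by omega) hM' hτM.2 (by omega)

theorem rel_of_he (hL : L.Admissible) (hm : 1 ≤ m) (hn : 1 ≤ n) {i j : ℕ} (hB : B ∈ L.parts)
    (ht : L.ty B = (H, E)) {N : Subgroup (Equiv.Perm (Fin i))} (hBD : B = DSet K m n {(i, j)})
    (hj : j ≤ n) (hg : L.grp B = PartGroup.both i j (Subgroup.prod N ⊥))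
    {τ : Equiv.Perm (Fin i)}
    (hτ : τ ∈ N) {h : Q K m} {k : Q K n} (hh : h.rank = i) (hk : k.rank ≤ j) :
    L.rel o₁ o₂ (h, k) (o₁.act h hh τ, k) := by
  have direct : ∀ {j : ℕ} {B : Set (Q K m × Q K n)} {b : CompType}
      {M : Subgroup (Equiv.Perm (Fin i) × Equiv.Perm (Fin j))}, B ∈ L.parts → b ≠ F →
      L.ty B = (H, b) → B = DSet K m n {(i, j)} → L.grp B = PartGroup.both i j M →
      (τ, 1) ∈ M → k.rank = j → L.rel o₁ o₂ (h, k) (o₁.act h hh τ, k) := by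
    intro j B b M hB hb ht hBD hg hM hkj
    have := rel_act_of_cell (o₁ := o₁) (o₂ := o₂) hB (by simp) hb ht hBD hg hh hkj hM
    rwa [o₂.act_one] at this
  induction j generalizing B N with
  | zero => exact direct hB (by simp) ht hBD hg ⟨hτ, Subgroup.mem_bot.2 rfl⟩ (by omega)
  | succ j ih =>
    rcases hk.eq_or_lt with he | hlt
    · exact direct hB (by simp) ht hBD hg ⟨hτ, Subgroup.mem_bot.2 rfl⟩ he
    have hkz := zeroStar_le_rank hn k
    have hi : i ∈ Set.Icc K.zeroStar m := hh ▸ rank_mem_Icc hm h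
    obtain ⟨B', hB', hs, ht'⟩ := hL.he_place_snd B hB ht _ _ N hBD hg (by omega)
    simp only [Nat.add_sub_cancel] at hs ht'
    obtain ⟨q, hq₁, hq₂⟩ := exists_pair (K := K) (n := n) (j := j) hi ⟨by omega, by omega⟩
    have hq : q ∈ B' := hs (Prod.ext hq₁ hq₂)
    have hrow : ∀ {a : CompType}, L.ty B' = (F, a) →
        L.rel o₁ o₂ (h, k) (o₁.act h hh τ, k) := fun ht' =>
      hL.rel_of_fst_eq_F hm hn hB' ht' hq (by omega) (by omega)
        (by rw [o₁.rank_act]; omega)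
    have hcol : ∀ {B' : Set (Q K m × Q K n)}, B' ∈ L.parts → L.ty B' = (H, F) → ∀ {M}, L.grp B' = PartGroup.left i M →
        τ ∈ M → ∀ q ∈ B', k.rank ≤ q.2.rank → L.rel o₁ o₂ (h, k) (o₁.act h hh τ, k) :=
      fun hB' ht' M hM hτM q hq hle =>
        hL.rel_act_fst_of_col hn hB' (by simp) ht' hM hq hh hle hle hτM
    rcases ht' with ht' | ht' | ht' | ⟨ht', M, hM, hle⟩ | ⟨ht', M, hM, hle⟩
    · exact hrow ht'
    · exact hrow ht'
    · exact hrow ht'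
    · exact hcol hB' ht' hM (hle hτ) q hq (by omega)
    have hτM : (τ, 1) ∈ M := hle ⟨hτ, Subgroup.mem_bot.2 rfl⟩
    obtain ⟨b, hb, ht''⟩ : ∃ b, b ≠ F ∧ L.ty B' = (H, b) := by
      rcases ht' with ht' | ht' <;> exact ⟨_, by simp, ht'⟩
    obtain ⟨i', j', M', hi', hj', hBD', hM', -, c₁, -, c₂, -⟩ :=
      hL.cell_shape B' hB' (by rw [ht'']; simp) (by rw [ht'']; exact hb)
    rw [hM'] at hM
    cases hM
    rcases (show k.rank ≤ j by omega).eq_or_lt with he | hlt'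
    · exact direct hB' hb ht'' hBD' hM' hτM he
    rcases ht' with ht' | ht'
    · obtain ⟨B'', hB'', hs', h''⟩ := hL.hh_place_snd B' hB' ht' _ _ _ hBD' hM'
      obtain ⟨r, hr₁, hr₂⟩ := exists_pair (K := K) (n := n) (j := j - 1) hi ⟨by omega, by omega⟩
      have hr : r ∈ B'' := hs' (Prod.ext hr₁ hr₂)
      rcases h'' with h'' | ⟨h'', M'', hg'', hle''⟩
      · exact hL.rel_of_fst_eq_F hm hn hB'' h'' hr (by omega) (by omega)
          (by rw [o₁.rank_act]; omega)
      · exact hcol hB'' h'' hg'' (hle'' ⟨(τ, 1), hτM, rfl⟩) r hr (by omega)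
    · obtain ⟨-, N'', -, rfl⟩ := c₂ ht'
      exact ih hB' ht' hBD' (by omega) hM' hτM.1 (by omega)

/-- The relation of an admissible labelled partition is compatible with multiplication. -/
theorem rel_mul_mul (hL : L.Admissible) (hm : 1 ≤ m) (hn : 1 ≤ n) {f f' : Q K m} {g g' : Q K n}
    (h : L.rel o₁ o₂ (f, g) (f', g')) (s t : Q K m) (u v : Q K n) :
    L.rel o₁ o₂ (s * f * t, u * g * v) (s * f' * t, u * g' * v) := by
  have r₁ : ∀ a : Q K m, (s * a * t).rank ≤ a.rank := fun a => rank_mul_mul_le _ _ _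
  have r₂ : ∀ a : Q K n, (u * a * v).rank ≤ a.rank := fun a => rank_mul_mul_le _ _ _
  obtain ⟨B, hB, h⟩ := h
  rcases ht : L.ty B with ⟨a, b⟩
  by_cases ha : a = F <;> by_cases hb : b = F
  · subst ha hb
    obtain ⟨hp, hq⟩ := (partRel_ff ht).1 h
    exact ⟨B, hB, (partRel_ff ht).2 ⟨hL.mem_of_ff hm hn hB ht hp (r₁ _) (r₂ _),
      hL.mem_of_ff hm hn hB ht hq (r₁ _) (r₂ _)⟩⟩
  · subst ha
    obtain ⟨i, j, N, -, -, hBD, hg, hN, -, hE⟩ := hL.row_part hB hb ht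
    obtain ⟨hp, hq, hr, σ, hσ, rfl⟩ := (partRel_row hb ht hg).1 h
    obtain ⟨r, hrB, hr₁, hr₁', hr₂⟩ : ∃ r ∈ B, f.rank ≤ r.1.rank ∧ f'.rank ≤ r.1.rank ∧
        r.2.rank = j := by
      rcases le_total f.rank f'.rank with hle | hle
      · exact ⟨_, hq, hle, le_rfl, o₂.rank_act _ _ _⟩
      · exact ⟨_, hp, le_rfl, hle, hr⟩
    rcases ((r₂ g).trans hr.le).eq_or_lt with he | hlt
    · obtain ⟨ρ, hρ⟩ := o₂.exists_conj_of_rank_mul_mul hr he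
      rw [hρ]
      exact hL.rel_act_snd_of_row hm hB hb ht hg hrB he ((r₁ _).trans hr₁)
        ((r₁ _).trans hr₁') (hN.conj_mem _ hσ _)
    · cases b
      · exact absurd rfl hb
      · obtain ⟨B', hB', ht', hs⟩ := hL.ff_of_fh hm hn hB ht
        refine ⟨B', hB', (partRel_ff ht').2 ⟨hs r hrB _ ((r₁ _).trans hr₁) ?_,
          hs r hrB _ ((r₁ _).trans hr₁') ?_⟩⟩
        · rwa [hr₂]
        · rw [hr₂]
          exact o₂.rank_mul_act_mul_lt hr hlt σ
      · obtain rfl : σ = 1 := by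
          rw [hE rfl] at hσ
          exact Subgroup.mem_bot.1 hσ
        rw [o₂.act_one]
        exact hL.rel_of_fst_eq_F hm hn hB ht hrB (hr₂ ▸ hlt.le) ((r₁ _).trans hr₁)
          ((r₁ _).trans hr₁')
  · subst hb
    obtain ⟨i, j, N, -, -, hBD, hg, hN, -, hE⟩ := hL.col_part hB ha ht
    obtain ⟨hp, hq, hr, σ, hσ, rfl⟩ := (partRel_col ha ht hg).1 h
    obtain ⟨r, hrB, hr₁, hr₁', hr₂⟩ : ∃ r ∈ B, g.rank ≤ r.2.rank ∧ g'.rank ≤ r.2.rank ∧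
        r.1.rank = i := by
      rcases le_total g.rank g'.rank with hle | hle
      · exact ⟨_, hq, hle, le_rfl, o₁.rank_act _ _ _⟩
      · exact ⟨_, hp, le_rfl, hle, hr⟩
    rcases ((r₁ f).trans hr.le).eq_or_lt with he | hlt
    · obtain ⟨ρ, hρ⟩ := o₁.exists_conj_of_rank_mul_mul hr he
      rw [hρ]
      exact hL.rel_act_fst_of_col hn hB ha ht hg hrB he ((r₂ _).trans hr₁)
        ((r₂ _).trans hr₁') (hN.conj_mem _ hσ _)
    · cases a
      · exact absurd rfl ha
      · obtain ⟨B', hB', ht', hs⟩ := hL.ff_of_hf hm hn hB ht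
        refine ⟨B', hB', (partRel_ff ht').2 ⟨hs r hrB _ ?_ ((r₂ _).trans hr₁),
          hs r hrB _ ?_ ((r₂ _).trans hr₁')⟩⟩
        · rwa [hr₂]
        · rw [hr₂]
          exact o₁.rank_mul_act_mul_lt hr hlt σ
      · obtain rfl : σ = 1 := by
          rw [hE rfl] at hσ
          exact Subgroup.mem_bot.1 hσ
        rw [o₁.act_one]
        exact hL.rel_of_snd_eq_F hm hn hB ht hrB (hr₂ ▸ hlt.le) ((r₂ _).trans hr₁)
          ((r₂ _).trans hr₁')
  · obtain ⟨i, j, N, hi, hj, hBD, hg, hN, cHH, cEH, cHE, cEE⟩ :=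
      hL.cell_shape B hB (by rwa [ht]) (by rwa [ht])
    obtain ⟨hp, hq, hf, hg₂, σ, hσ, rfl, rfl⟩ := (partRel_cell ha hb ht hg).1 h
    change f.rank = i at hf
    change g.rank = j at hg₂
    change L.rel o₁ o₂ (s * f * t, u * g * v)
      (s * o₁.act f hf σ.1 * t, u * o₂.act g hg₂ σ.2 * v)
    have low₁ := fun h => o₁.rank_mul_act_mul_lt (s := s) (t := t) hf h σ.1
    have low₂ := fun h => o₂.rank_mul_act_mul_lt (s := u) (t := v) hg₂ h σ.2
    have hz₁ := zeroStar_le_rank hm (s * f * t)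
    have hz₂ := zeroStar_le_rank hn (u * g * v)
    have cases₁ := ((r₁ f).trans hf.le).eq_or_lt
    have cases₂ := ((r₂ g).trans hg₂.le).eq_or_lt
    have below : j ≠ K.zeroStar → ∀ {B'}, DSet K m n {(i, j - 1)} ⊆ B' →
        ∃ r ∈ B', r.1.rank = i ∧ r.2.rank = j - 1 := by
      intro hne B' hs
      obtain ⟨r, hr₁, hr₂⟩ := exists_pair (K := K) (n := n) (j := j - 1) hi
        ⟨by have := hj.1; omega, by have := hj.2; omega⟩
      exact ⟨r, hs (Prod.ext hr₁ hr₂), hr₁, hr₂⟩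
    have left : i ≠ K.zeroStar → ∀ {B'}, DSet K m n {(i - 1, j)} ⊆ B' →
        ∃ r ∈ B', r.1.rank = i - 1 ∧ r.2.rank = j := by
      intro hne B' hs
      obtain ⟨r, hr₁, hr₂⟩ := exists_pair (K := K) (m := m) (i := i - 1)
        ⟨by have := hi.1; omega, by have := hi.2; omega⟩ hj
      exact ⟨r, hs (Prod.ext hr₁ hr₂), hr₁, hr₂⟩
    cases a <;> cases b
    any_goals exact absurd rfl ha
    any_goals exact absurd rfl hb
    · rcases cases₁ with e₁ | l₁
      · obtain ⟨ρ₁, hρ₁⟩ := o₁.exists_conj_of_rank_mul_mul hf e₁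
        rcases cases₂ with e₂ | l₂
        · obtain ⟨ρ₂, hρ₂⟩ := o₂.exists_conj_of_rank_mul_mul hg₂ e₂
          rw [hρ₁, hρ₂]
          exact rel_act_of_cell hB ha hb ht hBD hg e₁ e₂ (hN.conj_mem _ hσ (ρ₁, ρ₂))
        · obtain ⟨B', hB', hs, h'⟩ := hL.hh_place_snd B hB ht _ _ _ hBD hg
          obtain ⟨r, hr, hr₁, hr₂⟩ := below (by omega) hs
          have := low₂ l₂
          rcases h' with h' | ⟨h', N', hg', hle⟩
          · exact ⟨B', hB', (partRel_ff h').2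
              ⟨hL.mem_of_ff hm hn hB' h' hr (hr₁ ▸ e₁.le) (by change (u * g * v).rank ≤ _; omega),
                hL.mem_of_ff hm hn hB' h' hr (((r₁ _).trans (o₁.rank_act _ _ _).le).trans hr₁.ge)
                  (by change (u * _ * v).rank ≤ _; omega)⟩⟩
          · rw [hρ₁]
            have hN' : N'.Normal := by
              obtain ⟨i', j', N'', -, -, -, hg'', hN'', -⟩ := hL.col_part hB' (by simp) h'
              rw [hg''] at hg'
              cases hg'
              exact hN''
            exact hL.rel_act_fst_of_col hn hB' (by simp) h' hg' hr e₁ (by omega) (by omega)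
              (hN'.conj_mem _ (hle ⟨σ, hσ, rfl⟩) _)
      · have := low₁ l₁
        rcases cases₂ with e₂ | l₂
        · obtain ⟨ρ₂, hρ₂⟩ := o₂.exists_conj_of_rank_mul_mul hg₂ e₂
          obtain ⟨B', hB', hs, h'⟩ := hL.hh_place_fst B hB ht _ _ _ hBD hg
          obtain ⟨r, hr, hr₁, hr₂⟩ := left (by omega) hs
          rcases h' with h' | ⟨h', N', hg', hle⟩
          · exact ⟨B', hB', (partRel_ff h').2
              ⟨hL.mem_of_ff hm hn hB' h' hr (by change (s * f * t).rank ≤ _; omega) (hr₂ ▸ e₂.le),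
                hL.mem_of_ff hm hn hB' h' hr (by change (s * _ * t).rank ≤ _; omega)
                  (((r₂ _).trans (o₂.rank_act _ _ _).le).trans hr₂.ge)⟩⟩
          · rw [hρ₂]
            have hN' : N'.Normal := by
              obtain ⟨i', j', N'', -, -, -, hg'', hN'', -⟩ := hL.row_part hB' (by simp) h'
              rw [hg''] at hg'
              cases hg'
              exact hN''
            exact hL.rel_act_snd_of_row hm hB' (by simp) h' hg' hr e₂ (by omega) (by omega)
              (hN'.conj_mem _ (hle ⟨σ, hσ, rfl⟩) _)
        · have := low₂ l₂
          obtain ⟨B', hB', hs, h'⟩ := hL.hh_place_snd B hB ht _ _ _ hBD hg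
          obtain ⟨r, hr, hr₁, hr₂⟩ := below (by omega) hs
          rcases h' with h' | ⟨h', -⟩
          · exact ⟨B', hB', (partRel_ff h').2
              ⟨hL.mem_of_ff hm hn hB' h' hr (by change (s * f * t).rank ≤ _; omega)
                (by change (u * g * v).rank ≤ _; omega),
                hL.mem_of_ff hm hn hB' h' hr (by change (s * _ * t).rank ≤ _; omega)
                (by change (u * _ * v).rank ≤ _; omega)⟩⟩
          · obtain ⟨B'', hB'', h'', hs''⟩ := hL.ff_of_hf hm hn hB' h'
            exact ⟨B'', hB'', (partRel_ff h'').2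
              ⟨hs'' r hr _ (hr₁ ▸ l₁) (by change (u * g * v).rank ≤ _; omega),
                hs'' r hr _ (hr₁ ▸ low₁ l₁) (by change (u * _ * v).rank ≤ _; omega)⟩⟩
    · obtain ⟨-, N', -, rfl⟩ := cHE ht
      obtain ⟨σ₁, σ₂⟩ := σ
      obtain rfl : σ₂ = 1 := Subgroup.mem_bot.1 hσ.2
      simp only [o₂.act_one]
      have hN' : ∀ ρ, ρ * σ₁ * ρ⁻¹ ∈ N' := fun ρ => (hN.conj_mem _ hσ (ρ, 1)).1
      rcases cases₁ with e₁ | l₁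
      · obtain ⟨ρ₁, hρ₁⟩ := o₁.exists_conj_of_rank_mul_mul hf e₁
        rw [hρ₁]
        exact hL.rel_of_he hm hn hB ht hBD hj.2 hg (hN' _) e₁ ((r₂ _).trans hg₂.le)
      · have := low₁ l₁
        obtain ⟨B', hB', hs, h'⟩ := hL.he_place_fst B hB ht _ _ hBD
        obtain ⟨r, hr, hr₁, hr₂⟩ := left (by omega) hs
        obtain ⟨b, h'⟩ : ∃ b, L.ty B' = (F, b) := by
          rcases h' with h' | h' | h' <;> exact ⟨_, h'⟩
        exact hL.rel_of_fst_eq_F hm hn hB' h' hr (((r₂ _).trans hg₂.le).trans hr₂.ge)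
          (by omega) (by simp only at this; omega)
    · obtain ⟨-, N', -, rfl⟩ := cEH ht
      obtain ⟨σ₁, σ₂⟩ := σ
      obtain rfl : σ₁ = 1 := Subgroup.mem_bot.1 hσ.1
      simp only [o₁.act_one]
      have hN' : ∀ ρ, ρ * σ₂ * ρ⁻¹ ∈ N' := fun ρ => (hN.conj_mem _ hσ (1, ρ)).2
      rcases cases₂ with e₂ | l₂
      · obtain ⟨ρ₂, hρ₂⟩ := o₂.exists_conj_of_rank_mul_mul hg₂ e₂
        rw [hρ₂]
        exact hL.rel_of_eh hm hn hB ht hBD hi.2 hg (hN' _) e₂ ((r₁ _).trans hf.le)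
      · have := low₂ l₂
        obtain ⟨B', hB', hs, h'⟩ := hL.eh_place_snd B hB ht _ _ hBD
        obtain ⟨r, hr, hr₁, hr₂⟩ := below (by omega) hs
        obtain ⟨b, h'⟩ : ∃ b, L.ty B' = (b, F) := by
          rcases h' with h' | h' | h' <;> exact ⟨_, h'⟩
        exact hL.rel_of_snd_eq_F hm hn hB' h' hr (((r₁ _).trans hf.le).trans hr₁.ge)
          (by omega) (by simp only at this; omega)
    · have hσ' := cEE ht ▸ hσ
      obtain ⟨σ₁, σ₂⟩ := σ
      obtain rfl : σ₁ = 1 := Subgroup.mem_bot.1 hσ'.1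
      obtain rfl : σ₂ = 1 := Subgroup.mem_bot.1 hσ'.2
      simp only [o₁.act_one, o₂.act_one]
      exact hL.rel_refl _

end Admissible

end LabelledPartition

theorem one_le_of_nontrivial {K : Kind} {m : ℕ} (h : Nontrivial (Q K m)) : 1 ≤ m := by
  by_contra h0
  obtain rfl : m = 0 := by omega
  obtain ⟨x, y, hxy⟩ := h
  exact hxy (Q.ext' fun i => i.elim0)

theorem theorem4p10 (K : Kind) (m n : ℕ) (hm : Nontrivial (Q K m)) (hn : Nontrivial (Q K n))
    (o₁ : ImageOrder K m) (o₂ : ImageOrder K n) :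
    (∀ L : LabelledPartition K m n, L.Admissible →
      ∃ θ : Con (Q K m × Q K n), ∀ p q, θ p q ↔ L.rel o₁ o₂ p q) ∧
    (∀ θ : Con (Q K m × Q K n), ∃ L : LabelledPartition K m n, L.Admissible ∧
      ∀ p q, θ p q ↔ L.rel o₁ o₂ p q) := by
  have hm' := one_le_of_nontrivial hm
  have hn' := one_le_of_nontrivial hn
  refine ⟨fun L hL => ?_, fun θ => ⟨ProductCon.partition θ o₁ o₂,
    ProductCon.partition_admissible hm' hn' θ o₁ o₂,
    ProductCon.rel_iff_partition_rel hm' hn' θ o₁ o₂⟩⟩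
  refine ⟨{ r := L.rel o₁ o₂
            iseqv := ⟨hL.rel_refl, hL.rel_symm, hL.rel_trans⟩
            mul' := ?_ }, fun p q => Iff.rfl⟩
  rintro ⟨f, g⟩ ⟨f', g'⟩ ⟨a, b⟩ ⟨a', b'⟩ h h'
  have h₁ := hL.rel_mul_mul hm' hn' h 1 a 1 b
  have h₂ := hL.rel_mul_mul hm' hn' h' f' 1 g' 1
  simp only [one_mul, mul_one] at h₁ h₂
  exact hL.rel_trans h₁ h₂
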